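/- Let $\mathfrak g$ be a finite-dimensional simple Lie algebra over $\mathbb C$ with Cartan subalgebra $\mathfrak h$, set of roots $\Phi$, root spaces $\mathfrak g_\alpha$ and root lattice $Q$. Let $\langle\cdot,\cdot\rangle$ be the Killing form normalized so that $\langle\alpha,\alpha\rangle=2$ for long roots; use it to identify $\mathfrak h^*$ with $\mathfrak h$. Let $\hat{\mathfrak g}=\mathfrak g\otimes\mathbb C[t,t^{-1}]\oplus\mathbb C c$ be the affine Lie algebra, with $c$ central and $[a(m),b(n)]=[a,b](m+n)+m\langle a,b\rangle\delta_{m+n,0}c$, where $a(n)=a\otimes t^n$; put $a(z)=\sum_{n\in\mathbb Z}a(n)z^{-n-1}$. Let $\ell\in\mathbb C^\times$. Let $M(\ell,0)=U(\hat{\mathfrak g})\otimes_{U(\mathfrak g\otimes\mathbb C[t]+\mathbb C c)}\mathbb C_\ell$ be the generalized Verma module, where $\mathfrak g\otimes\mathbb C[t]$ acts on $\mathbb C_\ell=\mathbb C$ as $0$ and $c$ as $\ell$, with highest weight vector $\mathbf 1=1\otimes 1$, graded by giving $a_1(n_1)\cdots a_r(n_r)\mathbf 1$ degree $-n_1-\cdots-n_r$.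 Let $L(\ell,0)$ be its irreducible quotient by the largest proper graded submodule, and write $\mathbf 1$ also for the image of $\mathbf 1$ there. Let $V=M(\ell,0)$ or $V=L(\ell,0)$, and let $$\Omega_V=\{w\in V: h(n)w=0\text{ for all }h\in\mathfrak h,\ n\ge 1\},\qquad \Omega_V^\beta=\{w\in\Omega_V: h(0)w=\langle\beta,h\rangle w\text{ for all }h\in\mathfrak h\}\quad(\beta\in Q).$$ For $a\in\mathfrak g_\alpha$, $\alpha\in\Phi$, put $$\psi(a,z)=E^-(\tfrac1\ell\alpha,z)\,a(z)\,E^+(\tfrac1\ell\alpha,z)\,z^{-\alpha(0)/\ell},\qquad E^{\pm}(h,z)=\exp\Big(\sum_{\pm n\ge 1}\frac{h(n)}{n}z^{-n}\Big),$$ where $z^{-\alpha(0)/\ell}w=z^{-\langle\alpha,\beta\rangle/\ell}w$ if $w$ has weight $\beta$. A generalized vertex algebra associated with an abelian group $G$, a symmetric $\mathbb Z$-bilinear form $(\cdot,\cdot):G\times G\to\mathbb C/2\mathbb Z$ and an alternating $\mathbb Z$-bilinear form $c(\cdot,\cdot):G\times G\to\mathbb C^\times$ is a $G$-graded complex vector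 space $U=\bigoplus_{g\in G}U^g$ with a linear map $u\mapsto Y(u,z)=\sum_{n\in\mathbb C}u_nz^{-n-1}$ from $U$ to the formal series with complex exponents and coefficients in $\operatorname{End}U$, and a vector $\mathbf 1\in U^0$, such that for $u\in U^g$, $v\in U^h$, $w\in U^{g'}$ and $l\in\mathbb C$: (i) $u_lU^h\subset U^{g+h}$; $u_lv=0$ if $\operatorname{Re}l$ is sufficiently large; $u_lv=0$ unless $l\equiv(g,h)$ mod $\mathbb Z$; (ii) $Y(\mathbf 1,z)=1$, $Y(v,z)\mathbf 1\in U[[z]]$ and $v_{-1}\mathbf 1=v$; (iii) with $\delta(x)=\sum_{n\in\mathbb Z}x^n$ and binomials expanded in nonnegative powers of the second variable, $$z_0^{-1}\Big(\frac{z_1-z_2}{z_0}\Big)^{(g,h)}\delta\Big(\frac{z_1-z_2}{z_0}\Big)Y(u,z_1)Y(v,z_2)w-c(g,h)z_0^{-1}\Big(\frac{z_2-z_1}{z_0}\Big)^{(g,h)}\delta\Big(\frac{z_2-z_1}{-z_0}\Big)Y(v,z_2)Y(u,z_1)w$$ $$=z_2^{-1}\Big(\frac{z_1-z_0}{z_2}\Big)^{-(g,g')}\delta\Big(\frac{z_1-z_0}{z_2}\Big)Y(Y(u,z_0)v,z_2)w.$$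 **Theorem.** The vector $\mathbf 1$ and the vectors $a=a(-1)\mathbf 1$ ($a\in\mathfrak g_\alpha$, $\alpha\in\Phi$) lie in $\Omega_V$, and there is a unique generalized vertex algebra structure $Y_\Omega$ on $\Omega_V=\bigoplus_{\beta\in Q}\Omega_V^\beta$, associated with $G=Q$, $c(\cdot,\cdot)=1$ and $(\cdot,\cdot)=\frac1\ell\langle\cdot,\cdot\rangle$ mod $2\mathbb Z$, such that $Y_\Omega(\mathbf 1,z)=1$ and $$Y_\Omega(a,z)=\psi(a,z)\qquad\text{for } a\in\mathfrak g_\alpha,\ \alpha\in\Phi.$$ Its vacuum vector is $\mathbf 1$. Furthermore, $\Omega_V$ is generated by the subspaces $\mathfrak g_\alpha$ ($\alpha\in\Phi$): the only subspace of $\Omega_V$ that contains $\mathbf 1$ and all $\mathfrak g_\alpha$ and is closed under all products $u_nv$ ($n\in\mathbb C$) is $\Omega_V$ itself. -/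

import Mathlib

noncomputable section

namespace ZAlgebra

/-! ## Generalized vertex algebras -/

/-- The data to which a generalized vertex algebra is associated: a symmetric biadditive
`ℂ/2ℤ`-valued form `(·,·)` and an alternating biadditive `ℂˣ`-valued form `c(·,·)` on an abelian
group `G`. -/
structure GradingForms (G : Type*) [AddCommGroup G] where
  /-- the form `(·,·)` with values in `ℂ/2ℤ` -/
  form : G →+ G →+ (ℂ ⧸ AddSubgroup.zmultiples (2 : ℂ))
  form_symm : ∀ g h, form g h = form h g
  /-- the form `c(·,·)` with values in `ℂˣ` -/
  c : G → G → ℂˣ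
  c_add_left : ∀ g g' h, c (g + g') h = c g h * c g' h
  c_add_right : ∀ g h h', c g (h + h') = c g h * c g h'
  c_self : ∀ g, c g g = 1

/-- A complex number `r` is a representative of `(g,h) ∈ ℂ/2ℤ`. -/
def GradingForms.Rep {G : Type*} [AddCommGroup G] (F : GradingForms G) (r : ℂ) (g h : G) : Prop :=
  (QuotientAddGroup.mk r : ℂ ⧸ AddSubgroup.zmultiples (2 : ℂ)) = F.form g h

/-- A generalized vertex algebra structure, associated with `G`, `(·,·)` and `c(·,·)`, on the
complex vector space `V` with the family `gr` of homogeneous subspaces `V^g`, `g ∈ G`.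

`Y u n` is the mode `u_n`, i.e. `Y(u,z) = ∑_{n ∈ ℂ} u_n z^{-n-1}`. -/
@[ext]
structure GenVertexAlgebra {G : Type*} [AddCommGroup G] (F : GradingForms G)
    {V : Type*} [AddCommGroup V] [Module ℂ V] (gr : G → Submodule ℂ V) where
  /-- the vertex operator map -/
  Y : V →ₗ[ℂ] (ℂ → Module.End ℂ V)
  /-- the vacuum vector -/
  vac : V
  /-- `V` is the direct sum of the `V^g` -/
  gr_indep : iSupIndep gr
  gr_span : ⨆ g, gr g = ⊤
  vac_mem : vac ∈ gr 0
  /-- `u_l V^h ⊆ V^{g+h}` for `u ∈ V^g` -/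
  mode_mem : ∀ (g h : G) (u v : V) (l : ℂ), u ∈ gr g → v ∈ gr h → Y u l v ∈ gr (g + h)
  /-- `u_l v = 0` if the real part of `l` is sufficiently large -/
  truncation : ∀ u v : V, ∃ N : ℝ, ∀ l : ℂ, N ≤ l.re → Y u l v = 0
  /-- `Y(𝟏,z) = 1` -/
  vacuum : ∀ l : ℂ, Y vac l = if l = -1 then 1 else 0
  /-- `Y(v,z)𝟏 ∈ V[[z]]` -/
  creation : ∀ (v : V) (l : ℂ), (∀ k : ℕ, l ≠ -1 - (k : ℂ)) → Y v l vac = 0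
  /-- `v_{-1}𝟏 = v` -/
  creation_neg_one : ∀ v : V, Y v (-1) vac = v
  /-- `Y(u,z)|_{V^h} = ∑_{n ≡ (g,h) mod ℤ} u_n z^{-n-1}` for `u ∈ V^g` -/
  support : ∀ (g h : G) (u v : V) (r l : ℂ), u ∈ gr g → v ∈ gr h → F.Rep r g h →
    (∀ k : ℤ, l ≠ r + (k : ℂ)) → Y u l v = 0
  /-- The generalized Jacobi identity, applied to `w ∈ V^{g'}`:
  `z₀⁻¹ ((z₁-z₂)/z₀)^{(g,h)} δ((z₁-z₂)/z₀) Y(u,z₁) Y(v,z₂) w`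
  `- c(g,h) z₀⁻¹ ((z₂-z₁)/z₀)^{(g,h)} δ((z₂-z₁)/(-z₀)) Y(v,z₂) Y(u,z₁) w`
  `= z₂⁻¹ ((z₁-z₀)/z₂)^{-(g,g')} δ((z₁-z₀)/z₂) Y(Y(u,z₀)v,z₂) w`,
  where binomials are expanded in nonnegative powers of their second variable.
  With representatives `r` of `(g,h)`, `s` of `(g,g')` and `t` of `(h,g')`, the equation below
  is the comparison of the coefficients of `z₀^{-n-r-1} z₁^{-m-s-1} z₂^{-k-t-1}`. By `support` all
  other coefficients of the three terms vanish; by `truncation` all three sums are finite. -/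
  jacobi : ∀ (g h g' : G) (u v w : V), u ∈ gr g → v ∈ gr h → w ∈ gr g' →
    ∀ r s t : ℂ, F.Rep r g h → F.Rep s g g' → F.Rep t h g' → ∀ n m k : ℤ,
    (∑ᶠ i : ℕ, ((-1 : ℂ) ^ i * Ring.choose (n + r) i) •
        Y u (m + s + n + r - i) (Y v (k + t + i) w))
      - ((F.c g h : ℂ) * (-1 : ℂ) ^ n) • (∑ᶠ i : ℕ, ((-1 : ℂ) ^ i * Ring.choose (n + r) i) •
        Y v (k + t + n + r - i) (Y u (m + s + i) w))
      = ∑ᶠ i : ℕ, Ring.choose (m + s) i • Y (Y u (n + r + i) v) (m + s + k + t - i) w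

/-- The subset `U` generates the generalized vertex algebra: the only subspace that contains
`U` and the vacuum and is closed under all products `u_n v` is the whole space. -/
def GenVertexAlgebra.GeneratedBy {G : Type*} [AddCommGroup G] {F : GradingForms G}
    {V : Type*} [AddCommGroup V] [Module ℂ V] {gr : G → Submodule ℂ V}
    (S : GenVertexAlgebra F gr) (U : Set V) : Prop :=
  ∀ W : Submodule ℂ V, S.vac ∈ W → U ⊆ W → (∀ u ∈ W, ∀ v ∈ W, ∀ n : ℂ, S.Y u n v ∈ W) → W = ⊤

/-! ## Simple Lie algebras: the normalized Killing form and the root lattice -/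

section Affine

open LieAlgebra LieAlgebra.LoopAlgebra
open scoped TensorProduct Nat

variable {𝔤 : Type*} [LieRing 𝔤] [LieAlgebra ℂ 𝔤] [FiniteDimensional ℂ 𝔤] [LieAlgebra.IsSimple ℂ 𝔤]
variable (H : LieSubalgebra ℂ 𝔤) [H.IsCartanSubalgebra]

/-- The largest value of `κ(t_α, t_α) = α(t_α)`, `α` a root, where `κ` is the Killing form and
`t_α` is the element of the Cartan subalgebra with `κ(t_α, h) = α(h)`. (These values are
positive real numbers, and the maximum is attained at the long roots.) -/
def killingLongRootSq : ℝ :=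
  ⨆ α : H.root, ((α : LieModule.Weight ℂ H 𝔤)
    ((IsKilling.cartanEquivDual H).symm
      (LieModule.Weight.toLinear ℂ H 𝔤 (α : LieModule.Weight ℂ H 𝔤)))).re

/-- The factor `s` such that `⟨·,·⟩ = s κ` satisfies `⟨α, α⟩ = 2` for long roots `α`. -/
def normFactor : ℂ := ((killingLongRootSq H / 2 : ℝ) : ℂ)

/-- The normalized Killing form `⟨·,·⟩` on `𝔤`. -/
def normForm : LinearMap.BilinForm ℂ 𝔤 := normFactor H • killingForm ℂ 𝔤

/-- The identification of `𝔥*` with `𝔥` through `⟨·,·⟩`: `⟨dualToCartan λ, h⟩ = λ(h)`. -/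
def dualToCartan : Module.Dual ℂ H →ₗ[ℂ] H :=
  (normFactor H)⁻¹ • ((IsKilling.cartanEquivDual H).symm : Module.Dual ℂ H →ₗ[ℂ] H)

/-- The form `⟨·,·⟩` transported to `𝔥*`: `⟨lam, mu⟩ = mu (dualToCartan lam)`. -/
def dualForm (lam mu : Module.Dual ℂ H) : ℂ := mu (dualToCartan H lam)

/-- The root lattice. -/
def rootLattice : AddSubgroup (Module.Dual ℂ H) :=
  AddSubgroup.closure {lam | ∃ α ∈ H.root, lam = LieModule.Weight.toLinear ℂ H 𝔤 α}

theorem dualForm_comm (lam mu : Module.Dual ℂ H) : dualForm H lam mu = dualForm H mu lam := by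
  have key : ∀ a b : Module.Dual ℂ H, b ((IsKilling.cartanEquivDual H).symm a) =
      killingForm ℂ 𝔤 ((IsKilling.cartanEquivDual H).symm b : H)
        ((IsKilling.cartanEquivDual H).symm a : H) := by
    intro a b
    conv_lhs => rw [← (IsKilling.cartanEquivDual H).apply_symm_apply b]
    rfl
  simp only [dualForm, dualToCartan, LinearMap.smul_apply, map_smul, LinearEquiv.coe_coe]
  rw [key lam mu, key mu lam, LieModule.traceForm_comm]

/-- The forms `(·,·) = ⟨·,·⟩/ℓ` (modulo `2ℤ`) and `c(·,·) = 1` on the root lattice. -/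
def latticeForms (ℓ : ℂ) : GradingForms (rootLattice H) where
  form := AddMonoidHom.mk' (fun α => AddMonoidHom.mk'
      (fun β => (QuotientAddGroup.mk (dualForm H α β / ℓ) :
        ℂ ⧸ AddSubgroup.zmultiples (2 : ℂ)))
      (fun β β' => by
        rw [← QuotientAddGroup.mk_add]; congr 1; simp [dualForm, add_div]))
    (fun α α' => by
      ext β
      simp only [AddMonoidHom.mk'_apply, AddMonoidHom.add_apply]
      rw [← QuotientAddGroup.mk_add]; congr 1; simp [dualForm, add_div])
  form_symm α β := by
    simp only [AddMonoidHom.mk'_apply]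
    rw [dualForm_comm]
  c _ _ := 1
  c_add_left := by simp
  c_add_right := by simp
  c_self := by simp

/-! ## The affine Lie algebra -/


theorem normForm_symm : (-normForm H).IsSymm := by
  constructor
  intro x y
  simp [normForm, LieModule.traceForm_comm ℂ 𝔤 𝔤 x y]

theorem normForm_invariant : (-normForm H).lieInvariant 𝔤 := by
  intro x y z
  have := LieModule.traceForm_lieInvariant ℂ 𝔤 𝔤 x y z
  simp [normForm, this]

/-- The affine Lie algebra `ĝ = 𝔤 ⊗ ℂ[t,t⁻¹] ⊕ ℂc`. (Mathlib's cocycle attached to a form `Φ` is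
`(x tᵐ, y tⁿ) ↦ n δ_{m+n,0} Φ(x,y)`, which for `Φ = -⟨·,·⟩` is `m δ_{m+n,0} ⟨x,y⟩`.) -/
abbrev Affine : Type _ :=
  ofTwoCocycle (twoCocycleOfBilinear ℂ ℤ 𝔤 (-normForm H) (normForm_invariant H) (normForm_symm H))

/-- The element `x(n) = x ⊗ tⁿ` of the affine Lie algebra. -/
def loopElt (x : 𝔤) (n : ℤ) : Affine H :=
  ofProd _ (AddMonoidAlgebra.single n (1 : ℂ) ⊗ₜ[ℂ] x, 0)

/-- The central element `c`. -/
def centralElt : Affine H :=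
  ofProd _ (0, (TrivialLieModule.equiv ℂ (loopAlgebra ℂ ℤ 𝔤) ℂ).symm 1)

theorem lie_loopElt (x y : 𝔤) (m n : ℤ) :
    ⁅loopElt H x m, loopElt H y n⁆ = loopElt H ⁅x, y⁆ (m + n) +
      ((m : ℂ) * normForm H x y * if m + n = 0 then 1 else 0) • centralElt H := by
  have key : residuePairing ℂ ℤ 𝔤 (-normForm H) (AddMonoidAlgebra.single m (1 : ℂ) ⊗ₜ[ℂ] x)
      (AddMonoidAlgebra.single n (1 : ℂ) ⊗ₜ[ℂ] y) =
      (m : ℂ) * normForm H x y * if m + n = 0 then 1 else 0 := by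
    rw [residuePairing_apply_apply, toFinsupp_single_tmul, toFinsupp_single_tmul,
      Finsupp.sum_single_index (by simp)]
    by_cases h : m + n = 0
    · obtain rfl : n = -m := by omega
      simp
    · have h' : m ≠ -n := by omega
      simp [h, Finsupp.single_eq_of_ne' h']
  rw [bracket_ofTwoCocycle]
  simp only [loopElt, centralElt, ← of_smul, ← of_add]
  congr 1
  refine Prod.ext ?_ ?_
  · simp only [Equiv.symm_apply_apply, Prod.fst_add, Prod.smul_fst, smul_zero, add_zero]
    rw [LieAlgebra.ExtendScalars.bracket_tmul, AddMonoidAlgebra.single_mul_single, one_mul]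
  · simp only [Equiv.symm_apply_apply, Prod.snd_add, Prod.smul_snd, lie_zero, zero_add,
      add_zero, sub_zero, ← map_smul, smul_eq_mul, mul_one]
    rw [← key]
    rfl

theorem lie_centralElt (x : Affine H) : ⁅x, centralElt H⁆ = 0 := by
  rw [bracket_ofTwoCocycle, ← of_zero]
  congr 1
  refine Prod.ext ?_ ?_
  · simp [centralElt]
  · simp only [centralElt, Equiv.symm_apply_apply, map_zero, zero_lie, sub_zero, zero_add,
      Prod.snd_zero]
    exact trivial_lie_zero _ _ _ _

/-! ## Modules for the affine Lie algebra -/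

/-- The universal enveloping algebra `U(ĝ)`; `ĝ`-modules are `U(ĝ)`-modules. -/
abbrev UAffine : Type _ := UniversalEnvelopingAlgebra ℂ (Affine H)

/-- The element `x(n)` of `U(ĝ)`. -/
def loopU (x : 𝔤) (n : ℤ) : UAffine H := UniversalEnvelopingAlgebra.ι ℂ (loopElt H x n)

/-- The left ideal of `U(ĝ)` generated by `𝔤 ⊗ ℂ[t]` and `c - ℓ`, i.e. generated by the kernel of
the character `𝔤 ⊗ ℂ[t] ↦ 0`, `c ↦ ℓ` of `U(𝔤 ⊗ ℂ[t] + ℂc)`. -/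
def vermaIdeal (ℓ : ℂ) : Submodule (UAffine H) (UAffine H) :=
  Submodule.span (UAffine H)
    ({u | ∃ (x : 𝔤) (n : ℤ), 0 ≤ n ∧ u = loopU H x n} ∪
      {UniversalEnvelopingAlgebra.ι ℂ (centralElt H) - algebraMap ℂ (UAffine H) ℓ})

/-- The generalized Verma module
`M(ℓ,0) = U(ĝ) ⊗_{U(𝔤 ⊗ ℂ[t] + ℂc)} ℂ_ℓ = U(ĝ) / vermaIdeal`; its highest weight vector
`𝟏 = 1 ⊗ 1` is the class of `1`. -/
abbrev GenVerma (ℓ : ℂ) : Type _ := UAffine H ⧸ vermaIdeal H ℓ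

/-- The homogeneous subspace of degree `d` of `M(ℓ,0)`, spanned by the vectors
`x₁(n₁) ⋯ x_r(n_r) 𝟏` with `n₁ + ⋯ + n_r = -d`. -/
def degreePart (ℓ : ℂ) (d : ℤ) : Submodule ℂ (GenVerma H ℓ) :=
  Submodule.span ℂ {v | ∃ p : List (𝔤 × ℤ), (p.map Prod.snd).sum = -d ∧
    v = (vermaIdeal H ℓ).mkQ ((p.map fun q => loopU H q.1 q.2).prod)}

/-- A submodule of `M(ℓ,0)` is graded if it is the sum of its homogeneous parts. -/
def IsGradedSub (ℓ : ℂ) (N : Submodule (UAffine H) (GenVerma H ℓ)) : Prop :=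
  N.restrictScalars ℂ = ⨆ d : ℤ, N.restrictScalars ℂ ⊓ degreePart H ℓ d

/-- The largest proper graded submodule of `M(ℓ,0)`. -/
def maxGradedSub (ℓ : ℂ) : Submodule (UAffine H) (GenVerma H ℓ) :=
  sSup {N | IsGradedSub H ℓ N ∧ N ≠ ⊤}

/-- The preimage in `U(ĝ)` of the largest proper graded submodule of `M(ℓ,0)`, so that
`U(ĝ) / simpleIdeal` is the irreducible quotient `L(ℓ,0)` of `M(ℓ,0)`. -/
def simpleIdeal (ℓ : ℂ) : Submodule (UAffine H) (UAffine H) :=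
  (maxGradedSub H ℓ).comap (vermaIdeal H ℓ).mkQ

/-! ## The vacuum space and the `Z`-operators -/

section Module

variable (V : Type*) [AddCommGroup V] [Module ℂ V] [Module (UAffine H) V]
  [IsScalarTower ℂ (UAffine H) V]

/-- The action of `x(n)` on a `ĝ`-module `V`. -/
def modeOp (x : 𝔤) (n : ℤ) : Module.End ℂ V := Algebra.lsmul ℂ ℂ V (loopU H x n)

/-- The vacuum space `Ω_V = {w ∈ V | h(n)w = 0 for h ∈ 𝔥, n ≥ 1}`. -/
def vacuumSpace : Submodule ℂ V :=
  ⨅ (h : H) (n : ℤ) (_ : 1 ≤ n), LinearMap.ker (modeOp H V (h : 𝔤) n)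

/-- The weight space `Ω_V^β = {w ∈ Ω_V | h(0)w = β(h)w for h ∈ 𝔥}`, where `β` is an element of the
root lattice. -/
def vacuumWeightSpace (β : rootLattice H) : Submodule ℂ (vacuumSpace H V) :=
  (⨅ h : H, LinearMap.ker (modeOp H V (h : 𝔤) 0 - (β : Module.Dual ℂ H) h • 1)).comap
    (vacuumSpace H V).subtype

variable {V}

/-- The exponential of a power series without constant term; the coefficients may lie in a
noncommutative algebra. -/
def expSeries {A : Type*} [Ring A] [Algebra ℂ A] (f : PowerSeries A) : PowerSeries A :=
  PowerSeries.mk fun k => ∑ r ∈ Finset.range (k + 1), ((r ! : ℂ)⁻¹) • PowerSeries.coeff k (f ^ r)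

variable (V) in
/-- `E⁺(h,z) = exp(∑_{n ≥ 1} (h(n)/n) z⁻ⁿ)` on `V`, a power series in `z⁻¹`. -/
def EPlus (h : H) : PowerSeries (Module.End ℂ V) :=
  expSeries (PowerSeries.mk fun n : ℕ =>
    if n = 0 then 0 else (n : ℂ)⁻¹ • modeOp H V (h : 𝔤) n)

variable (V) in
/-- `E⁻(h,z) = exp(∑_{n ≤ -1} (h(n)/n) z⁻ⁿ)` on `V`, a power series in `z`. -/
def EMinus (h : H) : PowerSeries (Module.End ℂ V) :=
  expSeries (PowerSeries.mk fun n : ℕ =>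
    if n = 0 then 0 else (-(n : ℂ))⁻¹ • modeOp H V (h : 𝔤) (-n))

/-- The coefficient of `z^N` in `Z(a,z)w = E⁻(α/ℓ,z) a(z) E⁺(α/ℓ,z) w`, where `a ∈ 𝔤_α`,
`a(z) = ∑ a(n) z^{-n-1}`. The sum is over the powers `z^i` in `E⁻` and `z^{-j}` in `E⁺`. -/
def ZCoeff (ℓ : ℂ) (α : Module.Dual ℂ H) (a : 𝔤) (w : V) (N : ℤ) : V :=
  ∑ᶠ p : ℕ × ℕ,
    PowerSeries.coeff p.1 (EMinus H V (ℓ⁻¹ • dualToCartan H α))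
      (modeOp H V a ((p.1 : ℤ) - (p.2 : ℤ) - 1 - N)
        (PowerSeries.coeff p.2 (EPlus H V (ℓ⁻¹ • dualToCartan H α)) w))

/-- The coefficient of `z^x`, `x ∈ ℂ`, in `ψ(a,z)w = Z(a,z) z^{-α(0)/ℓ} w`, where `a ∈ 𝔤_α` and
`w` has `𝔥`-weight `β`, so that `z^{-α(0)/ℓ} w = z^{-⟨α,β⟩/ℓ} w`. -/
def psiCoeff (ℓ : ℂ) (α : Module.Dual ℂ H) (a : 𝔤) (β : Module.Dual ℂ H) (w : V) (x : ℂ) : V :=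
  Function.extend (fun N : ℤ => (N : ℂ)) (ZCoeff H ℓ α a w) 0 (x + dualForm H α β / ℓ)

/-- The two conditions on a generalized vertex algebra structure on `Ω_V`, where `one` is the
highest weight vector `𝟏` of `V`: `Y(𝟏,z) = 1`, and `Y(a,z) = ψ(a,z)` for `a ∈ 𝔤_α`, `α` a root,
where `a` is identified with `a(-1)𝟏`. The second one compares the coefficients of `z^x`, for all
`x ∈ ℂ`, on every `Ω_V^β`. -/
def HasPsiFields {ℓ : ℂ} (one : V)
    (S : GenVertexAlgebra (latticeForms H ℓ) (vacuumWeightSpace H V)) : Prop :=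
  (∀ e : vacuumSpace H V, (e : V) = one → ∀ n : ℂ, S.Y e n = if n = -1 then 1 else 0) ∧
  ∀ α ∈ H.root, ∀ a ∈ rootSpace H α, ∀ u : vacuumSpace H V, (u : V) = modeOp H V a (-1) one →
    ∀ (β : rootLattice H), ∀ w ∈ vacuumWeightSpace H V β, ∀ x : ℂ,
      (S.Y u (-x - 1) w : V) =
        psiCoeff H ℓ (LieModule.Weight.toLinear ℂ H 𝔤 α) a (β : Module.Dual ℂ H) (w : V) x

end Module

end Affine

end ZAlgebra

/-!
Both `M(ℓ,0)` and `L(ℓ,0)` are vacuum modules in the sense of `IsVacuumModule`: the centre acts by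
`ℓ`, the fields `x(z)` are truncated, the module is generated by a vector `o` that is killed by the
modes `x(n)` with `n ≥ 0`, and the derivation `x(n) ↦ -n x(n-1)` of `ĝ` acts on it by an operator
`D` that kills `o`. For `L(ℓ,0)` the last point requires that the largest proper graded submodule of
`M(ℓ,0)` is stable under `D` (`vermaDer_mem_maxGradedSub`): a graded submodule `N` is proper exactly
if it lives in positive degrees, and then so does `N + D N`.

On the vacuum space `Ω` of such a module, `E⁺` acts as the identity, and the operators
`ψ(a,z) = E⁻(α/ℓ,z) a(z) z^{-α(0)/ℓ}` commute with the `h(n)`, `n ≥ 1` (`cartan_pos_psiOp`), so they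
act on `Ω`. They have four properties.

* They are mutually local in the generalized sense. As `a(z₁)` and `b(z₂)` are local of order `2`,
  and as moving `a(z₁)` past `E⁻(β/ℓ,z₂)` costs a factor `(1 - z₂/z₁)^{-⟨α,β⟩/ℓ}`, the products
  `(z₁ - z₂)^{2 + ⟨α,β⟩/ℓ} ψ(a,z₁)ψ(b,z₂)` and `(z₁ - z₂)² (-z₂ + z₁)^{⟨α,β⟩/ℓ} ψ(b,z₂)ψ(a,z₁)`
  agree (`psiOp_local`).
* They are covariant for the translation operator that equals `D - β(-1)/ℓ` on the vacuum vectors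
  of weight `β` (`covariant_psi`).
* They are creative: `ψ(a,z)o` is a power series with constant term `a(-1)o`.
* They generate `Ω` from `o` (`span_reach`). Since `a(z)` is recovered from `ψ(a,z)` and the creation
  operators `h(-n)`, the module is spanned by the monomials `h₁(-n₁) ⋯ h_k(-n_k) w`, where `w` is
  obtained from `o` by modes of the `ψ(a,z)`. The operator
  `∑_{n ≥ 1} ∑_i (nℓ)⁻¹ h_i(-n) h^i(n)` multiplies such a monomial by its length `k` and vanishes on
  `Ω`, so that only the monomials with `k = 0` contribute to `Ω`.

The rest is a reconstruction theorem for generalized vertex algebras with `c(·,·) = 1`. For two local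
fields `A` and `B`, the product `F(z₁,z₂) = (z₁ - z₂)^{N+r} A(z₁)B(z₂)` can be restricted to the
diagonal, and the coefficients of `F(z₂ + z₀, z₂)` in `z₀` are the products `A_n B`. By
the expansion of the derivatives of the formal delta function (`delta_expansion`) and Vandermonde's
identity they satisfy the Jacobi identity (`jacobiFor_nProd`), and by Dong's lemma (`Local.nProd`)
they are again local with every field that is local with `A` and `B`. A covariant creative field
that is local with the generators is determined by its value on the vacuum
(`eq_zero_of_mem_fieldSpace`), and every vector is such a value; this gives the vertex operators
(`reconstruct`). Uniqueness (`genVertexAlgebra_ext`) and generation (`generatedBy_of_generating`) hold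
because the modes of the generating fields produce `Ω` from the vacuum and the Jacobi identity
expresses the field of `u_n v` through those of `u` and `v`.

Exponents are complex, but on each homogeneous component they lie in one coset of `ℤ`. Modes of a
field of charge `g` are therefore indexed by integers: on the component of degree `h`, the index `n`
stands for the mode `n + ⟨g,h⟩/ℓ`. A formal distribution in several variables is the family of its
coefficients, and multiplication by an expansion of a power of `z₁ - z₂` is an action of a power
series on this family (`act`).
-/

set_option linter.unusedSectionVars false

namespace ZAlgebra

/-! ### Locally finite sums -/

section Finsum

variable {W : Type*} [AddCommGroup W] [Module ℂ W]

theorem finsum_comm_of_finite {α β : Type*} {f : α → β → W}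
    (h : {p : α × β | f p.1 p.2 ≠ 0}.Finite) :
    ∑ᶠ a, ∑ᶠ b, f a b = ∑ᶠ b, ∑ᶠ a, f a b := by
  rw [← finsum_curry (fun p : α × β => f p.1 p.2) h,
    ← finsum_comp_equiv (Equiv.prodComm β α), finsum_curry]
  · rfl
  · exact h.preimage (Equiv.prodComm β α).injective.injOn

theorem finsum_prod_eq_finsum_antidiagonal {f : ℕ × ℕ → W} (h : {p | f p ≠ 0}.Finite) :
    ∑ᶠ p, f p = ∑ᶠ n, ∑ p ∈ Finset.HasAntidiagonal.antidiagonal n, f p := by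
  have hs : Function.support f ⊆ h.toFinset := by intro p hp; simpa using hp
  rw [finsum_eq_sum_of_support_subset f hs]
  rw [← Finset.sum_fiberwise_of_maps_to (g := fun p : ℕ × ℕ => p.1 + p.2)
    (t := h.toFinset.image fun p => p.1 + p.2) (fun p hp => Finset.mem_image_of_mem _ hp)]
  rw [finsum_eq_sum_of_support_subset (s := h.toFinset.image fun p => p.1 + p.2)]
  · refine Finset.sum_congr rfl fun n _ => ?_
    refine Finset.sum_subset_zero_on_sdiff ?_ ?_ (fun _ _ => rfl)
    · intro p hp
      simpa using (Finset.mem_filter.1 hp).2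
    · intro p hp
      simp only [Finset.mem_sdiff, Finset.HasAntidiagonal.mem_antidiagonal, Finset.mem_filter,
        Set.Finite.mem_toFinset, Set.mem_ofPred_eq] at hp
      by_contra h0
      exact hp.2 ⟨h0, hp.1⟩
  · intro n hn
    obtain ⟨p, hp, hp0⟩ := Finset.exists_ne_zero_of_sum_ne_zero hn
    simp only [Finset.coe_image, Set.mem_image, Finset.mem_coe, Set.Finite.mem_toFinset]
    exact ⟨p, hp0, by simpa using hp⟩

theorem smul_finsum_of_field {α : Type*} (c : ℂ) (f : α → W) :
    c • ∑ᶠ a, f a = ∑ᶠ a, c • f a := smul_finsum c f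

theorem finsum_mem_submodule {α : Type*} (S : Submodule ℂ W) {f : α → W} (h : ∀ a, f a ∈ S) :
    ∑ᶠ a, f a ∈ S := by
  by_cases hf : (Function.support f).Finite
  · rw [finsum_eq_sum f hf]; exact Submodule.sum_mem _ fun a _ => h a
  · rw [finsum_of_infinite_support hf]; exact S.zero_mem

/-- The sum of a family of linear maps that is finite on every vector. -/
def finsumLM {ι V : Type*} [AddCommGroup V] [Module ℂ V] (L : ι → V →ₗ[ℂ] W)
    (h : ∀ w, {i | L i w ≠ 0}.Finite) : V →ₗ[ℂ] W where
  toFun w := ∑ᶠ i, L i w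
  map_add' x y := by
    simp only [map_add]
    exact finsum_add_distrib (h x) (h y)
  map_smul' c x := by
    simp only [map_smul, RingHom.id_apply]
    rw [smul_finsum_of_field]

end Finsum

/-! ### Binomial series and their action on formal distributions -/

/-- The power series `(1 - X)^x = ∑ (-1)^i (x choose i) X^i`. -/
def oneSubPow (x : ℂ) : PowerSeries ℂ := PowerSeries.mk fun i => (-1) ^ i * Ring.choose x i

theorem coeff_oneSubPow (x : ℂ) (i : ℕ) :
    PowerSeries.coeff i (oneSubPow x) = (-1) ^ i * Ring.choose x i := by
  simp [oneSubPow]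

theorem oneSubPow_add (x y : ℂ) : oneSubPow (x + y) = oneSubPow x * oneSubPow y := by
  ext n
  rw [PowerSeries.coeff_mul, coeff_oneSubPow, Ring.add_choose_eq n (Commute.all x y),
    Finset.mul_sum]
  refine Finset.sum_congr rfl fun p hp => ?_
  rw [coeff_oneSubPow, coeff_oneSubPow, ← Finset.HasAntidiagonal.mem_antidiagonal.1 hp, pow_add]
  ring

theorem oneSubPow_zero : oneSubPow 0 = 1 := by
  ext n
  rw [coeff_oneSubPow, PowerSeries.coeff_one, Ring.choose_zero_ite]
  split_ifs with h <;> simp [h]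

section Act

variable {W : Type*} [AddCommGroup W] [Module ℂ W] {I : Type*} [AddCommGroup I]

/-- The action of a power series `p(X)` on a family `T : I → W`, the coefficients of a formal
distribution, where `X` acts by the translation of the index by `δ`. With index `n` for the
coefficient of `z^{-n-1}`, the step `(-1, 1)` is multiplication by `z₂/z₁` and the step `(1, -1)` is
multiplication by `z₁/z₂`. -/
def act (p : PowerSeries ℂ) (δ : I) (T : I → W) (γ : I) : W :=
  ∑ᶠ i : ℕ, PowerSeries.coeff i p • T (γ + i • δ)

/-- The action of power series with step `δ` on `T` involves only finite sums. -/
def Summable₁ (δ : I) (T : I → W) : Prop := ∀ γ, {i : ℕ | T (γ + i • δ) ≠ 0}.Finite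

/-- The joint action of power series with steps `a` and `b` on `T` involves only finite sums. -/
def Summable₂ (a b : I) (T : I → W) : Prop :=
  ∀ γ, {e : ℕ × ℕ | T (γ + e.1 • a + e.2 • b) ≠ 0}.Finite

/-- The joint action of power series with steps `a`, `b`, `c` on `T` involves only finite
sums. -/
def Summable₃ (a b c : I) (T : I → W) : Prop :=
  ∀ γ, {e : ℕ × ℕ × ℕ | T (γ + e.1 • a + e.2.1 • b + e.2.2 • c) ≠ 0}.Finite

theorem Summable₂.left {a b : I} {T : I → W} (h : Summable₂ a b T) : Summable₁ a T := by
  intro γ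
  refine ((h γ).image Prod.fst).subset fun i hi => ⟨(i, 0), ?_, rfl⟩
  simpa using hi

theorem Summable₂.symm {a b : I} {T : I → W} (h : Summable₂ a b T) : Summable₂ b a T := by
  intro γ
  refine ((h γ).image Prod.swap).subset fun e he => ⟨e.swap, ?_, by simp⟩
  simpa [add_right_comm] using he

theorem Summable₂.right {a b : I} {T : I → W} (h : Summable₂ a b T) : Summable₁ b T :=
  h.symm.left

theorem Summable₃.left {a b c : I} {T : I → W} (h : Summable₃ a b c T) : Summable₂ a b T := by
  intro γ
  refine ((h γ).image fun e => (e.1, e.2.1)).subset fun e he => ⟨(e.1, e.2, 0), ?_, rfl⟩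
  simpa using he

theorem Summable₃.rotate {a b c : I} {T : I → W} (h : Summable₃ a b c T) :
    Summable₃ b c a T := by
  intro γ
  refine ((h γ).image fun e => (e.2.1, e.2.2, e.1)).subset
    fun e he => ⟨(e.2.2, e.1, e.2.1), ?_, rfl⟩
  simp only [Set.mem_ofPred_eq] at he ⊢
  convert he using 2
  abel

theorem act_ne_zero {p : PowerSeries ℂ} {δ : I} {T : I → W} {γ : I} (h : act p δ T γ ≠ 0) :
    ∃ i : ℕ, T (γ + i • δ) ≠ 0 := by
  by_contra! h0
  exact h (by simp [act, h0])

theorem Summable₃.act {a b c : I} {T : I → W} (h : Summable₃ a b c T) (p : PowerSeries ℂ) :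
    Summable₂ a b (act p c T) := by
  intro γ
  refine ((h γ).image fun e => (e.1, e.2.1)).subset fun e he => ?_
  obtain ⟨i, hi⟩ := act_ne_zero he
  exact ⟨(e.1, e.2, i), hi, rfl⟩

theorem Summable₂.act {a b : I} {T : I → W} (h : Summable₂ a b T) (p : PowerSeries ℂ) :
    Summable₁ a (act p b T) := by
  intro γ
  refine ((h γ).image fun e => e.1).subset fun e he => ?_
  obtain ⟨i, hi⟩ := act_ne_zero he
  exact ⟨(e, i), hi, rfl⟩

theorem act_act {a b : I} {T : I → W} (p q : PowerSeries ℂ) (γ : I) :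
    act p a (act q b T) γ = ∑ᶠ i : ℕ, ∑ᶠ j : ℕ,
      (PowerSeries.coeff i p * PowerSeries.coeff j q) • T (γ + i • a + j • b) := by
  unfold act
  refine finsum_congr fun i => ?_
  rw [smul_finsum_of_field]
  exact finsum_congr fun j => by rw [mul_smul]

theorem act_comm {a b : I} {T : I → W} (h : Summable₂ a b T) (p q : PowerSeries ℂ) :
    act p a (act q b T) = act q b (act p a T) := by
  funext γ
  rw [act_act, act_act, finsum_comm_of_finite]
  · refine finsum_congr fun i => finsum_congr fun j => ?_
    rw [mul_comm, add_right_comm]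
  · refine (h γ).subset fun e he h0 => he ?_
    simp only [h0, smul_zero]

theorem act_mul {a : I} {T : I → W} (h : Summable₁ a T) (p q : PowerSeries ℂ) :
    act p a (act q a T) = act (p * q) a T := by
  funext γ
  rw [act_act]
  have hf : {e : ℕ × ℕ | (PowerSeries.coeff e.1 p * PowerSeries.coeff e.2 q) •
      T (γ + e.1 • a + e.2 • a) ≠ 0}.Finite := by
    have : {e : ℕ × ℕ | T (γ + (e.1 + e.2) • a) ≠ 0}.Finite := by
      refine ((h γ).biUnion fun n _ => (Finset.finite_toSet (Finset.HasAntidiagonal.antidiagonal n))).subset ?_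
      intro e he
      simp only [Set.mem_iUnion, Finset.mem_coe, Finset.HasAntidiagonal.mem_antidiagonal]
      exact ⟨e.1 + e.2, he, rfl⟩
    refine this.subset fun e he h0 => he ?_
    rw [add_assoc, ← add_smul, h0, smul_zero]
  rw [← finsum_curry (fun e : ℕ × ℕ => (PowerSeries.coeff e.1 p * PowerSeries.coeff e.2 q) •
      T (γ + e.1 • a + e.2 • a)) hf, finsum_prod_eq_finsum_antidiagonal hf]
  refine finsum_congr fun n => ?_
  rw [PowerSeries.coeff_mul, Finset.sum_smul]
  refine Finset.sum_congr rfl fun e he => ?_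
  rw [add_assoc, ← add_smul, Finset.HasAntidiagonal.mem_antidiagonal.1 he]

theorem act_one (a : I) (T : I → W) : act 1 a T = T := by
  funext γ
  unfold act
  rw [finsum_eq_single _ 0]
  · simp
  · intro n hn; simp [PowerSeries.coeff_one, hn]

theorem act_zero (p : PowerSeries ℂ) (a : I) : act p a (0 : I → W) = 0 := by
  funext γ; simp [act]

theorem act_translate (p : PowerSeries ℂ) (a τ : I) (T : I → W) (γ : I) :
    act p a (fun x => T (x + τ)) γ = act p a T (γ + τ) := by
  unfold act
  refine finsum_congr fun i => ?_
  rw [add_right_comm]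

theorem act_add {a : I} {T T' : I → W} (h : Summable₁ a T) (h' : Summable₁ a T')
    (p : PowerSeries ℂ) : act p a (T + T') = act p a T + act p a T' := by
  funext γ
  simp only [act, Pi.add_apply, smul_add]
  refine finsum_add_distrib ((h γ).subset ?_) ((h' γ).subset ?_) <;>
  · intro i hi h0
    exact hi (by simp only [h0, smul_zero])

theorem act_smul (c : ℂ) (a : I) (T : I → W) (p : PowerSeries ℂ) :
    act p a (c • T) = c • act p a T := by
  funext γ
  simp only [act, Pi.smul_apply]
  rw [smul_finsum_of_field]
  exact finsum_congr fun i => smul_comm _ _ _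

theorem act_map {W' : Type*} [AddCommGroup W'] [Module ℂ W'] {a : I} {T : I → W}
    (L : W →ₗ[ℂ] W') (p : PowerSeries ℂ) (γ : I) (h : {i : ℕ | T (γ + i • a) ≠ 0}.Finite) :
    L (act p a T γ) = act p a (fun x => L (T x)) γ := by
  unfold act
  change L.toAddMonoidHom _ = _
  rw [AddMonoidHom.map_finsum]
  · exact finsum_congr fun i => by simp
  · refine h.subset fun i hi h0 => hi ?_
    simp only [h0, smul_zero]

/-- The value of `act` depends only on the values of the family along the line it sums over. -/
theorem act_congr {J : Type*} [AddCommGroup J] {a : I} {b : J} {T : I → W} {T' : J → W} {γ : I}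
    {γ' : J} (p : PowerSeries ℂ) (h : ∀ i : ℕ, T (γ + i • a) = T' (γ' + i • b)) :
    act p a T γ = act p b T' γ' := by
  unfold act
  exact finsum_congr fun i => by rw [h]

end Act

/-! ### Locality of two families of coefficients -/

section Locality

variable {W : Type*} [AddCommGroup W] [Module ℂ W]

theorem finsum_comp_of_injective {α β : Type*} {f : β → W} {g : α → β} (hg : Function.Injective g)
    (h : ∀ b, f b ≠ 0 → b ∈ Set.range g) : ∑ᶠ a, f (g a) = ∑ᶠ b, f b := by
  rw [← finsum_mem_range hg, ← finsum_mem_univ f]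
  refine finsum_mem_inter_support_eq _ _ _ ?_
  ext b
  simp only [Set.mem_inter_iff, Set.mem_univ, true_and, Function.mem_support]
  exact ⟨fun hb => hb.2, fun hb => ⟨h b hb, hb⟩⟩

/-- The family `F`, indexed by pairs of integers, vanishes as soon as one of the indices is
large. -/
def BoundedAbove (F : ℤ × ℤ → W) : Prop := ∃ M : ℤ, ∀ p : ℤ × ℤ, F p ≠ 0 → p.1 < M ∧ p.2 < M

theorem BoundedAbove.antidiagonal_finite {F : ℤ × ℤ → W} (h : BoundedAbove F) (q : ℤ) :
    {m : ℤ | F (m, q - m) ≠ 0}.Finite := by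
  obtain ⟨M, hM⟩ := h
  refine (Set.finite_Ioo (q - M) M).subset fun m hm => ?_
  have := hM _ hm
  simp only [Set.mem_Ioo] at *
  omega

/-- Series in `z₂/z₁` can be applied to a family whose second index is bounded above. -/
theorem summable_left {T : ℤ × ℤ → W} (h : ∃ K : ℤ, ∀ m k, K ≤ k → T (m, k) = 0) :
    Summable₁ ((-1, 1) : ℤ × ℤ) T := by
  obtain ⟨K, hK⟩ := h
  rintro ⟨m, k⟩
  refine (Set.finite_Iio (K - k).toNat).subset fun i hi => ?_
  by_contra h0
  refine hi ?_
  simp only [Set.mem_Iio, not_lt, Int.toNat_le] at h0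
  simp only [Prod.smul_mk, smul_neg, nsmul_eq_mul, mul_one, Prod.mk_add_mk]
  exact hK _ _ (by omega)

/-- Series in `z₁/z₂` can be applied to a family whose first index is bounded above. -/
theorem summable_right {T : ℤ × ℤ → W} (h : ∃ K : ℤ, ∀ m k, K ≤ m → T (m, k) = 0) :
    Summable₁ ((1, -1) : ℤ × ℤ) T := by
  obtain ⟨K, hK⟩ := h
  rintro ⟨m, k⟩
  refine (Set.finite_Iio (K - m).toNat).subset fun i hi => ?_
  by_contra h0
  refine hi ?_
  simp only [Set.mem_Iio, not_lt, Int.toNat_le] at h0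
  simp only [Prod.smul_mk, smul_neg, nsmul_eq_mul, mul_one, Prod.mk_add_mk]
  exact hK _ _ (by omega)

theorem act_left_apply (p : PowerSeries ℂ) (T : ℤ × ℤ → W) (m k : ℤ) :
    act p ((-1, 1) : ℤ × ℤ) T (m, k) =
      ∑ᶠ i : ℕ, PowerSeries.coeff i p • T (m - i, k + i) := by
  unfold act
  refine finsum_congr fun i => ?_
  simp [sub_eq_add_neg]

theorem act_right_apply (p : PowerSeries ℂ) (T : ℤ × ℤ → W) (m k : ℤ) :
    act p ((1, -1) : ℤ × ℤ) T (m, k) =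
      ∑ᶠ i : ℕ, PowerSeries.coeff i p • T (m + i, k - i) := by
  unfold act
  refine finsum_congr fun i => ?_
  simp [sub_eq_add_neg]

theorem finsum_oneSubPow_nat (n : ℕ) (f : ℕ → W) :
    ∑ᶠ i : ℕ, PowerSeries.coeff i (oneSubPow n) • f i =
      ∑ i ∈ Finset.range (n + 1), ((-1 : ℂ) ^ i * (n.choose i : ℂ)) • f i := by
  rw [finsum_eq_sum_of_support_subset (s := Finset.range (n + 1))]
  · refine Finset.sum_congr rfl fun i _ => ?_
    rw [coeff_oneSubPow, Ring.choose_natCast]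
  · intro i hi
    rw [Finset.mem_coe, Finset.mem_range]
    by_contra h
    refine hi ?_
    simp only [coeff_oneSubPow, Ring.choose_natCast]
    rw [Nat.choose_eq_zero_of_lt (by omega)]
    simp

/-- `(z₁ - z₂)^n` is the same polynomial in both expansions. -/
theorem act_oneSubPow_nat_swap (n : ℕ) (F : ℤ × ℤ → W) (m k : ℤ) :
    act (oneSubPow n) ((-1, 1) : ℤ × ℤ) F (m + n, k) =
      (-1 : ℂ) ^ n • act (oneSubPow n) ((1, -1) : ℤ × ℤ) F (m, k + n) := by
  rw [act_left_apply, act_right_apply, finsum_oneSubPow_nat n fun i => F (m + n - i, k + i),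
    finsum_oneSubPow_nat n fun i => F (m + i, k + n - i), Finset.smul_sum,
    ← Finset.sum_range_reflect]
  refine Finset.sum_congr rfl fun i hi => ?_
  have hi' : i ≤ n := by simpa [Nat.lt_succ_iff] using hi
  obtain ⟨j, rfl⟩ := Nat.exists_eq_add_of_le hi'
  have e1 : i + j + 1 - 1 - i = j := by omega
  rw [e1, smul_smul]
  have e2 : (i + j).choose j = (i + j).choose i := by
    rw [Nat.choose_symm_add]
  congr 1
  · rw [e2, pow_add, ← mul_assoc, mul_comm ((-1 : ℂ) ^ i) ((-1) ^ j), mul_assoc ((-1 : ℂ) ^ j),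
      ← pow_add, ← two_mul, pow_mul]
    simp
  · congr 2 <;> push_cast <;> ring

theorem choose_neg_one_sub (j i : ℕ) :
    Ring.choose (-1 - (j : ℂ)) i = (-1) ^ i * ((i + j).choose i : ℂ) := by
  rw [show (-1 - (j : ℂ)) = -(1 + j) by ring, Ring.choose_neg,
    show (1 + (j : ℂ) + i - 1) = ((i + j : ℕ) : ℂ) by push_cast; ring, Ring.choose_natCast]
  rw [Int.negOnePow_def, Units.smul_def]
  simp

/-- The difference of the two expansions of `(z₁ - z₂)^{-1-j}`, a derivative of the formal delta
function, applied to a distribution for which both products exist. -/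
theorem delta_expansion {F : ℤ × ℤ → W} (h : BoundedAbove F) (j : ℕ) (m k : ℤ) :
    act (oneSubPow (-1 - j)) ((-1, 1) : ℤ × ℤ) F (m - 1 - j, k) +
      (-1 : ℂ) ^ j • act (oneSubPow (-1 - j)) ((1, -1) : ℤ × ℤ) F (m, k - 1 - j) =
    ∑ᶠ m' : ℤ, Ring.choose ((m : ℂ) - m' - 1) j • F (m', m + k - 1 - j - m') := by
  set f : ℤ → W := fun m' => Ring.choose ((m : ℂ) - m' - 1) j • F (m', m + k - 1 - j - m')
    with hf
  have hfin : f.support.Finite := by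
    refine (h.antidiagonal_finite (m + k - 1 - j)).subset fun m' hm' h0 => hm' ?_
    simp only [hf, h0, smul_zero]
  have key : ∀ m', f m' = (if m' < m then f m' else 0) + (if m' < m then 0 else f m') := by
    intro m'; split_ifs <;> simp
  have h1 : ∑ᶠ m', f m' = (∑ᶠ m', if m' < m then f m' else 0) +
      ∑ᶠ m', (if m' < m then 0 else f m') := by
    rw [← finsum_add_distrib]
    · exact finsum_congr key
    · refine hfin.subset fun m' hm' h0 => hm' ?_
      simp only [h0]; split_ifs <;> rfl
    · refine hfin.subset fun m' hm' h0 => hm' ?_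
      simp only [h0]; split_ifs <;> rfl
  rw [h1]
  congr 1
  · rw [act_left_apply, ← finsum_comp_of_injective (g := fun i : ℕ => m - 1 - j - (i : ℤ))]
    · refine finsum_congr fun i => ?_
      rw [if_pos (by omega), coeff_oneSubPow, choose_neg_one_sub, ← mul_assoc, ← mul_pow]
      simp only [hf]
      rw [show ((m : ℂ) - ((m - 1 - j - i : ℤ) : ℂ) - 1) = ((i + j : ℕ) : ℂ) by push_cast; ring,
        Ring.choose_natCast, Nat.choose_symm_add]
      congr 2
      · simp
      · congr 1; ring
    · intro a b hab; simpa using hab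
    · intro b hb
      have hb' : b < m := by by_contra h0; simp [h0] at hb
      rw [if_pos hb'] at hb
      by_contra h0
      refine hb ?_
      simp only [hf]
      have h2 : (m - b - 1).toNat < j := by
        by_contra h3
        refine h0 ⟨(m - 1 - j - b).toNat, ?_⟩
        simp only
        omega
      have h4 : ((m : ℂ) - b - 1) = (((m - b - 1).toNat : ℕ) : ℂ) := by
        have : ((m - b - 1).toNat : ℤ) = m - b - 1 := Int.toNat_of_nonneg (by omega)
        rw [← Int.cast_natCast, this]; push_cast; ring
      rw [h4, Ring.choose_natCast, Nat.choose_eq_zero_of_lt h2]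
      simp
  · rw [act_right_apply, ← finsum_comp_of_injective (g := fun i : ℕ => m + (i : ℤ)),
      smul_finsum_of_field]
    · refine finsum_congr fun i => ?_
      rw [if_neg (by omega), coeff_oneSubPow, choose_neg_one_sub, ← mul_assoc, ← mul_pow]
      simp only [hf]
      rw [show ((m : ℂ) - ((m + i : ℤ) : ℂ) - 1) = -1 - i by push_cast; ring,
        choose_neg_one_sub, smul_smul, add_comm j i, Nat.choose_symm_add]
      congr 2
      · simp
      · congr 1; ring
    · intro a b hab; simpa using hab
    · intro b hb
      have hb' : ¬ b < m := by intro h0; simp [h0] at hb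
      exact ⟨(b - m).toNat, by simp only; omega⟩

/-- Locality of order `N`: the two families `T` and `T'`, thought of as the coefficients of
`A(z₁)B(z₂)w` and `B(z₂)A(z₁)w` (with `T (m, k)` the coefficient at `z₁^{-m-1} z₂^{-k-1}`, up
to powers that are the same for all `m`, `k`), agree after multiplication by
`(z₁ - z₂)^{N + r}`, expanded in the appropriate domains. -/
def LocalPair (N : ℕ) (r : ℂ) (T T' : ℤ × ℤ → W) : Prop :=
  ∀ m k : ℤ, act (oneSubPow (N + r)) ((-1, 1) : ℤ × ℤ) T (m + N, k) =
    (-1 : ℂ) ^ N • act (oneSubPow (N + r)) ((1, -1) : ℤ × ℤ) T' (m, k + N)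

/-- The second index is bounded above. -/
def BddSnd (T : ℤ × ℤ → W) : Prop := ∃ K : ℤ, ∀ m k, K ≤ k → T (m, k) = 0

/-- The first index is bounded above. -/
def BddFst (T : ℤ × ℤ → W) : Prop := ∃ K : ℤ, ∀ m k, K ≤ m → T (m, k) = 0

theorem BddSnd.act {T : ℤ × ℤ → W} (h : BddSnd T) (p : PowerSeries ℂ) :
    BddSnd (act p ((-1, 1) : ℤ × ℤ) T) := by
  obtain ⟨K, hK⟩ := h
  refine ⟨K, fun m k hk => ?_⟩
  rw [act_left_apply]
  refine finsum_eq_zero_of_forall_eq_zero fun i => ?_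
  rw [hK _ _ (by omega), smul_zero]

theorem BddFst.act {T : ℤ × ℤ → W} (h : BddFst T) (p : PowerSeries ℂ) :
    BddFst (act p ((1, -1) : ℤ × ℤ) T) := by
  obtain ⟨K, hK⟩ := h
  refine ⟨K, fun m k hk => ?_⟩
  rw [act_right_apply]
  refine finsum_eq_zero_of_forall_eq_zero fun i => ?_
  rw [hK _ _ (by omega), smul_zero]

theorem LocalPair.boundedAbove {N : ℕ} {r : ℂ} {T T' : ℤ × ℤ → W} (h : LocalPair N r T T')
    (hT : BddSnd T) (hT' : BddFst T') :
    BoundedAbove fun p => act (oneSubPow (N + r)) ((-1, 1) : ℤ × ℤ) T (p.1 + N, p.2) := by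
  obtain ⟨K, hK⟩ := hT.act (oneSubPow (N + r))
  obtain ⟨K', hK'⟩ := hT'.act (oneSubPow (N + r))
  refine ⟨max K K', fun p hp => ⟨?_, ?_⟩⟩
  · by_contra h0
    refine hp ?_
    simp only
    rw [h, hK' _ _ (by omega), smul_zero]
  · by_contra h0
    exact hp (hK _ _ (by omega))

theorem LocalPair.mono {N : ℕ} {r : ℂ} {T T' : ℤ × ℤ → W} (h : LocalPair N r T T')
    (hT : BddSnd T) (hT' : BddFst T') (n : ℕ) : LocalPair (N + n) r T T' := by
  intro m k
  have e : oneSubPow (((N + n : ℕ) : ℂ) + r) = oneSubPow n * oneSubPow (N + r) := by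
    rw [← oneSubPow_add]; congr 1; push_cast; ring
  rw [e, ← act_mul (summable_left hT), ← act_mul (summable_right hT')]
  have h1 : act (oneSubPow n) ((-1, 1) : ℤ × ℤ) (act (oneSubPow (N + r)) ((-1, 1) : ℤ × ℤ) T)
      (m + (N + n : ℕ), k) = act (oneSubPow n) ((-1, 1) : ℤ × ℤ)
        (fun p => act (oneSubPow (N + r)) ((-1, 1) : ℤ × ℤ) T (p + ((N : ℤ), 0))) (m + n, k) := by
    rw [act_translate]; congr 1; simp; ring
  have h2 : (fun p : ℤ × ℤ => act (oneSubPow (N + r)) ((-1, 1) : ℤ × ℤ) T (p + ((N : ℤ), 0))) =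
      (-1 : ℂ) ^ N • fun p : ℤ × ℤ => act (oneSubPow (N + r)) ((1, -1) : ℤ × ℤ) T'
        (p + (0, (N : ℤ))) := by
    funext ⟨a, b⟩
    simpa using h a b
  rw [h1, act_oneSubPow_nat_swap, h2, act_smul, Pi.smul_apply, act_translate, smul_smul, pow_add,
    mul_comm]
  congr 2
  simp; ring

theorem LocalPair.symm {N : ℕ} {r : ℂ} {T T' : ℤ × ℤ → W} (h : LocalPair N r T T') :
    LocalPair N r (fun p => T' p.swap) (fun p => T p.swap) := by
  intro m k
  have h1 := h k m
  have e1 : act (oneSubPow (N + r)) ((-1, 1) : ℤ × ℤ) (fun p => T' p.swap) (m + N, k) =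
      act (oneSubPow (N + r)) ((1, -1) : ℤ × ℤ) T' (k, m + N) :=
    act_congr _ fun i => by simp
  have e2 : act (oneSubPow (N + r)) ((1, -1) : ℤ × ℤ) (fun p => T p.swap) (m, k + N) =
      act (oneSubPow (N + r)) ((-1, 1) : ℤ × ℤ) T (k + N, m) :=
    act_congr _ fun i => by simp
  rw [e1, e2, h1, smul_smul, ← mul_pow]
  simp

theorem LocalPair.add {N : ℕ} {r : ℂ} {T₁ T₁' T₂ T₂' : ℤ × ℤ → W} (h₁ : LocalPair N r T₁ T₁')
    (h₂ : LocalPair N r T₂ T₂') (b₁ : BddSnd T₁) (b₁' : BddFst T₁') (b₂ : BddSnd T₂)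
    (b₂' : BddFst T₂') : LocalPair N r (T₁ + T₂) (T₁' + T₂') := by
  intro m k
  rw [act_add (summable_left b₁) (summable_left b₂), Pi.add_apply, h₁, h₂,
    act_add (summable_right b₁') (summable_right b₂'), Pi.add_apply, smul_add]

theorem LocalPair.smul {N : ℕ} {r : ℂ} {T T' : ℤ × ℤ → W} (h : LocalPair N r T T') (c : ℂ) :
    LocalPair N r (c • T) (c • T') := by
  intro m k
  rw [act_smul, act_smul, Pi.smul_apply, Pi.smul_apply, h, smul_comm]

theorem LocalPair.zero (N : ℕ) (r : ℂ) : LocalPair N r (0 : ℤ × ℤ → W) 0 := by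
  intro m k
  rw [act_zero, act_zero]
  simp

/-- Two families that arise as the two expansions of `(z₁ - z₂)^{-N-r} F(z₁, z₂)` are local. -/
theorem localPair_of_expansion {F : ℤ × ℤ → W} (hF : BoundedAbove F) (N : ℕ) (r : ℂ) :
    LocalPair N r
      (fun p => act (oneSubPow (-(N : ℂ) - r)) ((-1, 1) : ℤ × ℤ) F (p + (-(N : ℤ), 0)))
      ((-1 : ℂ) ^ N • fun p =>
        act (oneSubPow (-(N : ℂ) - r)) ((1, -1) : ℤ × ℤ) F (p + (0, -(N : ℤ)))) := by
  have hs : BddSnd F := by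
    obtain ⟨M, hM⟩ := hF
    refine ⟨M, fun m k hk => ?_⟩
    by_contra h0
    have := (hM _ h0).2
    simp only at this
    omega
  have hf : BddFst F := by
    obtain ⟨M, hM⟩ := hF
    refine ⟨M, fun m k hk => ?_⟩
    by_contra h0
    have := (hM _ h0).1
    simp only at this
    omega
  intro m k
  rw [act_smul, Pi.smul_apply, act_translate, act_translate, act_mul (summable_left hs),
    act_mul (summable_right hf), ← oneSubPow_add, smul_smul, ← mul_pow]
  rw [show (N : ℂ) + r + (-N - r) = 0 by ring, oneSubPow_zero, act_one, act_one]
  simp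

/-- For a local pair of families, the difference of the products with the two expansions of
`(z₁ - z₂)^{n + r}`, `n ∈ ℤ`, in terms of the common product with `(z₁ - z₂)^{N + r}`. -/
theorem LocalPair.commutator {N : ℕ} {r : ℂ} {T T' : ℤ × ℤ → W} (h : LocalPair N r T T')
    (hT : BddSnd T) (hT' : BddFst T') (n m k : ℤ) :
    act (oneSubPow (n + r)) ((-1, 1) : ℤ × ℤ) T (m + n, k) -
      (-1 : ℂ) ^ n • act (oneSubPow (n + r)) ((1, -1) : ℤ × ℤ) T' (m, k + n) =
    if (N : ℤ) ≤ n then 0 else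
      ∑ᶠ m' : ℤ, Ring.choose ((m : ℂ) - m' - 1) (N - 1 - n).toNat •
        act (oneSubPow (N + r)) ((-1, 1) : ℤ × ℤ) T (m' + N, m + k + n - N - m') := by
  set F : ℤ × ℤ → W := fun p => act (oneSubPow (N + r)) ((-1, 1) : ℤ × ℤ) T (p.1 + N, p.2)
    with hFdef
  have hF : BoundedAbove F := h.boundedAbove hT hT'
  have e : oneSubPow ((n : ℂ) + r) = oneSubPow ((n : ℂ) - N) * oneSubPow (N + r) := by
    rw [← oneSubPow_add]; congr 1; ring
  have h1 : act (oneSubPow (n + r)) ((-1, 1) : ℤ × ℤ) T (m + n, k) =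
      act (oneSubPow ((n : ℂ) - N)) ((-1, 1) : ℤ × ℤ) F (m + n - N, k) := by
    rw [e, ← act_mul (summable_left hT)]
    refine act_congr _ fun i => ?_
    simp only [hFdef]
    congr 1
    simp; ring
  have h2 : act (oneSubPow (n + r)) ((1, -1) : ℤ × ℤ) T' (m, k + n) =
      (-1 : ℂ) ^ N • act (oneSubPow ((n : ℂ) - N)) ((1, -1) : ℤ × ℤ) F (m, k + n - N) := by
    rw [e, ← act_mul (summable_right hT'), ← Pi.smul_apply, ← act_smul]
    refine act_congr _ fun i => ?_
    simp only [hFdef, Pi.smul_apply]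
    rw [h, smul_smul, ← mul_pow]
    simp
    congr 1
    simp; ring
  rw [h1, h2, smul_smul]
  split_ifs with hn
  · obtain ⟨l, hl⟩ := Int.eq_ofNat_of_zero_le (sub_nonneg.2 hn)
    have hn' : n = N + l := by omega
    subst hn'
    rw [show (((N + l : ℤ) : ℂ) - N) = (l : ℂ) by push_cast; ring,
      show m + (N + l : ℤ) - N = m + l by ring, show k + (N + l : ℤ) - N = k + l by ring,
      act_oneSubPow_nat_swap, sub_eq_zero, ← Nat.cast_add, zpow_natCast, pow_add,
      mul_right_comm, ← mul_pow]
    simp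
  · obtain ⟨j, hj⟩ := Int.eq_ofNat_of_zero_le (show 0 ≤ N - 1 - n by omega)
    have hn' : n = N - 1 - j := by omega
    subst hn'
    rw [hj]
    have e2 : (-1 : ℂ) ^ ((N : ℤ) - 1 - j) * (-1) ^ N = - (-1) ^ j := by
      rw [zpow_sub₀ (by norm_num), zpow_sub₀ (by norm_num), zpow_natCast, zpow_natCast, zpow_one]
      have : ((-1 : ℂ) ^ N) * (-1) ^ N = 1 := by rw [← mul_pow]; simp
      have h3 : ((-1 : ℂ) ^ j) * (-1) ^ j = 1 := by rw [← mul_pow]; simp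
      field_simp
      linear_combination (-1) * this + h3
    rw [e2, neg_smul, sub_neg_eq_add,
      show (((N - 1 - j : ℤ) : ℂ) - N) = -1 - j by push_cast; ring,
      show m + (N - 1 - j : ℤ) - N = m - 1 - j by ring,
      show k + (N - 1 - j : ℤ) - N = k - 1 - j by ring, delta_expansion hF]
    refine finsum_congr fun m' => ?_
    simp only [hFdef, Int.toNat_natCast]
    congr 2
    congr 1; ring

end Locality

/-! ### Fields on a graded space and their products -/

/-- A `G`-graded complex vector space with a complex valued symmetric form on `G`, a vector `vac`
of degree `0` and an operator `der` of degree `0` (the translation operator) that kills it. -/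
structure ChargedSpace (G W : Type*) [AddCommGroup G] [AddCommGroup W] [Module ℂ W] where
  gr : G → Submodule ℂ W
  indep : iSupIndep gr
  span : ⨆ g, gr g = ⊤
  pairing : G →+ G →+ ℂ
  pairing_comm : ∀ g h, pairing g h = pairing h g
  vac : W
  vac_mem : vac ∈ gr 0
  der : Module.End ℂ W
  der_mem : ∀ g, ∀ w ∈ gr g, der w ∈ gr g
  der_vac : der vac = 0

section Glue

variable {G W : Type*} [AddCommGroup W] [Module ℂ W]

theorem exists_glue {gr : G → Submodule ℂ W} (hi : iSupIndep gr) (hs : ⨆ g, gr g = ⊤)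
    (X : Type*) [AddCommGroup X] [Module ℂ X] :
    ∃ gl : (∀ g, gr g →ₗ[ℂ] X) →ₗ[ℂ] (W →ₗ[ℂ] X), ∀ f g (w : gr g), gl f w = f g w := by
  classical
  have hint : DirectSum.IsInternal gr :=
    (DirectSum.isInternal_submodule_iff_iSupIndep_and_iSup_eq_top gr).2 ⟨hi, hs⟩
  let e := LinearEquiv.ofBijective (DirectSum.coeLinearMap gr) hint
  have he : ∀ g (w : gr g), e.symm (w : W) = DFinsupp.single g w := by
    intro g w
    rw [LinearEquiv.symm_apply_eq]
    exact (DirectSum.coeLinearMap_lof gr g w).symm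
  let e' : W →ₗ[ℂ] Π₀ g, gr g := show W →ₗ[ℂ] DirectSum G fun g => gr g from e.symm
  refine ⟨(LinearMap.lcomp ℂ X e') ∘ₗ
    (DFinsupp.lsum (M := fun g => gr g) (R := ℂ) (N := X) ℂ).toLinearMap, fun f g w => ?_⟩
  have he' : e' w = DFinsupp.single g w := he g w
  simp only [LinearMap.comp_apply, LinearMap.lcomp_apply, LinearEquiv.coe_coe, he']
  simp

/-- Linear maps out of a graded space, given on the homogeneous components. -/
def glue {gr : G → Submodule ℂ W} (hi : iSupIndep gr) (hs : ⨆ g, gr g = ⊤)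
    (X : Type*) [AddCommGroup X] [Module ℂ X] : (∀ g, gr g →ₗ[ℂ] X) →ₗ[ℂ] (W →ₗ[ℂ] X) :=
  (exists_glue hi hs X).choose

theorem glue_apply {gr : G → Submodule ℂ W} (hi : iSupIndep gr) (hs : ⨆ g, gr g = ⊤)
    {X : Type*} [AddCommGroup X] [Module ℂ X] (f : ∀ g, gr g →ₗ[ℂ] X) {g : G} {w : W}
    (hw : w ∈ gr g) : glue hi hs X f w = f g ⟨w, hw⟩ :=
  (exists_glue hi hs X).choose_spec f g ⟨w, hw⟩

theorem linearMap_ext_of_span {gr : G → Submodule ℂ W} (hs : ⨆ g, gr g = ⊤)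
    {X : Type*} [AddCommGroup X] [Module ℂ X] {f f' : W →ₗ[ℂ] X}
    (h : ∀ g, ∀ w ∈ gr g, f w = f' w) : f = f' := by
  refine LinearMap.ext fun w => ?_
  have hw : w ∈ ⨆ g, gr g := hs ▸ Submodule.mem_top
  induction hw using Submodule.iSup_induction' with
  | mem g x hx => exact h g x hx
  | zero => simp
  | add x y _ _ hx hy => simp [hx, hy]

end Glue

section Fields

variable {G W : Type*} [AddCommGroup G] [AddCommGroup W] [Module ℂ W]

/-- The modes of `A` kill every vector from some index on. -/
def Truncated (A : ℤ → Module.End ℂ W) : Prop := ∀ w, ∃ K : ℤ, ∀ n, K ≤ n → A n w = 0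

/-- `A` is a field of charge `g`. Its modes are indexed by integers: on the component of
degree `h`, `A n` stands for the mode with index `n + pairing g h`. -/
structure IsField (S : ChargedSpace G W) (g : G) (A : ℤ → Module.End ℂ W) : Prop where
  maps : ∀ h, ∀ w ∈ S.gr h, ∀ n, A n w ∈ S.gr (g + h)
  trunc : Truncated A

/-- `[der, A(z)] = d/dz A(z)` for a field of charge `g`. -/
def Covariant (S : ChargedSpace G W) (g : G) (A : ℤ → Module.End ℂ W) : Prop :=
  ∀ h, ∀ w ∈ S.gr h, ∀ n : ℤ,
    S.der (A n w) = A n (S.der w) - ((n : ℂ) + S.pairing g h) • A (n - 1) w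

/-- The coefficients of `A(z₁)B(z₂)w`. -/
def opTable (A B : ℤ → Module.End ℂ W) (w : W) (p : ℤ × ℤ) : W := A p.1 (B p.2 w)

/-- `A` and `B` are local of order `N`: `(z₁ - z₂)^{N+r} A(z₁)B(z₂)` and
`(z₁ - z₂)^N (-z₂+z₁)^r B(z₂)A(z₁)` coincide. -/
def LocalWith (N : ℕ) (r : ℂ) (A B : ℤ → Module.End ℂ W) : Prop :=
  ∀ w, LocalPair N r (opTable A B w) fun p => opTable B A w p.swap

/-- `A` and `B` are local of some order. -/
def Local (r : ℂ) (A B : ℤ → Module.End ℂ W) : Prop := ∃ N : ℕ, LocalWith N r A B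

variable {A B : ℤ → Module.End ℂ W}

theorem Truncated.bddSnd (hB : Truncated B) (A : ℤ → Module.End ℂ W) (w : W) :
    BddSnd (opTable A B w) := by
  obtain ⟨K, hK⟩ := hB w
  exact ⟨K, fun m k hk => by simp [opTable, hK k hk]⟩

theorem Truncated.bddFst (hA : Truncated A) (B : ℤ → Module.End ℂ W) (w : W) :
    BddFst fun p => opTable B A w p.swap := by
  obtain ⟨K, hK⟩ := hA w
  exact ⟨K, fun m k hk => by simp [opTable, hK m hk]⟩

theorem LocalWith.mono {N : ℕ} {r : ℂ} (h : LocalWith N r A B) (hA : Truncated A)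
    (hB : Truncated B) (n : ℕ) : LocalWith (N + n) r A B :=
  fun w => (h w).mono (hB.bddSnd A w) (hA.bddFst B w) n

theorem Local.symm {r : ℂ} (h : Local r A B) : Local r B A := by
  obtain ⟨N, hN⟩ := h
  exact ⟨N, fun w => (hN w).symm⟩

/-- The coefficients of `(z₁ - z₂)^{N+r} A(z₁)B(z₂)`. -/
def normProd (N : ℕ) (r : ℂ) (A : ℤ → Module.End ℂ W) {B : ℤ → Module.End ℂ W}
    (hB : Truncated B) (p : ℤ × ℤ) : Module.End ℂ W :=
  finsumLM (fun i : ℕ => PowerSeries.coeff i (oneSubPow (N + r)) •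
    (A (p.1 + N - i) ∘ₗ B (p.2 + i))) fun w => by
      refine (summable_left (hB.bddSnd A w) (p.1 + N, p.2)).subset fun i hi h0 => hi ?_
      simp only [Prod.smul_mk, smul_neg, nsmul_eq_mul, mul_one, Prod.mk_add_mk, opTable,
        ← sub_eq_add_neg] at h0
      simp [h0]

theorem normProd_apply (N : ℕ) (r : ℂ) (A : ℤ → Module.End ℂ W) (hB : Truncated B)
    (p : ℤ × ℤ) (w : W) : normProd N r A hB p w =
      act (oneSubPow (N + r)) ((-1, 1) : ℤ × ℤ) (opTable A B w) (p.1 + N, p.2) := by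
  rw [act_left_apply]
  rfl

theorem LocalWith.normProd_bounded {N : ℕ} {r : ℂ} (h : LocalWith N r A B) (hA : Truncated A)
    (hB : Truncated B) (w : W) : BoundedAbove fun p => normProd N r A hB p w := by
  simp only [normProd_apply]
  exact (h w).boundedAbove (hB.bddSnd A w) (hA.bddFst B w)

/-- The product `A_n B` of two local fields, `A` of charge `g`: for `n = N - 1 - j` it is the
coefficient of `z₀^j` of `F(z₂ + z₀, z₂)`, where `F(z₁, z₂) = (z₁ - z₂)^{N+r} A(z₁)B(z₂)`. -/
def nProd (S : ChargedSpace G W) (g : G) {N : ℕ} {r : ℂ} (h : LocalWith N r A B)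
    (hA : Truncated A) (hB : Truncated B) (n q : ℤ) : Module.End ℂ W :=
  if (N : ℤ) ≤ n then 0 else
    glue S.indep S.span W fun g' => (finsumLM (fun m : ℤ =>
      Ring.choose (-(m : ℂ) - S.pairing g g' - 1) (N - 1 - n).toNat •
        normProd N r A hB (m, q + n - N - m)) fun w => by
          refine ((h.normProd_bounded hA hB w).antidiagonal_finite (q + n - N)).subset
            fun m hm h0 => hm ?_
          rw [LinearMap.smul_apply, h0, smul_zero]) ∘ₗ (S.gr g').subtype

theorem nProd_of_le (S : ChargedSpace G W) (g : G) {N : ℕ} {r : ℂ} (h : LocalWith N r A B)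
    (hA : Truncated A) (hB : Truncated B) {n : ℤ} (hn : (N : ℤ) ≤ n) (q : ℤ) :
    nProd S g h hA hB n q = 0 := by
  rw [nProd, if_pos hn]

theorem nProd_apply (S : ChargedSpace G W) (g : G) {N : ℕ} {r : ℂ} (h : LocalWith N r A B)
    (hA : Truncated A) (hB : Truncated B) {n : ℤ} (hn : n < N) (q : ℤ) {g' : G} {w : W}
    (hw : w ∈ S.gr g') : nProd S g h hA hB n q w = ∑ᶠ m : ℤ,
      Ring.choose (-(m : ℂ) - S.pairing g g' - 1) (N - 1 - n).toNat •
        normProd N r A hB (m, q + n - N - m) w := by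
  rw [nProd, if_neg (by omega), glue_apply S.indep S.span _ hw]
  rfl

theorem IsField.normProd_mem {S : ChargedSpace G W} {g h : G} (hA : IsField S g A)
    (hB : IsField S h B) (N : ℕ) (r : ℂ) (p : ℤ × ℤ) {g' : G} {w : W} (hw : w ∈ S.gr g') :
    normProd N r A hB.trunc p w ∈ S.gr (g + h + g') := by
  refine finsum_mem_submodule _ fun i => Submodule.smul_mem _ _ ?_
  rw [add_assoc]
  exact hA.maps _ _ (hB.maps _ _ hw _) _

theorem IsField.nProd {S : ChargedSpace G W} {g h : G} (hA : IsField S g A)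
    (hB : IsField S h B) {N : ℕ} {r : ℂ} (hl : LocalWith N r A B) (n : ℤ) :
    IsField S (g + h) (nProd S g hl hA.trunc hB.trunc n) := by
  by_cases hn : (N : ℤ) ≤ n
  · constructor
    · intro g' w _ q
      rw [nProd_of_le _ _ _ _ _ hn]; exact Submodule.zero_mem _
    · intro w
      exact ⟨0, fun q _ => by rw [nProd_of_le _ _ _ _ _ hn]; rfl⟩
  · constructor
    · intro g' w hw q
      rw [nProd_apply _ _ _ _ _ (by omega) _ hw]
      exact finsum_mem_submodule _ fun m => Submodule.smul_mem _ _ (hA.normProd_mem hB _ _ _ hw)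
    · intro w
      have hw : w ∈ ⨆ g, S.gr g := S.span ▸ Submodule.mem_top
      induction hw using Submodule.iSup_induction' with
      | mem g' w hw =>
        obtain ⟨M, hM⟩ := hl.normProd_bounded hA.trunc hB.trunc w
        refine ⟨2 * M + N - n, fun q hq => ?_⟩
        rw [nProd_apply _ _ _ _ _ (by omega) _ hw]
        refine finsum_eq_zero_of_forall_eq_zero fun m => ?_
        by_cases h0 : ZAlgebra.normProd N r A hB.trunc (m, q + n - N - m) w = 0
        · rw [h0, smul_zero]
        · have := hM _ h0
          simp only at this
          omega
      | zero => exact ⟨0, fun q _ => by simp⟩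
      | add x y _ _ hx hy =>
        obtain ⟨K, hK⟩ := hx
        obtain ⟨K', hK'⟩ := hy
        exact ⟨max K K', fun q hq => by rw [map_add, hK q (by omega), hK' q (by omega), add_zero]⟩

/-- The Jacobi identity for `A`, `B` and a family `D` of products, applied to `w`. The number `s`
is the pairing of the charges of `A` and `w`. -/
def JacobiFor (r s : ℂ) (A B : ℤ → Module.End ℂ W) (D : ℤ → ℤ → Module.End ℂ W) (w : W) : Prop :=
  ∀ n m k : ℤ, act (oneSubPow (n + r)) ((-1, 1) : ℤ × ℤ) (opTable A B w) (m + n, k) -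
      (-1 : ℂ) ^ n • act (oneSubPow (n + r)) ((1, -1) : ℤ × ℤ)
        (fun p => opTable B A w p.swap) (m, k + n) =
    ∑ᶠ i : ℕ, Ring.choose (m + s) i • D (n + i) (m + k - i) w

/-- The products `A_n B` of local fields satisfy the Jacobi identity: both sides are combinations of
the coefficients of `F(z₁, z₂) = (z₁ - z₂)^{N+r} A(z₁)B(z₂)`, and the coefficients agree by
Vandermonde's identity. -/
theorem jacobiFor_nProd (S : ChargedSpace G W) (g : G) {N : ℕ} {r : ℂ} (h : LocalWith N r A B)
    (hA : Truncated A) (hB : Truncated B) {g' : G} {w : W} (hw : w ∈ S.gr g') :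
    JacobiFor r (S.pairing g g') A B (nProd S g h hA hB) w := by
  intro n m k
  rw [(h w).commutator (hB.bddSnd A w) (hA.bddFst B w)]
  set s := S.pairing g g'
  split_ifs with hn
  · refine (finsum_eq_zero_of_forall_eq_zero fun i => ?_).symm
    rw [nProd_of_le _ _ _ _ _ (by omega)]; simp
  · obtain ⟨j, hj⟩ := Int.eq_ofNat_of_zero_le (show 0 ≤ N - 1 - n by omega)
    have hn' : n = N - 1 - j := by omega
    rw [hj, Int.toNat_natCast]
    have hfin := (h.normProd_bounded hA hB w).antidiagonal_finite (m + k + n - N)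
    set F : ℤ → W := fun m' => normProd N r A hB (m', m + k + n - N - m') w with hF
    have hsum : ∀ c : ℤ → ℂ, ∑ᶠ m', c m' • F m' = ∑ m' ∈ hfin.toFinset, c m' • F m' := by
      intro c
      refine finsum_eq_sum_of_support_subset _ fun m' hm' => ?_
      rw [Set.Finite.coe_toFinset]
      intro h0
      exact hm' (by rw [hF]; simp only; rw [h0, smul_zero])
    have hL : ∑ᶠ m' : ℤ, Ring.choose ((m : ℂ) - m' - 1) j •
        act (oneSubPow (N + r)) ((-1, 1) : ℤ × ℤ) (opTable A B w)
          (m' + N, m + k + n - N - m') =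
        ∑ᶠ m' : ℤ, Ring.choose ((m : ℂ) - m' - 1) j • F m' := by
      refine finsum_congr fun m' => ?_
      rw [hF]; simp only; rw [normProd_apply]
    rw [hL, hsum]
    rw [finsum_eq_sum_of_support_subset (s := Finset.range (j + 1))]
    · have hR : ∀ i ∈ Finset.range (j + 1),
          Ring.choose ((m : ℂ) + s) i • nProd S g h hA hB (n + i) (m + k - i) w =
          ∑ m' ∈ hfin.toFinset, (Ring.choose ((m : ℂ) + s) i *
            Ring.choose (-(m' : ℂ) - s - 1) (j - i)) • F m' := by
        intro i hi
        rw [Finset.mem_range] at hi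
        rw [nProd_apply _ _ _ _ _ (by omega) _ hw]
        have e1 : ((N : ℤ) - 1 - (n + i)).toNat = j - i := by omega
        rw [e1]
        have e2 : (fun m' : ℤ => Ring.choose (-(m' : ℂ) - s - 1) (j - i) •
            normProd N r A hB (m', m + k - i + (n + i) - N - m') w) =
            fun m' : ℤ => Ring.choose (-(m' : ℂ) - s - 1) (j - i) • F m' := by
          funext m'
          rw [hF]; simp only
          rw [show m + k - i + (n + i) - N - m' = m + k + n - N - m' by ring]
        rw [e2, hsum, Finset.smul_sum]
        simp only [mul_smul]
      rw [Finset.sum_congr rfl hR, Finset.sum_comm]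
      refine Finset.sum_congr rfl fun m' _ => ?_
      rw [← Finset.sum_smul]
      congr 1
      rw [show ((m : ℂ) - m' - 1) = (m + s) + (-m' - s - 1) by ring,
        Ring.add_choose_eq _ (Commute.all _ _),
        Finset.Nat.sum_antidiagonal_eq_sum_range_succ
          (fun a b => Ring.choose ((m : ℂ) + s) a * Ring.choose (-(m' : ℂ) - s - 1) b)]
    · intro i hi
      rw [Finset.mem_coe, Finset.mem_range]
      by_contra h0
      exact hi (by simp only; rw [nProd_of_le _ _ _ _ _ (by omega)]; simp)

theorem succ_mul_choose_succ (y : ℂ) (j : ℕ) :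
    ((j : ℂ) + 1) * Ring.choose y (j + 1) = (y - j) * Ring.choose y j := by
  have h := Ring.choose_smul_choose y (n := j + 1) (k := j) (by omega)
  rw [Nat.choose_succ_self_right, nsmul_eq_mul, show j + 1 - j = 1 by omega,
    Ring.choose_one_right] at h
  push_cast at h
  rw [h, mul_comm]

theorem succ_mul_choose_succ' (y : ℂ) (j : ℕ) :
    ((j : ℂ) + 1) * Ring.choose y (j + 1) = y * Ring.choose (y - 1) j := by
  have h := Ring.choose_smul_choose y (n := j + 1) (k := 1) (by omega)
  rw [Nat.choose_one_right, nsmul_eq_mul, show j + 1 - 1 = j by omega,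
    Ring.choose_one_right] at h
  push_cast at h
  rw [h]

theorem coeff_oneSubPow_succ (x : ℂ) (i : ℕ) :
    ((i : ℂ) + 1) * PowerSeries.coeff (i + 1) (oneSubPow x) =
      -((x - i) * PowerSeries.coeff i (oneSubPow x)) := by
  rw [coeff_oneSubPow, coeff_oneSubPow, pow_succ]
  linear_combination (-(-1) ^ i) * succ_mul_choose_succ x i

/-- On `(z₁ - z₂)^{N+r} A(z₁)B(z₂)` the commutator with `der` is `∂₁ + ∂₂`, as this derivation kills
powers of `z₁ - z₂`. -/
theorem der_normProd {S : ChargedSpace G W} {g h : G} (hB : IsField S h B)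
    (cA : Covariant S g A) (cB : Covariant S h B) (N : ℕ) {g' : G} {w : W} (hw : w ∈ S.gr g')
    (m k : ℤ) : S.der (normProd N (S.pairing g h) A hB.trunc (m, k) w) =
      normProd N (S.pairing g h) A hB.trunc (m, k) (S.der w) -
        ((m : ℂ) + S.pairing g g') • normProd N (S.pairing g h) A hB.trunc (m - 1, k) w -
        ((k : ℂ) + S.pairing h g') • normProd N (S.pairing g h) A hB.trunc (m, k - 1) w := by
  obtain ⟨K, hK⟩ := hB.trunc w
  obtain ⟨K', hK'⟩ := hB.trunc (S.der w)
  set L : ℕ := (max K K' - k).toNat + 1 with hL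
  set r := S.pairing g h
  have hsum : ∀ (v : W) (m k₁ : ℤ), (∀ i : ℕ, L < i → B (k₁ + i) v = 0) →
      normProd N r A hB.trunc (m, k₁) v = ∑ i ∈ Finset.range (L + 1),
        PowerSeries.coeff i (oneSubPow (N + r)) • A (m + N - i) (B (k₁ + i) v) := by
    intro v m k₁ hv
    change ∑ᶠ i : ℕ, _ = _
    refine finsum_eq_sum_of_support_subset _ fun i hi => ?_
    rw [Finset.mem_coe, Finset.mem_range]
    by_contra h0
    exact hi (by simp [hv i (by omega)])
  rw [hsum w m k fun i hi => hK _ (by omega), hsum (S.der w) m k fun i hi => hK' _ (by omega),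
    hsum w (m - 1) k fun i hi => hK _ (by omega),
    hsum w m (k - 1) fun i hi => hK _ (by omega), map_sum]
  have hterm : ∀ i ∈ Finset.range (L + 1),
      S.der (PowerSeries.coeff i (oneSubPow (N + r)) • A (m + N - i) (B (k + i) w)) =
      PowerSeries.coeff i (oneSubPow (N + r)) • A (m + N - i) (B (k + i) (S.der w)) -
      ((m : ℂ) + S.pairing g g') • PowerSeries.coeff i (oneSubPow (N + r)) •
        A (m - 1 + N - i) (B (k + i) w) -
      ((k : ℂ) + S.pairing h g') • PowerSeries.coeff i (oneSubPow (N + r)) •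
        A (m + N - i) (B (k - 1 + i) w) -
      (((N + r - i) * PowerSeries.coeff i (oneSubPow (N + r))) • A (m - 1 + N - i) (B (k + i) w) +
        (i * PowerSeries.coeff i (oneSubPow (N + r))) • A (m + N - i) (B (k - 1 + i) w)) := by
    intro i _
    rw [map_smul, cA _ _ (hB.maps _ _ hw _), cB _ _ hw, map_sub, map_smul,
      show m + N - i - 1 = m - 1 + N - i by ring, show k + i - 1 = k - 1 + i by ring, map_add]
    push_cast
    change _ • (_ - (_ + (r + _)) • _) = _
    module
  rw [Finset.sum_congr rfl hterm]
  simp only [Finset.sum_sub_distrib, ← Finset.smul_sum]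
  rw [sub_eq_self]
  -- The terms from the derivatives of the factor `(z₁ - z₂)^{N+r}` telescope.
  have tel : ∀ l : ℕ, ∑ i ∈ Finset.range (l + 1),
      (((N + r - i) * PowerSeries.coeff i (oneSubPow (N + r))) • A (m - 1 + N - i) (B (k + i) w) +
        (i * PowerSeries.coeff i (oneSubPow (N + r))) • A (m + N - i) (B (k - 1 + i) w)) =
      ((N + r - l) * PowerSeries.coeff l (oneSubPow (N + r))) •
        A (m - 1 + N - l) (B (k + l) w) := by
    intro l
    induction l with
    | zero => simp
    | succ l ih =>
      rw [Finset.sum_range_succ, ih]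
      push_cast
      rw [coeff_oneSubPow_succ, show m + N - ((l : ℤ) + 1) = m - 1 + N - l by ring,
        show k - 1 + ((l : ℤ) + 1) = k + l by ring]
      module
  rw [tel, hK _ (by omega)]
  simp

/-- Products of covariant fields are covariant: `∂₂ (F(z₂ + z₀, z₂)) = ((∂₁ + ∂₂) F)(z₂ + z₀, z₂)`. -/
theorem Covariant.nProd {S : ChargedSpace G W} {g h : G} (hA : IsField S g A)
    (hB : IsField S h B) (cA : Covariant S g A) (cB : Covariant S h B) {N : ℕ}
    (hl : LocalWith N (S.pairing g h) A B) (n : ℤ) :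
    Covariant S (g + h) (nProd S g hl hA.trunc hB.trunc n) := by
  intro g' w hw q
  by_cases hn : (N : ℤ) ≤ n
  · rw [nProd_of_le _ _ _ _ _ hn, nProd_of_le _ _ _ _ _ hn]; simp
  · have hn' : n < N := by omega
    obtain ⟨j, hj⟩ := Int.eq_ofNat_of_zero_le (show 0 ≤ N - 1 - n by omega)
    rw [nProd_apply _ _ _ _ _ hn' _ hw, nProd_apply _ _ _ _ _ hn' _ (S.der_mem _ _ hw),
      nProd_apply _ _ _ _ _ hn' _ hw, hj, Int.toNat_natCast]
    set r := S.pairing g h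
    set s := S.pairing g g' with hs
    set Φ := normProd N r A hB.trunc with hΦ
    have hbd := hl.normProd_bounded hA.trunc hB.trunc
    have f1 := (hbd w).antidiagonal_finite (q + n - N)
    have f2 := (hbd (S.der w)).antidiagonal_finite (q + n - N)
    have f3 := (hbd w).antidiagonal_finite (q - 1 + n - N)
    have f3' := f3.image (fun m => m + 1)
    have S0 : ∀ (c : ℤ → ℂ) (f : ℤ → W), {m | f m ≠ 0}.Finite →
        (Function.support fun m => c m • f m).Finite := by
      intro c f hf
      refine hf.subset fun m hm h0 => hm ?_
      simp only [h0, smul_zero]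
    have key : S.der (∑ᶠ m : ℤ, Ring.choose (-(m : ℂ) - s - 1) j • Φ (m, q + n - N - m) w) =
        ∑ᶠ m : ℤ, Ring.choose (-(m : ℂ) - s - 1) j • S.der (Φ (m, q + n - N - m) w) := by
      change S.der.toAddMonoidHom _ = _
      rw [AddMonoidHom.map_finsum _ (S0 _ _ f1)]
      exact finsum_congr fun m => S.der.map_smul _ _
    rw [key]
    have hterm : ∀ m : ℤ, Ring.choose (-(m : ℂ) - s - 1) j • S.der (Φ (m, q + n - N - m) w) =
        Ring.choose (-(m : ℂ) - s - 1) j • Φ (m, q + n - N - m) (S.der w) -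
        (Ring.choose (-(m : ℂ) - s - 1) j * (m + s)) •
            Φ (m - 1, q - 1 + n - N - (m - 1)) w -
        (Ring.choose (-(m : ℂ) - s - 1) j * (((q + n - N - m : ℤ) : ℂ) + S.pairing h g')) •
            Φ (m, q - 1 + n - N - m) w := by
      intro m
      rw [hΦ, der_normProd hB cA cB N hw, show q - 1 + n - N - (m - 1) = q + n - N - m by ring,
        show q - 1 + n - N - m = q + n - N - m - 1 by ring]
      simp only [smul_sub, smul_smul, r, hs]
    have f4 : {m : ℤ | Φ (m - 1, q - 1 + n - N - (m - 1)) w ≠ 0}.Finite := by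
      refine f3'.subset fun m hm => ⟨m - 1, hm, by simp⟩
    rw [finsum_congr hterm, finsum_sub_distrib
        (((S0 _ _ f2).union (S0 _ _ f4)).subset (Function.support_sub _ _)) (S0 _ _ f3),
      finsum_sub_distrib (S0 _ _ f2) (S0 _ _ f4), sub_sub]
    congr 1
    have shift : ∑ᶠ m : ℤ, (Ring.choose (-(m : ℂ) - s - 1) j * (m + s)) •
            Φ (m - 1, q - 1 + n - N - (m - 1)) w =
        ∑ᶠ m : ℤ, (Ring.choose (-(m : ℂ) - s - 1 - 1) j * (m + s + 1)) •
            Φ (m, q - 1 + n - N - m) w := by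
      rw [← finsum_comp_equiv (Equiv.addRight (1 : ℤ))]
      refine finsum_congr fun m => ?_
      simp only [Equiv.coe_addRight]
      rw [show m + 1 - 1 = m by ring,
        show (-((m + 1 : ℤ) : ℂ) - s - 1) = -m - s - 1 - 1 by push_cast; ring,
        show (((m + 1 : ℤ) : ℂ) + s) = m + s + 1 by push_cast; ring]
    rw [shift, ← finsum_add_distrib (S0 _ _ f3) (S0 _ _ f3), smul_finsum_of_field]
    refine finsum_congr fun m => ?_
    rw [← add_smul, smul_smul]
    congr 1
    have e1 := succ_mul_choose_succ (-(m : ℂ) - s - 1) j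
    have e2 := succ_mul_choose_succ' (-(m : ℂ) - s - 1) j
    have e3 : (j : ℂ) = N - 1 - n := by
      have : ((j : ℤ) : ℂ) = ((N - 1 - n : ℤ) : ℂ) := by rw [hj]
      push_cast at this; exact this
    rw [map_add, AddMonoidHom.add_apply, ← hs]
    push_cast
    have e4 := e1.symm.trans e2
    rw [e3] at e4
    linear_combination e4

/-- The constant term of `(A_n B)(z)𝟏` is `A_n B_{-1}𝟏`, and no negative powers of `z` occur. -/
theorem nProd_vac {S : ChargedSpace G W} {g h : G} (hA : IsField S g A) (hB : IsField S h B)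
    (vA : ∀ n : ℤ, 0 ≤ n → A n S.vac = 0) (vB : ∀ n : ℤ, 0 ≤ n → B n S.vac = 0) {N : ℕ}
    (hl : LocalWith N (S.pairing g h) A B) (n k : ℤ) (hk : -1 ≤ k) :
    nProd S g hl hA.trunc hB.trunc n k S.vac = if k = -1 then A n (B (-1) S.vac) else 0 := by
  -- The vacuum has charge `0`, so for `m = 0` the binomial coefficients on the right vanish for
  -- `i ≠ 0`.
  have hj := jacobiFor_nProd S g hl hA.trunc hB.trunc S.vac_mem n 0 k
  have hR : ∑ᶠ i : ℕ, Ring.choose (((0 : ℤ) : ℂ) + S.pairing g 0) i •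
      nProd S g hl hA.trunc hB.trunc (n + i) (0 + k - i) S.vac =
      nProd S g hl hA.trunc hB.trunc n k S.vac := by
    rw [finsum_eq_single _ 0]
    · simp
    · intro i hi
      simp [Ring.choose_zero_ite, hi]
  rw [hR] at hj
  rw [← hj, act_right_apply, finsum_eq_zero_of_forall_eq_zero (f := fun i : ℕ => _ • _), smul_zero,
    sub_zero, act_left_apply, finsum_eq_single _ 0]
  · simp only [coeff_oneSubPow, opTable]
    split_ifs with h1
    · subst h1; simp
    · simp [vB k (by omega)]
  · intro i hi
    simp [opTable, vB (k + i) (by omega)]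
  · intro i
    simp [opTable, vA i (by omega)]

end Fields

/-! ### Dong's lemma: products of local fields are local -/

section Rho

variable {W : Type*} [AddCommGroup W] [Module ℂ W]

/-- For a family `G`, the coefficients of `G(z₁, z₂, z₃)`, the family of the coefficients of `z₀^c`
in `G(z₂ + z₀, z₂, z₃)`; here `z₁` occurs with exponents in `-y + ℤ`. -/
def restrictDiag (y : ℂ) (c : ℕ) (G : ℤ × ℤ × ℤ → W) (p : ℤ × ℤ) : W :=
  ∑ᶠ m : ℤ, Ring.choose (-(m : ℂ) - y - 1) c • G (m, p.1 - m, p.2)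

theorem restrictDiag_ne_zero {y : ℂ} {c : ℕ} {G : ℤ × ℤ × ℤ → W} {p : ℤ × ℤ}
    (h : restrictDiag y c G p ≠ 0) : ∃ m, G (m, p.1 - m, p.2) ≠ 0 := by
  by_contra! h0
  exact h (by simp [restrictDiag, h0])

theorem finsum_choose_add (y z : ℂ) (j : ℕ) {G : ℤ × ℤ × ℤ → W} (Q k : ℤ)
    (h : {m : ℤ | G (m, Q - m, k) ≠ 0}.Finite) :
    ∑ᶠ m : ℤ, Ring.choose (-(m : ℂ) - y - 1 + z) j • G (m, Q - m, k) =
      ∑ b ∈ Finset.range (j + 1), Ring.choose z b • restrictDiag y (j - b) G (Q, k) := by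
  simp only [restrictDiag]
  simp_rw [smul_finsum_of_field]
  rw [← finsum_sum_comm]
  · refine finsum_congr fun m => ?_
    rw [add_comm, Ring.add_choose_eq _ (Commute.all _ _),
      Finset.Nat.sum_antidiagonal_eq_sum_range_succ
        (fun a b => Ring.choose z a * Ring.choose (-(m : ℂ) - y - 1) b), Finset.sum_smul]
    exact Finset.sum_congr rfl fun b _ => mul_smul _ _ _
  · intro b _
    refine h.subset fun m hm h0 => hm ?_
    simp only [h0, smul_zero]

theorem choose_mul_choose_sub (x : ℂ) (i b : ℕ) :
    Ring.choose x i * Ring.choose (x - i) b = Ring.choose x b * Ring.choose (x - b) i := by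
  have h1 := Ring.choose_smul_choose x (n := i + b) (k := i) (by omega)
  have h2 := Ring.choose_smul_choose x (n := i + b) (k := b) (by omega)
  rw [show i + b - i = b by omega] at h1
  rw [show i + b - b = i by omega] at h2
  rw [← h1, ← h2, Nat.choose_symm_add]

/-- Multiplication by `(z₁ - z₃)^x` (first expansion) before the substitution `z₁ = z₂ + z₀`. -/
theorem restrictDiag_act_fst (x y : ℂ) (j : ℕ) {G : ℤ × ℤ × ℤ → W} (Q k : ℤ)
    (h : {p : ℕ × ℤ | G (p.2, Q - p.1 - p.2, k + p.1) ≠ 0}.Finite) :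
    restrictDiag (y - x) j (act (oneSubPow x) ((-1, 0, 1) : ℤ × ℤ × ℤ) G) (Q, k) =
      ∑ b ∈ Finset.range (j + 1), Ring.choose x b •
        act (oneSubPow (x - b)) ((-1, 1) : ℤ × ℤ) (restrictDiag y (j - b) G) (Q, k) := by
  have e1 : restrictDiag (y - x) j (act (oneSubPow x) ((-1, 0, 1) : ℤ × ℤ × ℤ) G) (Q, k) =
      ∑ᶠ (m : ℤ) (i : ℕ), (Ring.choose (-(m : ℂ) - (y - x) - 1) j *
        PowerSeries.coeff i (oneSubPow x)) • G (m - i, Q - m, k + i) := by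
    refine finsum_congr fun m => ?_
    rw [act, smul_finsum_of_field]
    refine finsum_congr fun i => ?_
    simp [smul_smul, sub_eq_add_neg]
  rw [e1, finsum_comm_of_finite]
  · have e2 : ∀ i : ℕ, ∑ᶠ m : ℤ, (Ring.choose (-(m : ℂ) - (y - x) - 1) j *
          PowerSeries.coeff i (oneSubPow x)) • G (m - i, Q - m, k + i) =
        ∑ b ∈ Finset.range (j + 1), (Ring.choose x b *
          PowerSeries.coeff i (oneSubPow (x - b))) • restrictDiag y (j - b) G (Q - i, k + i) := by
      intro i
      rw [← finsum_comp_equiv (Equiv.addRight (i : ℤ))]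
      have e3 : ∀ m : ℤ, (Ring.choose (-((m + i : ℤ) : ℂ) - (y - x) - 1) j *
          PowerSeries.coeff i (oneSubPow x)) • G (m + i - i, Q - (m + i), k + i) =
          PowerSeries.coeff i (oneSubPow x) •
            Ring.choose (-(m : ℂ) - y - 1 + (x - i)) j • G (m, Q - i - m, k + i) := by
        intro m
        rw [smul_smul, mul_comm, show m + (i : ℤ) - i = m by ring,
          show Q - (m + (i : ℤ)) = Q - i - m by ring,
          show -((m + i : ℤ) : ℂ) - (y - x) - 1 = -(m : ℂ) - y - 1 + (x - i) by
            push_cast; ring]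
      simp only [Equiv.coe_addRight]
      rw [finsum_congr e3, ← smul_finsum_of_field, finsum_choose_add, Finset.smul_sum]
      · refine Finset.sum_congr rfl fun b _ => ?_
        rw [smul_smul, coeff_oneSubPow, coeff_oneSubPow]
        congr 1
        linear_combination ((-1) ^ i) * choose_mul_choose_sub x i b
      · refine (h.image Prod.snd).subset fun m hm => ⟨(i, m), hm, rfl⟩
    rw [finsum_congr e2, finsum_sum_comm]
    · refine Finset.sum_congr rfl fun b _ => ?_
      rw [act_left_apply, smul_finsum_of_field]
      exact finsum_congr fun i => mul_smul _ _ _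
    · intro b _
      refine (h.image Prod.fst).subset fun i hi => ?_
      have : restrictDiag y (j - b) G (Q - i, k + i) ≠ 0 := fun h0 => hi (by simp only [h0, smul_zero])
      obtain ⟨m, hm⟩ := restrictDiag_ne_zero this
      exact ⟨(i, m), hm, rfl⟩
  · refine (h.image fun p : ℕ × ℤ => (p.2 + p.1, p.1)).subset fun p hp => ?_
    refine ⟨(p.2, p.1 - p.2), fun h0 => hp ?_, by simp⟩
    simp only at h0 ⊢
    rw [show Q - (p.2 : ℤ) - (p.1 - p.2) = Q - p.1 by ring] at h0
    rw [h0, smul_zero]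

theorem natCast_choose_mul_choose (x : ℂ) (b i : ℕ) :
    Ring.choose (((b + i : ℕ) : ℂ)) b * Ring.choose x (b + i) =
      Ring.choose x b * Ring.choose (x - b) i := by
  have h1 := Ring.choose_smul_choose x (n := b + i) (k := b) (by omega)
  rw [show b + i - b = i by omega, nsmul_eq_mul] at h1
  rw [← h1, Ring.choose_natCast]

/-- Multiplication by `(-z₃ + z₁)^x` (second expansion) before the substitution
`z₁ = z₂ + z₀`. -/
theorem restrictDiag_act_snd (x y : ℂ) (j : ℕ) {G : ℤ × ℤ × ℤ → W} (Q k : ℤ)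
    (h : {p : ℕ × ℤ | G (p.2, Q + p.1 - p.2, k - p.1) ≠ 0}.Finite) :
    restrictDiag y j (act (oneSubPow x) ((1, 0, -1) : ℤ × ℤ × ℤ) G) (Q, k) =
      ∑ b ∈ Finset.range (j + 1), ((-1) ^ b * Ring.choose x b) •
        act (oneSubPow (x - b)) ((1, -1) : ℤ × ℤ) (restrictDiag y (j - b) G)
          (Q + b, k - b) := by
  have e1 : restrictDiag y j (act (oneSubPow x) ((1, 0, -1) : ℤ × ℤ × ℤ) G) (Q, k) =
      ∑ᶠ (m : ℤ) (i : ℕ), (Ring.choose (-(m : ℂ) - y - 1) j *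
        PowerSeries.coeff i (oneSubPow x)) • G (m + i, Q - m, k - i) := by
    refine finsum_congr fun m => ?_
    rw [act, smul_finsum_of_field]
    refine finsum_congr fun i => ?_
    simp [smul_smul, sub_eq_add_neg]
  rw [e1, finsum_comm_of_finite]
  · have e2 : ∀ i : ℕ, ∑ᶠ m : ℤ, (Ring.choose (-(m : ℂ) - y - 1) j *
          PowerSeries.coeff i (oneSubPow x)) • G (m + i, Q - m, k - i) =
        ∑ b ∈ Finset.range (j + 1), (Ring.choose (i : ℂ) b *
          PowerSeries.coeff i (oneSubPow x)) • restrictDiag y (j - b) G (Q + i, k - i) := by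
      intro i
      rw [← finsum_comp_equiv (Equiv.subRight (i : ℤ))]
      have e3 : ∀ m : ℤ, (Ring.choose (-((m - i : ℤ) : ℂ) - y - 1) j *
          PowerSeries.coeff i (oneSubPow x)) • G (m - i + i, Q - (m - i), k - i) =
          PowerSeries.coeff i (oneSubPow x) •
            Ring.choose (-(m : ℂ) - y - 1 + i) j • G (m, Q + i - m, k - i) := by
        intro m
        rw [smul_smul, mul_comm, show m - (i : ℤ) + i = m by ring,
          show Q - (m - (i : ℤ)) = Q + i - m by ring,
          show -((m - i : ℤ) : ℂ) - y - 1 = -(m : ℂ) - y - 1 + i by push_cast; ring]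
      simp only [Equiv.subRight_apply]
      rw [finsum_congr e3, ← smul_finsum_of_field, finsum_choose_add, Finset.smul_sum]
      · refine Finset.sum_congr rfl fun b _ => ?_
        rw [smul_smul, mul_comm]
      · refine (h.image Prod.snd).subset fun m hm => ⟨(i, m), hm, rfl⟩
    rw [finsum_congr e2, finsum_sum_comm]
    · refine Finset.sum_congr rfl fun b _ => ?_
      rw [act_right_apply, smul_finsum_of_field]
      rw [← finsum_comp_of_injective (g := fun i : ℕ => b + i)]
      · refine finsum_congr fun i => ?_
        rw [smul_smul]
        congr 1
        · rw [coeff_oneSubPow, coeff_oneSubPow, pow_add]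
          linear_combination ((-1) ^ b * (-1) ^ i) * natCast_choose_mul_choose x b i
        · congr 2 <;> push_cast <;> ring
      · intro a c hac; simpa using hac
      · intro i hi
        have hb : b ≤ i := by
          by_contra h0
          refine hi ?_
          rw [Ring.choose_natCast, Nat.choose_eq_zero_of_lt (by omega)]
          simp
        exact ⟨i - b, by simp only; omega⟩
    · intro b _
      refine (h.image Prod.fst).subset fun i hi => ?_
      have : restrictDiag y (j - b) G (Q + i, k - i) ≠ 0 := fun h0 => hi (by simp only [h0, smul_zero])
      obtain ⟨m, hm⟩ := restrictDiag_ne_zero this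
      exact ⟨(i, m), hm, rfl⟩
  · refine (h.image fun p : ℕ × ℤ => (p.2 - p.1, p.1)).subset fun p hp => ?_
    refine ⟨(p.2, p.1 + p.2), fun h0 => hp ?_, by simp⟩
    simp only at h0 ⊢
    rw [show Q + (p.2 : ℤ) - (p.1 + p.2) = Q - p.1 by ring] at h0
    rw [h0, smul_zero]

/-- The substitution `z₁ = z₂ + z₀` commutes with multiplication by series in `z₂`, `z₃`. -/
theorem restrictDiag_act_of_fst_eq_zero (p : PowerSeries ℂ) (y : ℂ) (c : ℕ) {G : ℤ × ℤ × ℤ → W}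
    (Q k ε : ℤ) (h : {p : ℕ × ℤ | G (p.2, Q - ε * p.1 - p.2, k + ε * p.1) ≠ 0}.Finite) :
    restrictDiag y c (act p ((0, -ε, ε) : ℤ × ℤ × ℤ) G) (Q, k) =
      act p ((-ε, ε) : ℤ × ℤ) (restrictDiag y c G) (Q, k) := by
  have e1 : restrictDiag y c (act p ((0, -ε, ε) : ℤ × ℤ × ℤ) G) (Q, k) =
      ∑ᶠ (m : ℤ) (i : ℕ), (Ring.choose (-(m : ℂ) - y - 1) c *
        PowerSeries.coeff i p) • G (m, Q - ε * i - m, k + ε * i) := by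
    refine finsum_congr fun m => ?_
    rw [act, smul_finsum_of_field]
    refine finsum_congr fun i => ?_
    rw [smul_smul]
    congr 2
    simp only [Prod.smul_mk, smul_zero, Prod.mk_add_mk, add_zero, Prod.mk.injEq, true_and,
      nsmul_eq_mul]
    constructor <;> ring
  rw [e1, finsum_comm_of_finite]
  · refine finsum_congr fun i => ?_
    rw [restrictDiag, smul_finsum_of_field]
    refine finsum_congr fun m => ?_
    rw [smul_smul, mul_comm]
    congr 2
    simp only [Prod.smul_mk, Prod.mk_add_mk, Prod.mk.injEq, true_and, nsmul_eq_mul]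
    constructor <;> ring
  · refine (h.image Prod.swap).subset fun p hp => ⟨p.swap, fun h0 => hp ?_, by simp⟩
    simp only [Prod.fst_swap, Prod.snd_swap] at h0
    simp only [h0, smul_zero]

/-- Local pairs of families that are bounded above in the appropriate index. -/
def BddLocalPair (N : ℕ) (r : ℂ) (T T' : ℤ × ℤ → W) : Prop :=
  LocalPair N r T T' ∧ BddSnd T ∧ BddFst T'

theorem BddSnd.add {T T' : ℤ × ℤ → W} (h : BddSnd T) (h' : BddSnd T') : BddSnd (T + T') := by
  obtain ⟨K, hK⟩ := h
  obtain ⟨K', hK'⟩ := h'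
  exact ⟨max K K', fun m k hk => by
    rw [Pi.add_apply, hK m k (by omega), hK' m k (by omega), add_zero]⟩

theorem BddFst.add {T T' : ℤ × ℤ → W} (h : BddFst T) (h' : BddFst T') : BddFst (T + T') := by
  obtain ⟨K, hK⟩ := h
  obtain ⟨K', hK'⟩ := h'
  exact ⟨max K K', fun m k hk => by
    rw [Pi.add_apply, hK m k (by omega), hK' m k (by omega), add_zero]⟩

theorem BddSnd.smul {T : ℤ × ℤ → W} (h : BddSnd T) (c : ℂ) : BddSnd (c • T) := by
  obtain ⟨K, hK⟩ := h
  exact ⟨K, fun m k hk => by rw [Pi.smul_apply, hK m k hk, smul_zero]⟩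

theorem BddFst.smul {T : ℤ × ℤ → W} (h : BddFst T) (c : ℂ) : BddFst (c • T) := by
  obtain ⟨K, hK⟩ := h
  exact ⟨K, fun m k hk => by rw [Pi.smul_apply, hK m k hk, smul_zero]⟩

theorem BddLocalPair.smul {N : ℕ} {r : ℂ} {T T' : ℤ × ℤ → W} (h : BddLocalPair N r T T')
    (c : ℂ) : BddLocalPair N r (c • T) (c • T') :=
  ⟨h.1.smul c, h.2.1.smul c, h.2.2.smul c⟩

theorem BddLocalPair.sum {N : ℕ} {r : ℂ} {ι : Type*} (s : Finset ι) {T T' : ι → ℤ × ℤ → W}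
    (h : ∀ b ∈ s, BddLocalPair N r (T b) (T' b)) :
    BddLocalPair N r (∑ b ∈ s, T b) (∑ b ∈ s, T' b) := by
  classical
  induction s using Finset.induction_on with
  | empty => exact ⟨LocalPair.zero N r, ⟨0, fun _ _ _ => rfl⟩, ⟨0, fun _ _ _ => rfl⟩⟩
  | insert a s ha ih =>
    rw [Finset.sum_insert ha, Finset.sum_insert ha]
    have h1 := h a (Finset.mem_insert_self _ _)
    have h2 := ih fun b hb => h b (Finset.mem_insert_of_mem hb)
    exact ⟨h1.1.add h2.1 h1.2.1 h1.2.2 h2.2.1 h2.2.2, h1.2.1.add h2.2.1, h1.2.2.add h2.2.2⟩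

theorem BddLocalPair.mono {N N' : ℕ} {r : ℂ} {T T' : ℤ × ℤ → W} (h : BddLocalPair N r T T')
    (hN : N ≤ N') : BddLocalPair N' r T T' := by
  obtain ⟨n, rfl⟩ := Nat.exists_eq_add_of_le hN
  exact ⟨h.1.mono h.2.1 h.2.2 n, h.2⟩

theorem bddLocalPair_of_expansion {F : ℤ × ℤ → W} (hF : BoundedAbove F) (N : ℕ) (r : ℂ) :
    BddLocalPair N r
      (fun p => act (oneSubPow (-(N : ℂ) - r)) ((-1, 1) : ℤ × ℤ) F (p + (-(N : ℤ), 0)))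
      ((-1 : ℂ) ^ N • fun p =>
        act (oneSubPow (-(N : ℂ) - r)) ((1, -1) : ℤ × ℤ) F (p + (0, -(N : ℤ)))) := by
  refine ⟨localPair_of_expansion hF N r, ?_, ?_⟩
  · obtain ⟨M, hM⟩ := hF
    refine ⟨M, fun m k hk => ?_⟩
    by_contra h0
    obtain ⟨i, hi⟩ := act_ne_zero h0
    have := (hM _ hi).2
    simp at this
    omega
  · obtain ⟨M, hM⟩ := hF
    refine BddFst.smul ⟨M, fun m k hk => ?_⟩ _
    by_contra h0
    obtain ⟨i, hi⟩ := act_ne_zero h0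
    have := (hM _ hi).1
    simp at this
    omega

end Rho

section Dong

variable {G W : Type*} [AddCommGroup G] [AddCommGroup W] [Module ℂ W]
  {A B C : ℤ → Module.End ℂ W}

theorem tripleABC_summable (A : ℤ → Module.End ℂ W) (hB : Truncated B) (hC : Truncated C)
    (w : W) : Summable₃ ((-1, 1, 0) : ℤ × ℤ × ℤ) (-1, 0, 1) (0, -1, 1)
      (fun p : ℤ × ℤ × ℤ => A p.1 (B p.2.1 (C p.2.2 w))) := by
  rintro ⟨m₁, m₂, m₃⟩
  obtain ⟨K, hK⟩ := hC w
  choose K' hK' using fun m => hB (C m w)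
  refine ((Set.finite_Iio (K - m₃).toNat).prod
    (Set.finite_Iio (K - m₃).toNat)).biUnion (t := fun q : ℕ × ℕ =>
      {e : ℕ × ℕ × ℕ | e.2 = q ∧ e.1 < (K' (m₃ + q.1 + q.2) - m₂ + q.2).toNat}) ?_ |>.subset ?_
  · rintro q -
    refine ((Set.finite_Iio (K' (m₃ + q.1 + q.2) - m₂ + q.2).toNat).image
      fun i => (i, q)).subset ?_
    rintro ⟨i, q'⟩ ⟨rfl, hi⟩
    exact ⟨i, hi, rfl⟩
  · rintro ⟨i, j, l⟩ he
    simp only [Set.mem_ofPred_eq, Prod.smul_mk, nsmul_eq_mul, smul_zero, Prod.mk_add_mk,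
      mul_one, add_zero, mul_neg] at he
    have h1 : m₃ + j + l < K := by
      by_contra h0
      exact he (by rw [hK _ (by omega)]; simp)
    have h2 : m₂ + i + -l < K' (m₃ + j + l) := by
      by_contra h0
      exact he (by rw [hK' _ _ (by omega)]; simp)
    simp only [Set.mem_iUnion, Set.mem_prod, Set.mem_Iio, Set.mem_ofPred_eq, exists_prop]
    exact ⟨(j, l), ⟨by simp only; omega, by simp only; omega⟩, rfl, by simp only; omega⟩

theorem tripleACB_summable (A : ℤ → Module.End ℂ W) (hB : Truncated B) (hC : Truncated C)
    (w : W) : Summable₃ ((-1, 1, 0) : ℤ × ℤ × ℤ) (-1, 0, 1) (0, 1, -1)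
      (fun p : ℤ × ℤ × ℤ => A p.1 (C p.2.2 (B p.2.1 w))) := by
  rintro ⟨m₁, m₂, m₃⟩
  obtain ⟨K, hK⟩ := hB w
  choose K' hK' using fun m => hC (B m w)
  refine ((Set.finite_Iio (K - m₂).toNat).prod
    (Set.finite_Iio (K - m₂).toNat)).biUnion (t := fun q : ℕ × ℕ =>
      {e : ℕ × ℕ × ℕ | (e.1, e.2.2) = q ∧ e.2.1 < (K' (m₂ + q.1 + q.2) - m₃ + q.2).toNat}) ?_
        |>.subset ?_
  · rintro q -
    refine ((Set.finite_Iio (K' (m₂ + q.1 + q.2) - m₃ + q.2).toNat).image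
      fun i => (q.1, i, q.2)).subset ?_
    rintro ⟨i, j, l⟩ ⟨rfl, hi⟩
    exact ⟨j, hi, rfl⟩
  · rintro ⟨i, j, l⟩ he
    simp only [Set.mem_ofPred_eq, Prod.smul_mk, nsmul_eq_mul, smul_zero, Prod.mk_add_mk,
      mul_one, add_zero, mul_neg] at he
    have h1 : m₂ + i + l < K := by
      by_contra h0
      exact he (by rw [hK _ (by omega)]; simp)
    have h2 : m₃ + j + -l < K' (m₂ + i + l) := by
      by_contra h0
      exact he (by rw [hK' _ _ (by omega)]; simp)
    simp only [Set.mem_iUnion, Set.mem_prod, Set.mem_Iio, Set.mem_ofPred_eq, exists_prop]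
    exact ⟨(i, l), ⟨by simp only; omega, by simp only; omega⟩, rfl, by simp only; omega⟩

theorem tripleCAB_summable (hA : Truncated A) (hB : Truncated B) (C : ℤ → Module.End ℂ W)
    (w : W) : Summable₃ ((-1, 1, 0) : ℤ × ℤ × ℤ) (1, 0, -1) (0, 1, -1)
      (fun p : ℤ × ℤ × ℤ => C p.2.2 (A p.1 (B p.2.1 w))) := by
  rintro ⟨m₁, m₂, m₃⟩
  obtain ⟨K, hK⟩ := hB w
  choose K' hK' using fun m => hA (B m w)
  refine ((Set.finite_Iio (K - m₂).toNat).prod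
    (Set.finite_Iio (K - m₂).toNat)).biUnion (t := fun q : ℕ × ℕ =>
      {e : ℕ × ℕ × ℕ | (e.1, e.2.2) = q ∧ e.2.1 < (K' (m₂ + q.1 + q.2) - m₁ + q.1).toNat}) ?_
        |>.subset ?_
  · rintro q -
    refine ((Set.finite_Iio (K' (m₂ + q.1 + q.2) - m₁ + q.1).toNat).image
      fun i => (q.1, i, q.2)).subset ?_
    rintro ⟨i, j, l⟩ ⟨rfl, hi⟩
    exact ⟨j, hi, rfl⟩
  · rintro ⟨i, j, l⟩ he
    simp only [Set.mem_ofPred_eq, Prod.smul_mk, nsmul_eq_mul, smul_zero, Prod.mk_add_mk,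
      mul_one, add_zero, mul_neg] at he
    have h1 : m₂ + i + l < K := by
      by_contra h0
      exact he (by rw [hK _ (by omega)]; simp)
    have h2 : m₁ + -i + j < K' (m₂ + i + l) := by
      by_contra h0
      exact he (by rw [hK' _ _ (by omega)]; simp)
    simp only [Set.mem_iUnion, Set.mem_prod, Set.mem_Iio, Set.mem_ofPred_eq, exists_prop]
    exact ⟨(i, l), ⟨by simp only; omega, by simp only; omega⟩, rfl, by simp only; omega⟩

variable {N : ℕ} {r₁₂ r₁₃ r₂₃ : ℂ}

/-- `(z₁-z₂)^{N+r₁₂} (z₁-z₃)^{N+r₁₃} (z₂-z₃)^{N+r₂₃}` times `A(z₁)B(z₂)C(z₃)w` and times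
`C(z₃)A(z₁)B(z₂)w`, suitably expanded, agree. -/
theorem triple_eq (hA : Truncated A) (hB : Truncated B) (hC : Truncated C)
    (hAC : LocalWith N r₁₃ A C) (hBC : LocalWith N r₂₃ B C) (w : W) (p : PowerSeries ℂ)
    (γ : ℤ × ℤ × ℤ) :
    act (oneSubPow (N + r₁₃)) ((-1, 0, 1) : ℤ × ℤ × ℤ)
      (act (oneSubPow (N + r₂₃)) ((0, -1, 1) : ℤ × ℤ × ℤ) (act p ((-1, 1, 0) : ℤ × ℤ × ℤ)
        fun p : ℤ × ℤ × ℤ => A p.1 (B p.2.1 (C p.2.2 w)))) (γ + ((N : ℤ), (N : ℤ), (0 : ℤ))) =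
    act (oneSubPow (N + r₁₃)) ((1, 0, -1) : ℤ × ℤ × ℤ)
      (act (oneSubPow (N + r₂₃)) ((0, 1, -1) : ℤ × ℤ × ℤ) (act p ((-1, 1, 0) : ℤ × ℤ × ℤ)
        fun p : ℤ × ℤ × ℤ => C p.2.2 (A p.1 (B p.2.1 w))))
          (γ + ((0 : ℤ), (0 : ℤ), 2 * (N : ℤ))) := by
  set T₁ : ℤ × ℤ × ℤ → W := fun p => A p.1 (B p.2.1 (C p.2.2 w)) with hT₁
  set T₂ : ℤ × ℤ × ℤ → W := fun p => A p.1 (C p.2.2 (B p.2.1 w)) with hT₂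
  set T₃ : ℤ × ℤ × ℤ → W := fun p => C p.2.2 (A p.1 (B p.2.1 w)) with hT₃
  set b₁₃ := oneSubPow (N + r₁₃)
  set b₂₃ := oneSubPow (N + r₂₃)
  have s₁ : Summable₃ ((-1, 1, 0) : ℤ × ℤ × ℤ) (-1, 0, 1) (0, -1, 1) T₁ :=
    tripleABC_summable A hB hC w
  have s₂ : Summable₃ ((-1, 1, 0) : ℤ × ℤ × ℤ) (-1, 0, 1) (0, 1, -1) T₂ :=
    tripleACB_summable A hB hC w
  have s₃ : Summable₃ ((-1, 1, 0) : ℤ × ℤ × ℤ) (1, 0, -1) (0, 1, -1) T₃ :=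
    tripleCAB_summable hA hB C w
  have swapBC : act b₂₃ ((0, -1, 1) : ℤ × ℤ × ℤ) T₁ =
      (-1 : ℂ) ^ N • fun x => act b₂₃ ((0, 1, -1) : ℤ × ℤ × ℤ) T₂
        (x + ((0 : ℤ), -(N : ℤ), (N : ℤ))) := by
    funext ⟨m₁, m₂, m₃⟩
    have h1 : act b₂₃ ((0, -1, 1) : ℤ × ℤ × ℤ) T₁ (m₁, m₂, m₃) =
        A m₁ (act b₂₃ ((-1, 1) : ℤ × ℤ) (opTable B C w) (m₂, m₃)) := by
      rw [act_map (A m₁) _ _ (summable_left (hC.bddSnd B w) _)]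
      exact act_congr _ fun i => by simp [hT₁, opTable]
    have h2 : act b₂₃ ((0, 1, -1) : ℤ × ℤ × ℤ) T₂ (m₁, m₂ - N, m₃ + N) =
        A m₁ (act b₂₃ ((1, -1) : ℤ × ℤ) (fun p => opTable C B w p.swap) (m₂ - N, m₃ + N)) := by
      rw [act_map (A m₁) _ _ (summable_right
        (T := fun p => opTable C B w p.swap) (hB.bddFst C w) _)]
      exact act_congr _ fun i => by simp [hT₂, opTable]
    have h3 := hBC w (m₂ - N) m₃
    rw [sub_add_cancel] at h3
    rw [h1, h3, map_smul, ← h2]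
    simp [sub_eq_add_neg]
  have swapAC : act b₁₃ ((-1, 0, 1) : ℤ × ℤ × ℤ) T₂ =
      (-1 : ℂ) ^ N • fun x => act b₁₃ ((1, 0, -1) : ℤ × ℤ × ℤ) T₃
        (x + (-(N : ℤ), (0 : ℤ), (N : ℤ))) := by
    funext ⟨m₁, m₂, m₃⟩
    have h3 := hAC (B m₂ w) (m₁ - N) m₃
    rw [sub_add_cancel] at h3
    have h1 : act b₁₃ ((-1, 0, 1) : ℤ × ℤ × ℤ) T₂ (m₁, m₂, m₃) =
        act b₁₃ ((-1, 1) : ℤ × ℤ) (opTable A C (B m₂ w)) (m₁, m₃) :=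
      act_congr _ fun i => by simp [hT₂, opTable]
    have h2 : act b₁₃ ((1, 0, -1) : ℤ × ℤ × ℤ) T₃ (m₁ - N, m₂, m₃ + N) =
        act b₁₃ ((1, -1) : ℤ × ℤ) (fun p => opTable C A (B m₂ w) p.swap) (m₁ - N, m₃ + N) :=
      act_congr _ fun i => by simp [hT₃, opTable]
    rw [h1, h3, ← h2]
    simp [sub_eq_add_neg]
  rw [act_comm (T := T₁) s₁.rotate.rotate.left,
    act_comm (T := act b₂₃ ((0, -1, 1) : ℤ × ℤ × ℤ) T₁) (s₁.act b₂₃).symm, swapBC, act_smul,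
    act_smul]
  have t1 : act b₁₃ ((-1, 0, 1) : ℤ × ℤ × ℤ)
      (fun x => act b₂₃ ((0, 1, -1) : ℤ × ℤ × ℤ) T₂ (x + ((0 : ℤ), -(N : ℤ), (N : ℤ)))) =
      fun x => act b₁₃ ((-1, 0, 1) : ℤ × ℤ × ℤ) (act b₂₃ ((0, 1, -1) : ℤ × ℤ × ℤ) T₂)
        (x + ((0 : ℤ), -(N : ℤ), (N : ℤ))) := funext fun x => act_translate _ _ _ _ x
  have t2 : act b₂₃ ((0, 1, -1) : ℤ × ℤ × ℤ) (fun x => act b₁₃ ((1, 0, -1) : ℤ × ℤ × ℤ) T₃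
        (x + (-(N : ℤ), (0 : ℤ), (N : ℤ)))) =
      fun x => act b₂₃ ((0, 1, -1) : ℤ × ℤ × ℤ) (act b₁₃ ((1, 0, -1) : ℤ × ℤ × ℤ) T₃)
        (x + (-(N : ℤ), (0 : ℤ), (N : ℤ))) := funext fun x => act_translate _ _ _ _ x
  rw [t1, Pi.smul_apply, act_translate, act_comm (T := T₂) s₂.rotate.left, swapAC, act_smul,
    act_smul, Pi.smul_apply, t2, act_translate, smul_smul, ← mul_pow,
    act_comm (T := T₃) s₃.rotate.left.symm, act_comm (T := act b₂₃ _ T₃) (s₃.act b₂₃),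
    act_comm (T := T₃) s₃.rotate.rotate.left.symm]
  simp only [mul_neg, mul_one, neg_neg, one_pow, one_smul]
  congr 1
  rw [add_assoc, add_assoc]
  congr 1
  simp
  ring

end Dong

section DongLemma

theorem act_inverse {W : Type*} [AddCommGroup W] [Module ℂ W] {I : Type*} [AddCommGroup I]
    {a b : I} {F : I → W} (h : Summable₂ a b F) (x y : ℂ) :
    act (oneSubPow (-x)) a (act (oneSubPow (-y)) b
      (act (oneSubPow x) a (act (oneSubPow y) b F))) = F := by
  rw [act_comm h, act_mul (h.symm.act _), ← oneSubPow_add, neg_add_cancel, oneSubPow_zero,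
    act_one, act_mul h.left, ← oneSubPow_add, neg_add_cancel, oneSubPow_zero, act_one]

variable {G W : Type*} [AddCommGroup G] [AddCommGroup W] [Module ℂ W]
  {A B C : ℤ → Module.End ℂ W} {N : ℕ} {r₁₂ r₁₃ r₂₃ : ℂ}

/-- There is a family `H`, the coefficients of
`(z₁-z₂)^{N+r₁₂} (z₁-z₃)^{N+r₁₃} (z₂-z₃)^{N+r₂₃} A(z₁)B(z₂)C(z₃)w`, bounded above in every index,
from which both orders of `(z₁-z₂)^{N+r₁₂} A(z₁)B(z₂)` and `C(z₃)` are recovered by expanding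
the inverses of the remaining factors. -/
theorem exists_triple (hA : Truncated A) (hB : Truncated B) (hC : Truncated C)
    (hAB : LocalWith N r₁₂ A B) (hAC : LocalWith N r₁₃ A C) (hBC : LocalWith N r₂₃ B C) (w : W) :
    ∃ H : ℤ × ℤ × ℤ → W, (∃ M : ℤ, ∀ p, H p ≠ 0 → p.1 < M ∧ p.2.1 < M ∧ p.2.2 < M) ∧
      (∀ γ : ℤ × ℤ × ℤ, normProd N r₁₂ A hB (γ.1, γ.2.1) (C γ.2.2 w) =
        act (oneSubPow (-(N + r₁₃))) ((-1, 0, 1) : ℤ × ℤ × ℤ)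
          (act (oneSubPow (-(N + r₂₃))) ((0, -1, 1) : ℤ × ℤ × ℤ) H)
            (γ + (-(N : ℤ), -(N : ℤ), (0 : ℤ)))) ∧
      (∀ γ : ℤ × ℤ × ℤ, C γ.2.2 (normProd N r₁₂ A hB (γ.1, γ.2.1) w) =
        act (oneSubPow (-(N + r₁₃))) ((1, 0, -1) : ℤ × ℤ × ℤ)
          (act (oneSubPow (-(N + r₂₃))) ((0, 1, -1) : ℤ × ℤ × ℤ) H)
            (γ + ((0 : ℤ), (0 : ℤ), -(2 * (N : ℤ))))) := by
  set F₁ : ℤ × ℤ × ℤ → W := fun γ => normProd N r₁₂ A hB (γ.1, γ.2.1) (C γ.2.2 w) with hF₁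
  set F₂ : ℤ × ℤ × ℤ → W := fun γ => C γ.2.2 (normProd N r₁₂ A hB (γ.1, γ.2.1) w) with hF₂
  set T₁ : ℤ × ℤ × ℤ → W := fun p => A p.1 (B p.2.1 (C p.2.2 w)) with hT₁
  set T₃ : ℤ × ℤ × ℤ → W := fun p => C p.2.2 (A p.1 (B p.2.1 w)) with hT₃
  have s₁ : Summable₃ ((-1, 1, 0) : ℤ × ℤ × ℤ) (-1, 0, 1) (0, -1, 1) T₁ :=
    tripleABC_summable A hB hC w
  have s₃ : Summable₃ ((-1, 1, 0) : ℤ × ℤ × ℤ) (1, 0, -1) (0, 1, -1) T₃ :=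
    tripleCAB_summable hA hB C w
  have e₁ : F₁ = fun x => act (oneSubPow (N + r₁₂)) ((-1, 1, 0) : ℤ × ℤ × ℤ) T₁
      (x + ((N : ℤ), (0 : ℤ), (0 : ℤ))) := by
    funext ⟨m₁, m₂, m₃⟩
    simp only [hF₁, normProd_apply]
    exact act_congr _ fun i => by simp [hT₁, opTable]
  have e₂ : F₂ = fun x => act (oneSubPow (N + r₁₂)) ((-1, 1, 0) : ℤ × ℤ × ℤ) T₃
      (x + ((N : ℤ), (0 : ℤ), (0 : ℤ))) := by
    funext ⟨m₁, m₂, m₃⟩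
    simp only [hF₂, normProd_apply]
    rw [act_map (C m₃) _ _ (summable_left (hB.bddSnd A w) _)]
    exact act_congr _ fun i => by simp [hT₃, opTable]
  have translate : ∀ {a b : ℤ × ℤ × ℤ} {T : ℤ × ℤ × ℤ → W} (τ : ℤ × ℤ × ℤ),
      Summable₂ a b T → Summable₂ a b fun x => T (x + τ) := by
    intro a b T τ h γ
    refine (h (γ + τ)).subset fun e he => ?_
    simp only [Set.mem_ofPred_eq] at he ⊢
    convert he using 2
    abel
  have c₁ : Summable₂ ((-1, 0, 1) : ℤ × ℤ × ℤ) (0, -1, 1) F₁ := by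
    rw [e₁]
    exact translate _ (s₁.rotate.act _)
  have c₂ : Summable₂ ((1, 0, -1) : ℤ × ℤ × ℤ) (0, 1, -1) F₂ := by
    rw [e₂]
    exact translate _ (s₃.rotate.act _)
  set H : ℤ × ℤ × ℤ → W := fun γ => act (oneSubPow (N + r₁₃)) ((-1, 0, 1) : ℤ × ℤ × ℤ)
      (act (oneSubPow (N + r₂₃)) ((0, -1, 1) : ℤ × ℤ × ℤ) F₁) (γ + ((N : ℤ), (N : ℤ), (0 : ℤ)))
    with hH
  have translate₂ : ∀ {p q u : PowerSeries ℂ} {a b c : ℤ × ℤ × ℤ} {T : ℤ × ℤ × ℤ → W}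
      (τ γ : ℤ × ℤ × ℤ), act p a (act q b fun x => act u c T (x + τ)) γ =
        act p a (act q b (act u c T)) (γ + τ) := by
    intro p q u a b c T τ γ
    rw [show (act q b fun x => act u c T (x + τ)) = fun x => act q b (act u c T) (x + τ) from
      funext fun x => act_translate _ _ _ _ x, act_translate]
  have hH₂ : H = fun γ => act (oneSubPow (N + r₁₃)) ((1, 0, -1) : ℤ × ℤ × ℤ)
      (act (oneSubPow (N + r₂₃)) ((0, 1, -1) : ℤ × ℤ × ℤ) F₂)
        (γ + ((0 : ℤ), (0 : ℤ), 2 * (N : ℤ))) := by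
    funext γ
    rw [hH, e₁, e₂]
    simp only
    rw [translate₂, translate₂]
    have := triple_eq hA hB hC hAC hBC w (oneSubPow (N + r₁₂)) (γ + ((N : ℤ), (0 : ℤ), (0 : ℤ)))
    rw [add_right_comm γ, this, add_right_comm γ]
  refine ⟨H, ?_, ?_, ?_⟩
  -- The bound on the third index comes from the order with `C` on the right, the bounds on the first
  -- two from the order with `C` on the left.
  · obtain ⟨K, hK⟩ := hC w
    obtain ⟨M, hM⟩ := hAB.normProd_bounded hA hB w
    refine ⟨max K M, fun p hp => ?_⟩
    have h3 : p.2.2 < K := by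
      by_contra h0
      obtain ⟨i, hi⟩ := act_ne_zero hp
      obtain ⟨j, hj⟩ := act_ne_zero hi
      refine hj ?_
      simp only [hF₁]
      rw [hK _ (by simp; omega), map_zero]
    rw [hH₂] at hp
    obtain ⟨i, hi⟩ := act_ne_zero hp
    obtain ⟨j, hj⟩ := act_ne_zero hi
    have h4 : normProd N r₁₂ A hB
        ((p + ((0 : ℤ), (0 : ℤ), 2 * (N : ℤ)) + i • ((1, 0, -1) : ℤ × ℤ × ℤ) +
          j • ((0, 1, -1) : ℤ × ℤ × ℤ)).1, (p + ((0 : ℤ), (0 : ℤ), 2 * (N : ℤ)) +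
            i • ((1, 0, -1) : ℤ × ℤ × ℤ) + j • ((0, 1, -1) : ℤ × ℤ × ℤ)).2.1) w ≠ 0 := by
      intro h0
      exact hj (by simp only [hF₂]; rw [h0, map_zero])
    have h5 := hM _ h4
    simp at h5
    refine ⟨by omega, by omega, by omega⟩
  · intro γ
    change F₁ γ = _
    have : act (oneSubPow (-(N + r₂₃))) ((0, -1, 1) : ℤ × ℤ × ℤ) H = fun x =>
        act (oneSubPow (-(N + r₂₃))) ((0, -1, 1) : ℤ × ℤ × ℤ)
          (act (oneSubPow (N + r₁₃)) ((-1, 0, 1) : ℤ × ℤ × ℤ)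
          (act (oneSubPow (N + r₂₃)) ((0, -1, 1) : ℤ × ℤ × ℤ) F₁))
            (x + ((N : ℤ), (N : ℤ), (0 : ℤ))) := funext fun x => act_translate _ _ _ _ x
    rw [this, act_translate, act_inverse c₁, add_assoc]
    simp only [Prod.mk_add_mk, neg_add_cancel, add_zero]
    exact congrArg F₁ (add_zero γ).symm
  · intro γ
    change F₂ γ = _
    have : act (oneSubPow (-(N + r₂₃))) ((0, 1, -1) : ℤ × ℤ × ℤ) H = fun x =>
        act (oneSubPow (-(N + r₂₃))) ((0, 1, -1) : ℤ × ℤ × ℤ)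
          (act (oneSubPow (N + r₁₃)) ((1, 0, -1) : ℤ × ℤ × ℤ)
          (act (oneSubPow (N + r₂₃)) ((0, 1, -1) : ℤ × ℤ × ℤ) F₂))
            (x + ((0 : ℤ), (0 : ℤ), 2 * (N : ℤ))) := by
      rw [hH₂]
      exact funext fun x => act_translate _ _ _ _ x
    rw [this, act_translate, act_inverse c₂, add_assoc]
    simp only [Prod.mk_add_mk, neg_add_cancel, add_zero]
    exact congrArg F₂ (add_zero γ).symm

/-- The coefficients of `(A_n B)(z₂)C(z₃)w` and `C(z₃)(A_n B)(z₂)w` are the two expansions of a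
sum of terms `(z₂ - z₃)^{-2N-b-r} F_b(z₂, z₃)` with `b ≤ N - 1 - n`, which are obtained from the
family `H` of `exists_triple` by the substitution `z₁ = z₂ + z₀`. -/
theorem nProd_bddLocalPair {S : ChargedSpace G W} {a b c g : G} (hA : IsField S a A)
    (hB : IsField S b B) (hC : IsField S c C) (hAB : LocalWith N (S.pairing a b) A B)
    (hAC : LocalWith N (S.pairing a c) A C) (hBC : LocalWith N (S.pairing b c) B C) {j : ℕ}
    {n : ℤ} (hj : n = N - 1 - j) {w : W} (hw : w ∈ S.gr g) :
    BddLocalPair (2 * N + j) (S.pairing (a + b) c)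
      (opTable (nProd S a hAB hA.trunc hB.trunc n) C w)
      (fun p => opTable C (nProd S a hAB hA.trunc hB.trunc n) w p.swap) := by
  obtain ⟨H, ⟨M, hM⟩, h1, h2⟩ := exists_triple hA.trunc hB.trunc hC.trunc hAB hAC hBC w
  set s := S.pairing a g with hs
  set x : ℂ := -(N + S.pairing a c) with hx
  set y : ℂ := -(N + S.pairing b c) with hy
  have hn : n < N := by omega
  have hjn : (N - 1 - n).toNat = j := by omega
  set h : ℕ → ℤ × ℤ → W := fun c => restrictDiag s c H with hh
  have hbd : ∀ (c : ℕ) (τ : ℤ), BoundedAbove fun p => h c (p + (τ, 0)) := by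
    intro c τ
    refine ⟨max (2 * M - τ) M, fun p hp => ?_⟩
    obtain ⟨m, hm⟩ := restrictDiag_ne_zero hp
    have := hM _ hm
    simp at this
    omega
  -- `(A_n B)(z₂)C(z₃)w`: here `C k w` has degree `c + g`, which shifts the exponents of `z₁`.
  have E1 : opTable (nProd S a hAB hA.trunc hB.trunc n) C w =
      ∑ l ∈ Finset.range (j + 1), Ring.choose x l •
        fun p : ℤ × ℤ => act (oneSubPow (-((2 * N + l : ℕ) : ℂ) - S.pairing (a + b) c))
          ((-1, 1) : ℤ × ℤ) (fun q => h (j - l) (q + ((l : ℤ) - j - 1, 0)))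
            (p + (-((2 * N + l : ℕ) : ℤ), 0)) := by
    funext ⟨q, k⟩
    simp only [opTable]
    rw [nProd_apply _ _ _ _ _ hn _ (hC.maps _ _ hw _), hjn]
    have e1 : ∑ᶠ m : ℤ, Ring.choose (-(m : ℂ) - S.pairing a (c + g) - 1) j •
          normProd N (S.pairing a b) A hB.trunc (m, q + n - N - m) (C k w) =
        restrictDiag (s - x) j (act (oneSubPow x) ((-1, 0, 1) : ℤ × ℤ × ℤ)
          (act (oneSubPow y) ((0, -1, 1) : ℤ × ℤ × ℤ) H)) (q + n - 3 * N, k) := by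
      rw [restrictDiag, ← finsum_comp_equiv (Equiv.addRight (N : ℤ))]
      refine finsum_congr fun m => ?_
      simp only [Equiv.coe_addRight]
      rw [h1 (m + N, q + n - N - (m + N), k)]
      congr 1
      · congr 1
        rw [map_add, ← hs, hx]
        simp
        ring
      · congr 1
        ext <;> simp <;> ring
    rw [e1, restrictDiag_act_fst, Finset.sum_apply]
    · refine Finset.sum_congr rfl fun l hl => ?_
      rw [Pi.smul_apply]
      congr 1
      have e2 : restrictDiag s (j - l) (act (oneSubPow y) ((0, -1, 1) : ℤ × ℤ × ℤ) H) =
          act (oneSubPow y) ((-1, 1) : ℤ × ℤ) (h (j - l)) := by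
        funext ⟨Q, k'⟩
        refine restrictDiag_act_of_fst_eq_zero _ _ _ Q k' 1 ?_
        refine (((Set.finite_Iio (M - k').toNat)).prod (Set.finite_Icc (Q - 2 * M - |k'|) M)).subset
          fun p hp => ?_
        have := hM _ hp
        simp only [one_mul] at this
        simp only [Set.mem_prod, Set.mem_Iio, Set.mem_Icc]
        have := neg_abs_le k'
        omega
      have sm : BddSnd (h (j - l)) := by
        obtain ⟨M', hM'⟩ := hbd (j - l) 0
        refine ⟨M', fun m k hk => ?_⟩
        by_contra h0
        have := (hM' (m, k) (by simpa using h0)).2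
        simp only at this
        omega
      rw [e2, act_mul (summable_left sm), ← oneSubPow_add, act_translate]
      congr 1
      · congr 1
        rw [hx, hy, map_add, AddMonoidHom.add_apply]
        push_cast
        ring
      · ext
        · simp [hj]
          ring
        · simp
    · refine ((Set.finite_Iio (M - k).toNat).prod
          (Set.finite_Icc (q + n - 3 * N - 2 * M + k) M)).subset fun p hp => ?_
      obtain ⟨i, hi⟩ := act_ne_zero hp
      have := hM _ hi
      simp at this
      simp only [Set.mem_prod, Set.mem_Iio, Set.mem_Icc]
      omega
  -- `C(z₃)(A_n B)(z₂)w`, expanded in the opposite domain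
  have E2 : (fun p : ℤ × ℤ => opTable C (nProd S a hAB hA.trunc hB.trunc n) w p.swap) =
      ∑ l ∈ Finset.range (j + 1), Ring.choose x l • ((-1 : ℂ) ^ (2 * N + l) •
        fun p : ℤ × ℤ => act (oneSubPow (-((2 * N + l : ℕ) : ℂ) - S.pairing (a + b) c))
          ((1, -1) : ℤ × ℤ) (fun q => h (j - l) (q + ((l : ℤ) - j - 1, 0)))
            (p + (0, -((2 * N + l : ℕ) : ℤ)))) := by
    funext ⟨q, k⟩
    simp only [opTable, Prod.swap_prod_mk]
    rw [nProd_apply _ _ _ _ _ hn _ hw, hjn]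
    have e1 : C k (∑ᶠ m : ℤ, Ring.choose (-(m : ℂ) - s - 1) j •
          normProd N (S.pairing a b) A hB.trunc (m, q + n - N - m) w) =
        restrictDiag s j (act (oneSubPow x) ((1, 0, -1) : ℤ × ℤ × ℤ)
          (act (oneSubPow y) ((0, 1, -1) : ℤ × ℤ × ℤ) H)) (q + n - N, k - 2 * N) := by
      change (C k).toAddMonoidHom _ = _
      rw [AddMonoidHom.map_finsum]
      · rw [restrictDiag]
        refine finsum_congr fun m => ?_
        change C k _ = _
        rw [(C k).map_smul, h2 (m, q + n - N - m, k)]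
        congr 2
        ext <;> simp <;> ring
      · refine ((hAB.normProd_bounded hA.trunc hB.trunc w).antidiagonal_finite
          (q + n - N)).subset fun m hm h0 => hm ?_
        simp only [h0, smul_zero]
    rw [e1, restrictDiag_act_snd, Finset.sum_apply]
    · refine Finset.sum_congr rfl fun l hl => ?_
      rw [Pi.smul_apply, Pi.smul_apply, smul_smul, mul_comm ((-1 : ℂ) ^ l), pow_add, pow_mul]
      simp only [even_two, Even.neg_pow, one_pow, one_mul]
      congr 1
      have e2 : restrictDiag s (j - l) (act (oneSubPow y) ((0, 1, -1) : ℤ × ℤ × ℤ) H) =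
          act (oneSubPow y) ((1, -1) : ℤ × ℤ) (h (j - l)) := by
        funext ⟨Q, k'⟩
        have hfin : {p : ℕ × ℤ |
            H (p.2, Q - -1 * (p.1 : ℤ) - p.2, k' + -1 * (p.1 : ℤ)) ≠ 0}.Finite := by
          refine (((Set.finite_Iio (2 * M - Q).toNat)).prod
            (Set.finite_Icc (Q - M) M)).subset fun p hp => ?_
          have := hM _ hp
          simp only [neg_mul, one_mul, sub_neg_eq_add] at this
          simp only [Set.mem_prod, Set.mem_Iio, Set.mem_Icc]
          omega
        have e3 := restrictDiag_act_of_fst_eq_zero (oneSubPow y) s (j - l) Q k' (-1) hfin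
        rwa [neg_neg] at e3
      have sm : BddFst (h (j - l)) := by
        obtain ⟨M', hM'⟩ := hbd (j - l) 0
        refine ⟨M', fun m k hk => ?_⟩
        by_contra h0
        have := (hM' (m, k) (by simpa using h0)).1
        simp only at this
        omega
      rw [e2, act_mul (summable_right sm), ← oneSubPow_add, act_translate]
      congr 1
      · congr 1
        rw [hx, hy, map_add, AddMonoidHom.add_apply]
        push_cast
        ring
      · ext
        · simp [hj]
          ring
        · simp
          ring
    · refine ((Set.finite_Iio (2 * M - (q + n - N)).toNat).prod
          (Set.finite_Icc (q + n - N - M) M)).subset fun p hp => ?_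
      obtain ⟨i, hi⟩ := act_ne_zero hp
      have := hM _ hi
      simp at this
      simp only [Set.mem_prod, Set.mem_Iio, Set.mem_Icc]
      omega
  rw [E1, E2]
  refine BddLocalPair.sum _ fun l hl => ?_
  rw [Finset.mem_range] at hl
  exact ((bddLocalPair_of_expansion (hbd (j - l) ((l : ℤ) - j - 1)) (2 * N + l)
    (S.pairing (a + b) c)).smul _).mono (by omega)

theorem Local.exists_common {r₁ r₂ r₃ : ℂ} (hA : Truncated A) (hB : Truncated B)
    (hC : Truncated C) (h₁ : Local r₁ A B) (h₂ : Local r₂ A C) (h₃ : Local r₃ B C) :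
    ∃ N : ℕ, LocalWith N r₁ A B ∧ LocalWith N r₂ A C ∧ LocalWith N r₃ B C := by
  obtain ⟨N₁, h₁⟩ := h₁
  obtain ⟨N₂, h₂⟩ := h₂
  obtain ⟨N₃, h₃⟩ := h₃
  refine ⟨N₁ + N₂ + N₃, ?_, ?_, ?_⟩
  · rw [add_assoc]; exact h₁.mono hA hB _
  · rw [add_comm N₁, add_assoc]; exact h₂.mono hA hC _
  · rw [add_comm]; exact h₃.mono hB hC _

theorem localWith_of_homogeneous {S : ChargedSpace G W} (hA : Truncated A) (hB : Truncated B)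
    {N : ℕ} {r : ℂ} (h : ∀ g, ∀ w ∈ S.gr g, LocalPair N r (opTable A B w)
      fun p => opTable B A w p.swap) : LocalWith N r A B := by
  intro w
  have hw : w ∈ ⨆ g, S.gr g := S.span ▸ Submodule.mem_top
  induction hw using Submodule.iSup_induction' with
  | mem g x hx => exact h g x hx
  | zero =>
    convert LocalPair.zero N r using 1 <;> funext p <;> simp [opTable]
  | add x y _ _ hx hy =>
    convert hx.add hy (hB.bddSnd A x) (hA.bddFst B x) (hB.bddSnd A y) (hA.bddFst B y) using 1 <;>
    funext p <;> simp [opTable]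

/-- Dong's lemma: the products `A_n B` are local with every field that is local with `A` and
`B`. -/
theorem Local.nProd {S : ChargedSpace G W} {a b c : G} (hA : IsField S a A)
    (hB : IsField S b B) (hC : IsField S c C) (hAB : LocalWith N (S.pairing a b) A B)
    (hAC : LocalWith N (S.pairing a c) A C) (hBC : LocalWith N (S.pairing b c) B C) (n : ℤ) :
    Local (S.pairing (a + b) c) (nProd S a hAB hA.trunc hB.trunc n) C := by
  by_cases hn : (N : ℤ) ≤ n
  · refine ⟨0, fun w => ?_⟩
    convert LocalPair.zero 0 (S.pairing (a + b) c) using 1 <;> funext p <;>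
      simp [opTable, nProd_of_le _ _ _ _ _ hn]
  · obtain ⟨j, hj⟩ := Int.eq_ofNat_of_zero_le (show 0 ≤ N - 1 - n by omega)
    refine ⟨2 * N + j, localWith_of_homogeneous (S := S) (hA.nProd hB hAB n).trunc hC.trunc
      fun g w hw => ?_⟩
    exact (nProd_bddLocalPair hA hB hC hAB hAC hBC (by omega) hw).1

end DongLemma

/-! ### Reconstruction of a generalized vertex algebra from generating fields -/

section Reconstruction

variable {G W ι : Type*} [AddCommGroup G] [AddCommGroup W] [Module ℂ W]

/-- The vectors, with their degrees, obtained from `o` by applying modes of the fields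
`ψ x` of charges `c x`. -/
inductive Reach (o : W) (c : ι → G) (ψ : ι → ℤ → Module.End ℂ W) : G → W → Prop
  | vac : Reach o c ψ 0 o
  | step (x : ι) (n : ℤ) {h : G} {w : W} : Reach o c ψ h w → Reach o c ψ (c x + h) (ψ x n w)

/-- A family of mutually local, translation covariant and creative fields that generates the space
from the vacuum. -/
structure Generating (S : ChargedSpace G W) (c : ι → G) (ψ : ι → ℤ → Module.End ℂ W) : Prop where
  field : ∀ x, IsField S (c x) (ψ x)
  cov : ∀ x, Covariant S (c x) (ψ x)
  vac : ∀ x, ∀ n : ℤ, 0 ≤ n → ψ x n S.vac = 0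
  isLocal : ∀ x y, Local (S.pairing (c x) (c y)) (ψ x) (ψ y)
  span : Submodule.span ℂ {w | ∃ h, Reach S.vac c ψ h w} = ⊤

variable {S : ChargedSpace G W} {c : ι → G} {ψ : ι → ℤ → Module.End ℂ W}

theorem Reach.mem (hψ : ∀ x, IsField S (c x) (ψ x)) {h : G} {w : W} (hw : Reach S.vac c ψ h w) :
    w ∈ S.gr h := by
  induction hw with
  | vac => exact S.vac_mem
  | step x n _ ih => exact (hψ x).maps _ _ ih _

theorem Local.add {r : ℂ} {A A' B : ℤ → Module.End ℂ W} (h : Local r A B) (h' : Local r A' B)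
    (hA : Truncated A) (hA' : Truncated A') (hB : Truncated B) : Local r (A + A') B := by
  obtain ⟨N, hN⟩ := h
  obtain ⟨N', hN'⟩ := h'
  refine ⟨N + N', fun w => ?_⟩
  have h1 := hN.mono hA hB N' w
  have h2 := hN'.mono hA' hB N w
  rw [add_comm N' N] at h2
  convert h1.add h2 (hB.bddSnd A w) (hA.bddFst B w) (hB.bddSnd A' w) (hA'.bddFst B w) using 1 <;>
  funext p <;> simp [opTable]

theorem Local.smul {r : ℂ} {A B : ℤ → Module.End ℂ W} (h : Local r A B) (a : ℂ) :
    Local r (a • A) B := by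
  obtain ⟨N, hN⟩ := h
  refine ⟨N, fun w => ?_⟩
  convert (hN w).smul a using 1 <;> funext p <;> simp [opTable]

theorem Local.zero {r : ℂ} {B : ℤ → Module.End ℂ W} : Local r 0 B := by
  refine ⟨0, fun w => ?_⟩
  convert LocalPair.zero 0 r using 1 <;> funext p <;> simp [opTable]

theorem Truncated.add {A A' : ℤ → Module.End ℂ W} (h : Truncated A) (h' : Truncated A') :
    Truncated (A + A') := by
  intro w
  obtain ⟨K, hK⟩ := h w
  obtain ⟨K', hK'⟩ := h' w
  exact ⟨max K K', fun n hn => by simp [hK n (by omega), hK' n (by omega)]⟩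

/-- The identity field. -/
def idField : ℤ → Module.End ℂ W := fun n => if n = -1 then 1 else 0

theorem idField_isField (S : ChargedSpace G W) : IsField S 0 idField := by
  constructor
  · intro h w hw n
    rw [zero_add]
    unfold idField
    split_ifs
    · exact hw
    · exact Submodule.zero_mem _
  · intro w
    exact ⟨0, fun n hn => by simp [idField, show n ≠ -1 by omega]⟩

theorem idField_covariant (S : ChargedSpace G W) : Covariant S 0 idField := by
  intro h w hw n
  simp only [idField, map_zero, AddMonoidHom.zero_apply, add_zero]
  by_cases h1 : n = -1
  · subst h1; simp
  · by_cases h2 : n = 0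
    · subst h2; simp
    · simp [h1, show n - 1 ≠ -1 by omega]

theorem idField_local (B : ℤ → Module.End ℂ W) : Local 0 idField B := by
  refine ⟨0, fun w m k => ?_⟩
  simp only [Nat.cast_zero, add_zero, oneSubPow_zero, act_one, pow_zero, one_smul, opTable,
    Prod.swap_prod_mk, idField]
  split_ifs <;> simp

variable (S c ψ) in
/-- The covariant and creative fields of charge `g` that are local with all the fields `ψ x`. -/
def fieldSpace (hψ : Generating S c ψ) (g : G) : Submodule ℂ (ℤ → Module.End ℂ W) where
  carrier := {A | IsField S g A ∧ Covariant S g A ∧ (∀ n : ℤ, 0 ≤ n → A n S.vac = 0) ∧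
    ∀ x, Local (S.pairing g (c x)) A (ψ x)}
  zero_mem' := by
    refine ⟨⟨fun h w _ n => Submodule.zero_mem _, fun w => ⟨0, fun n _ => rfl⟩⟩, ?_, ?_, ?_⟩
    · intro h w _ n; simp
    · intro n _; rfl
    · intro x; exact Local.zero
  add_mem' := by
    rintro A B ⟨hA, cA, vA, lA⟩ ⟨hB, cB, vB, lB⟩
    refine ⟨⟨fun h w hw n => ?_, hA.trunc.add hB.trunc⟩, ?_, ?_, ?_⟩
    · exact Submodule.add_mem _ (hA.maps h w hw n) (hB.maps h w hw n)
    · intro h w hw n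
      simp only [Pi.add_apply, LinearMap.add_apply, map_add, cA h w hw, cB h w hw]
      module
    · intro n hn
      simp [vA n hn, vB n hn]
    · intro x
      exact (lA x).add (lB x) hA.trunc hB.trunc (hψ.field x).trunc
  smul_mem' := by
    rintro a A ⟨hA, cA, vA, lA⟩
    refine ⟨⟨fun h w hw n => ?_, fun w => ?_⟩, ?_, ?_, ?_⟩
    · exact Submodule.smul_mem _ _ (hA.maps h w hw n)
    · obtain ⟨K, hK⟩ := hA.trunc w
      exact ⟨K, fun n hn => by simp [hK n hn]⟩
    · intro h w hw n
      simp only [Pi.smul_apply, LinearMap.smul_apply, map_smul, cA h w hw]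
      module
    · intro n hn
      simp [vA n hn]
    · intro x
      exact (lA x).smul a

/-- A covariant creative field that kills the vacuum in its constant term kills it altogether, since
`A(z)𝟏 = exp(z der) A_{-1}𝟏`. -/
theorem eq_zero_of_vac {g : G} {A : ℤ → Module.End ℂ W} (cA : Covariant S g A)
    (vA : ∀ n : ℤ, 0 ≤ n → A n S.vac = 0) (h : A (-1) S.vac = 0) (n : ℤ) : A n S.vac = 0 := by
  by_cases hn : 0 ≤ n
  · exact vA n hn
  · obtain ⟨k, hk⟩ := Int.eq_ofNat_of_zero_le (show 0 ≤ -1 - n by omega)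
    obtain rfl : n = -1 - k := by omega
    clear hk hn
    induction k with
    | zero => simpa using h
    | succ k ih =>
      have h1 := cA 0 S.vac S.vac_mem (-1 - k)
      rw [ih, map_zero, S.der_vac, map_zero, zero_sub, eq_comm, neg_eq_zero, map_zero, add_zero,
        smul_eq_zero] at h1
      rcases h1 with h1 | h1
      · exfalso
        have h2 : (-1 : ℤ) - k = 0 := by exact_mod_cast h1
        omega
      · rw [← h1]
        congr 2
        push_cast
        ring

/-- If `A` kills `w` and is local with `B`, then `A` kills the vectors `B_k w`. -/
theorem LocalWith.eq_zero {A B : ℤ → Module.End ℂ W} {N : ℕ} {r : ℂ} (h : LocalWith N r A B)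
    (hB : Truncated B) {w : W} (hw : ∀ n, A n w = 0) (m k : ℤ) : A m (B k w) = 0 := by
  obtain ⟨K, hK⟩ := hB w
  -- Downward induction on `k`: in the coefficient of the locality relation at `(m - N, k)` the other
  -- terms are `A m' (B k' w)` with `k' > k`, or have `A` acting on `w`.
  have key : ∀ d : ℕ, ∀ k : ℤ, K - d ≤ k → ∀ m, A m (B k w) = 0 := by
    intro d
    induction d with
    | zero => intro k hk m; rw [hK k (by omega), map_zero]
    | succ d ih =>
      intro k hk m
      have h1 := h w (m - N) k
      rw [act_left_apply, act_right_apply, finsum_eq_single _ 0] at h1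
      · simp only [opTable, coeff_oneSubPow, Prod.swap_prod_mk, hw, map_zero, smul_zero,
          finsum_zero] at h1
        simpa using h1
      · intro i hi
        simp only [opTable]
        rw [ih _ (by omega), smul_zero]
  exact key (K - k).toNat k (by omega) m

/-- Goddard's uniqueness argument: a field local with the generators is determined by its value on
the vacuum. -/
theorem eq_zero_of_mem_fieldSpace (hψ : Generating S c ψ) {g : G} {A : ℤ → Module.End ℂ W}
    (hA : A ∈ fieldSpace S c ψ hψ g) (h : A (-1) S.vac = 0) : A = 0 := by
  obtain ⟨_, cA, vA, lA⟩ := hA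
  have key : ∀ g' w, Reach S.vac c ψ g' w → ∀ n, A n w = 0 := by
    intro g' w hw
    induction hw with
    | vac => exact eq_zero_of_vac cA vA h
    | step x n _ ih =>
      obtain ⟨N, hN⟩ := lA x
      exact fun m => hN.eq_zero (hψ.field x).trunc ih m n
  funext n
  refine LinearMap.ext_on hψ.span ?_
  rintro w ⟨g', hw⟩
  exact key g' w hw n

theorem nProd_mem_fieldSpace (hψ : Generating S c ψ) {g h : G} {A B : ℤ → Module.End ℂ W}
    (hA : A ∈ fieldSpace S c ψ hψ g) (hB : B ∈ fieldSpace S c ψ hψ h) {N : ℕ}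
    (hl : LocalWith N (S.pairing g h) A B) (n : ℤ) :
    nProd S g hl hA.1.trunc hB.1.trunc n ∈ fieldSpace S c ψ hψ (g + h) := by
  refine ⟨hA.1.nProd hB.1 hl n, Covariant.nProd hA.1 hB.1 hA.2.1 hB.2.1 hl n, ?_, ?_⟩
  · intro k hk
    rw [nProd_vac hA.1 hB.1 hA.2.2.1 hB.2.2.1 hl n k (by omega), if_neg (by omega)]
  · intro x
    obtain ⟨N', h1, h2, h3⟩ := Local.exists_common hA.1.trunc hB.1.trunc (hψ.field x).trunc
      ⟨N, hl⟩ (hA.2.2.2 x) (hB.2.2.2 x)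
    -- The product does not depend on the order of locality used to define it.
    have e : nProd S g hl hA.1.trunc hB.1.trunc n = nProd S g h1 hA.1.trunc hB.1.trunc n := by
      have indep : ∀ N₁ N₂ (l₁ : LocalWith N₁ (S.pairing g h) A B)
          (l₂ : LocalWith N₂ (S.pairing g h) A B) (g' : G) (w : W), w ∈ S.gr g' →
          ∀ d : ℕ, ∀ n : ℤ, max N₁ N₂ - d ≤ n → ∀ q,
            nProd S g l₁ hA.1.trunc hB.1.trunc n q w =
              nProd S g l₂ hA.1.trunc hB.1.trunc n q w := by
        intro N₁ N₂ l₁ l₂ g' w hw d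
        induction d with
        | zero =>
          intro n hn q
          rw [nProd_of_le _ _ _ _ _ (by omega), nProd_of_le _ _ _ _ _ (by omega)]
        | succ d ih =>
          intro n hn q
          have j := (jacobiFor_nProd S g l₁ hA.1.trunc hB.1.trunc hw n 0 q).symm.trans
            (jacobiFor_nProd S g l₂ hA.1.trunc hB.1.trunc hw n 0 q)
          have fin : ∀ N₁ (l₁ : LocalWith N₁ (S.pairing g h) A B), (Function.support fun i : ℕ =>
              Ring.choose (((0 : ℤ) : ℂ) + S.pairing g g') i •
                nProd S g l₁ hA.1.trunc hB.1.trunc (n + i) (0 + q - i) w).Finite := by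
            intro N₁ l₁
            refine (Set.finite_Iio (N₁ - n).toNat).subset fun i hi => ?_
            rw [Set.mem_Iio]
            by_contra h0
            exact hi (by simp only; rw [nProd_of_le _ _ _ _ _ (by omega)]; simp)
          rw [← sub_eq_zero, ← finsum_sub_distrib (fin N₁ l₁) (fin N₂ l₂),
            finsum_eq_single _ 0] at j
          · simpa [sub_eq_zero] using j
          · intro i hi
            rw [ih (n + i) (by omega), sub_self]
      funext q
      refine linearMap_ext_of_span S.span fun g' w hw => ?_
      exact indep N N' hl h1 g' w hw (max N N' - n).toNat n (by omega) q
    rw [e]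
    exact Local.nProd hA.1 hB.1 (hψ.field x) h1 h2 h3 n

theorem generator_mem_fieldSpace (hψ : Generating S c ψ) (x : ι) :
    ψ x ∈ fieldSpace S c ψ hψ (c x) :=
  ⟨hψ.field x, hψ.cov x, hψ.vac x, hψ.isLocal x⟩

theorem idField_mem_fieldSpace (hψ : Generating S c ψ) : idField ∈ fieldSpace S c ψ hψ 0 := by
  refine ⟨idField_isField S, idField_covariant S, fun n hn => ?_, fun x => ?_⟩
  · simp [idField, show n ≠ -1 by omega]
  · rw [map_zero, AddMonoidHom.zero_apply]
    exact idField_local _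

theorem local_generator (hψ : Generating S c ψ) {g : G} {A : ℤ → Module.End ℂ W}
    (hA : A ∈ fieldSpace S c ψ hψ g) (x : ι) : Local (S.pairing (c x) g) (ψ x) A := by
  rw [S.pairing_comm]
  exact (hA.2.2.2 x).symm

/-- A graded family of subspaces that contains all vectors obtained from the vacuum is the full
one. -/
theorem eq_gr_of_reach (hψ : Generating S c ψ) (R : G → Submodule ℂ W) (hR : ∀ g, R g ≤ S.gr g)
    (h : ∀ g w, Reach S.vac c ψ g w → w ∈ R g) (g : G) : R g = S.gr g := by
  classical
  refine le_antisymm (hR g) fun v hv => ?_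
  set P : W →ₗ[ℂ] W := glue S.indep S.span W fun g' =>
    if g' = g then (S.gr g').subtype else 0 with hP
  have hPv : P v = v := by
    rw [hP, glue_apply S.indep S.span _ hv]; simp
  have key : ∀ w : W, P w ∈ R g := by
    intro w
    have hw : w ∈ Submodule.span ℂ {w | ∃ h, Reach S.vac c ψ h w} := hψ.span ▸ Submodule.mem_top
    induction hw using Submodule.span_induction with
    | mem w hw =>
      obtain ⟨g', hw⟩ := hw
      rw [hP, glue_apply S.indep S.span _ (hw.mem hψ.field)]
      split_ifs with h0
      · subst h0; exact h _ _ hw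
      · exact Submodule.zero_mem _
    | zero => rw [map_zero]; exact Submodule.zero_mem _
    | add x y _ _ hx hy => rw [map_add]; exact Submodule.add_mem _ hx hy
    | smul a x _ hx => rw [map_smul]; exact Submodule.smul_mem _ _ hx
  rw [← hPv]
  exact key v

/-- The value of a field on the vacuum: `A ↦ A_{-1}𝟏`. -/
def vacValue (S : ChargedSpace G W) : (ℤ → Module.End ℂ W) →ₗ[ℂ] W where
  toFun A := A (-1) S.vac
  map_add' _ _ := rfl
  map_smul' _ _ := rfl

theorem exists_field_of_reach (hψ : Generating S c ψ) {h : G} {u : W} (hu : Reach S.vac c ψ h u) :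
    ∃ A ∈ fieldSpace S c ψ hψ h, A (-1) S.vac = u := by
  induction hu with
  | vac => exact ⟨idField, idField_mem_fieldSpace hψ, by simp [idField]⟩
  | step x n _ ih =>
    obtain ⟨A, hA, rfl⟩ := ih
    obtain ⟨N, hN⟩ := local_generator hψ hA x
    refine ⟨_, nProd_mem_fieldSpace hψ (generator_mem_fieldSpace hψ x) hA hN n, ?_⟩
    rw [nProd_vac (hψ.field x) hA.1 (hψ.vac x) hA.2.2.1 hN n (-1) (by omega), if_pos rfl]

theorem map_vacValue (hψ : Generating S c ψ) (g : G) :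
    (fieldSpace S c ψ hψ g).map (vacValue S) = S.gr g := by
  refine eq_gr_of_reach hψ (fun g => (fieldSpace S c ψ hψ g).map (vacValue S)) ?_ ?_ g
  · rintro g _ ⟨A, hA, rfl⟩
    have := hA.1.maps 0 S.vac S.vac_mem (-1)
    rwa [add_zero] at this
  · intro g w hw
    obtain ⟨A, hA, h⟩ := exists_field_of_reach hψ hw
    exact ⟨A, hA, h⟩

/-- The field-state correspondence on the component of degree `g`. -/
def stateEquiv (hψ : Generating S c ψ) (g : G) : fieldSpace S c ψ hψ g ≃ₗ[ℂ] S.gr g :=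
  LinearEquiv.ofBijective
    (((vacValue S).comp (fieldSpace S c ψ hψ g).subtype).codRestrict (S.gr g) fun A => by
      rw [← map_vacValue hψ g]
      exact ⟨A, A.2, rfl⟩) (by
    constructor
    · rw [← LinearMap.ker_eq_bot, LinearMap.ker_eq_bot']
      intro A hA
      exact Subtype.ext (eq_zero_of_mem_fieldSpace hψ A.2 (congrArg Subtype.val hA))
    · rintro ⟨u, hu⟩
      rw [← map_vacValue hψ g] at hu
      obtain ⟨A, hA, h⟩ := hu
      exact ⟨⟨A, hA⟩, Subtype.ext h⟩)

/-- The field of a homogeneous vector. -/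
def fieldOf (hψ : Generating S c ψ) (g : G) : S.gr g →ₗ[ℂ] (ℤ → Module.End ℂ W) :=
  (fieldSpace S c ψ hψ g).subtype ∘ₗ (stateEquiv hψ g).symm.toLinearMap

theorem fieldOf_mem (hψ : Generating S c ψ) {g : G} (u : S.gr g) :
    fieldOf hψ g u ∈ fieldSpace S c ψ hψ g :=
  ((stateEquiv hψ g).symm u).2

theorem fieldOf_vac (hψ : Generating S c ψ) {g : G} (u : S.gr g) :
    fieldOf hψ g u (-1) S.vac = u :=
  congrArg Subtype.val ((stateEquiv hψ g).apply_symm_apply u)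

theorem fieldOf_eq (hψ : Generating S c ψ) {g : G} {u : S.gr g} {A : ℤ → Module.End ℂ W}
    (hA : A ∈ fieldSpace S c ψ hψ g) (h : A (-1) S.vac = u) : fieldOf hψ g u = A := by
  rw [← sub_eq_zero]
  refine eq_zero_of_mem_fieldSpace hψ (Submodule.sub_mem _ (fieldOf_mem hψ u) hA) ?_
  rw [Pi.sub_apply, LinearMap.sub_apply, fieldOf_vac, h, sub_self]

/-- All fields in the spaces `fieldSpace` are mutually local. -/
theorem local_of_mem_fieldSpace (hψ : Generating S c ψ) {g h : G} {A B : ℤ → Module.End ℂ W}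
    (hA : A ∈ fieldSpace S c ψ hψ g) (hB : B ∈ fieldSpace S c ψ hψ h) :
    Local (S.pairing g h) A B := by
  -- The fields that are local with `B` form a subspace that still attains every vector on the
  -- vacuum, by Dong's lemma; as fields are determined by these values, it is the whole space.
  let L : G → Submodule ℂ (ℤ → Module.End ℂ W) := fun g =>
    { carrier := {A | A ∈ fieldSpace S c ψ hψ g ∧ Local (S.pairing g h) A B}
      zero_mem' := ⟨Submodule.zero_mem _, Local.zero⟩
      add_mem' := fun {A A'} h1 h2 => ⟨Submodule.add_mem _ h1.1 h2.1,
        h1.2.add h2.2 h1.1.1.trunc h2.1.1.trunc hB.1.trunc⟩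
      smul_mem' := fun a A h1 => ⟨Submodule.smul_mem _ _ h1.1, h1.2.smul a⟩ }
  have key : (L g).map (vacValue S) = S.gr g := by
    refine eq_gr_of_reach hψ (fun g => (L g).map (vacValue S)) ?_ ?_ g
    · rintro g _ ⟨A, hA, rfl⟩
      have := hA.1.1.maps 0 S.vac S.vac_mem (-1)
      rwa [add_zero] at this
    · intro g w hw
      induction hw with
      | vac =>
        refine ⟨idField, ⟨idField_mem_fieldSpace hψ, ?_⟩, by simp [idField, vacValue]⟩
        rw [map_zero, AddMonoidHom.zero_apply]
        exact idField_local _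
      | step x n _ ih =>
        obtain ⟨A, hA, rfl⟩ := ih
        obtain ⟨N, h1, h2, h3⟩ := Local.exists_common (hψ.field x).trunc hA.1.1.trunc hB.1.trunc
          (local_generator hψ hA.1 x) (local_generator hψ hB x) hA.2
        refine ⟨_, ⟨nProd_mem_fieldSpace hψ (generator_mem_fieldSpace hψ x) hA.1 h1 n,
          Local.nProd (hψ.field x) hA.1.1 hB.1 h1 h2 h3 n⟩, ?_⟩
        change nProd S _ h1 _ _ n (-1) S.vac = _
        rw [nProd_vac (hψ.field x) hA.1.1 (hψ.vac x) hA.1.2.2.1 h1 n (-1) (by omega), if_pos rfl]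
        rfl
  have hu : A (-1) S.vac ∈ S.gr g := by
    have := hA.1.maps 0 S.vac S.vac_mem (-1)
    rwa [add_zero] at this
  have hu' := hu
  rw [← key] at hu'
  obtain ⟨A', hA', h'⟩ := hu'
  have e : A' = A := (fieldOf_eq hψ (u := ⟨_, hu⟩) hA'.1 h').symm.trans (fieldOf_eq hψ hA rfl)
  exact e ▸ hA'.2

theorem jacobiFor_fieldOf (hψ : Generating S c ψ) {g h g' : G} (u : S.gr g) (v : S.gr h) {w : W}
    (hw : w ∈ S.gr g') : JacobiFor (S.pairing g h) (S.pairing g g') (fieldOf hψ g u)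
      (fieldOf hψ h v) (fun n => fieldOf hψ (g + h)
        ⟨fieldOf hψ g u n v, (fieldOf_mem hψ u).1.maps _ _ v.2 n⟩) w := by
  obtain ⟨N, hN⟩ := local_of_mem_fieldSpace hψ (fieldOf_mem hψ u) (fieldOf_mem hψ v)
  have hA := fieldOf_mem hψ u
  have hB := fieldOf_mem hψ v
  have e : (fun n => fieldOf hψ (g + h)
      ⟨fieldOf hψ g u n v, (fieldOf_mem hψ u).1.maps _ _ v.2 n⟩) =
      nProd S g hN hA.1.trunc hB.1.trunc := by
    funext n
    refine fieldOf_eq hψ (nProd_mem_fieldSpace hψ hA hB hN n) ?_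
    rw [nProd_vac hA.1 hB.1 hA.2.2.1 hB.2.2.1 hN n (-1) (by omega), if_pos rfl, fieldOf_vac]
  rw [e]
  exact jacobiFor_nProd S g hN hA.1.trunc hB.1.trunc hw

/-- The vertex operators with modes indexed by complex numbers: for `u` of degree `g` and on the
component of degree `h`, the mode `u_l` is the mode of `fieldOf` with the integral index
`l - pairing g h`, and `0` if this number is not an integer. -/
def vertexOp (hψ : Generating S c ψ) : W →ₗ[ℂ] (ℂ → Module.End ℂ W) :=
  glue S.indep S.span _ fun g => LinearMap.pi fun l =>
    (glue S.indep S.span W) ∘ₗ LinearMap.pi fun h =>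
      open Classical in
      if hl : ∃ n : ℤ, l = n + S.pairing g h then
        (LinearMap.lcomp ℂ W (S.gr h).subtype) ∘ₗ (LinearMap.proj hl.choose) ∘ₗ fieldOf hψ g
      else 0

theorem vertexOp_apply (hψ : Generating S c ψ) {g h : G} {u v : W} (hu : u ∈ S.gr g)
    (hv : v ∈ S.gr h) (n : ℤ) {l : ℂ} (hl : l = n + S.pairing g h) :
    vertexOp hψ u l v = fieldOf hψ g ⟨u, hu⟩ n v := by
  have hex : ∃ n : ℤ, l = n + S.pairing g h := ⟨n, hl⟩
  have hn : hex.choose = n := by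
    have := hl.symm.trans hex.choose_spec
    rw [add_left_inj] at this
    exact_mod_cast this.symm
  rw [vertexOp, glue_apply S.indep S.span _ hu]
  simp only [LinearMap.pi_apply, LinearMap.comp_apply]
  rw [glue_apply S.indep S.span _ hv, LinearMap.pi_apply, dif_pos hex, hn]
  rfl

theorem vertexOp_apply_eq_zero (hψ : Generating S c ψ) {g h : G} {u v : W} (hu : u ∈ S.gr g)
    (hv : v ∈ S.gr h) {l : ℂ} (hl : ∀ n : ℤ, l ≠ n + S.pairing g h) :
    vertexOp hψ u l v = 0 := by
  rw [vertexOp, glue_apply S.indep S.span _ hu]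
  simp only [LinearMap.pi_apply, LinearMap.comp_apply]
  rw [glue_apply S.indep S.span _ hv, LinearMap.pi_apply, dif_neg (by push Not; exact hl)]
  rfl

theorem GradingForms.Rep.exists_int {F : GradingForms G}
    (hF : ∀ g h, F.form g h = QuotientAddGroup.mk (S.pairing g h)) {r : ℂ} {g h : G}
    (hr : F.Rep r g h) : ∃ p : ℤ, r = S.pairing g h + 2 * p := by
  rw [GradingForms.Rep, hF, QuotientAddGroup.eq] at hr
  obtain ⟨p, hp⟩ := AddSubgroup.mem_zmultiples_iff.1 hr
  refine ⟨-p, ?_⟩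
  rw [zsmul_eq_mul] at hp
  push_cast
  linear_combination hp

/-- The generalized vertex algebra reconstructed from a generating family of fields. -/
def reconstruct (hψ : Generating S c ψ) (F : GradingForms G)
    (hF : ∀ g h, F.form g h = QuotientAddGroup.mk (S.pairing g h)) (hc : ∀ g h, F.c g h = 1) :
    GenVertexAlgebra F S.gr where
  Y := vertexOp hψ
  vac := S.vac
  gr_indep := S.indep
  gr_span := S.span
  vac_mem := S.vac_mem
  mode_mem g h u v l hu hv := by
    by_cases hl : ∃ n : ℤ, l = n + S.pairing g h
    · obtain ⟨n, hl⟩ := hl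
      rw [vertexOp_apply hψ hu hv n hl]
      exact (fieldOf_mem hψ _).1.maps _ _ hv _
    · rw [vertexOp_apply_eq_zero hψ hu hv (by push Not at hl; exact hl)]
      exact Submodule.zero_mem _
  truncation u v := by
    have hu : u ∈ ⨆ g, S.gr g := S.span ▸ Submodule.mem_top
    have hv : v ∈ ⨆ g, S.gr g := S.span ▸ Submodule.mem_top
    induction hu using Submodule.iSup_induction' with
    | mem g u hu =>
      induction hv using Submodule.iSup_induction' with
      | mem h v hv =>
        obtain ⟨K, hK⟩ := (fieldOf_mem hψ ⟨u, hu⟩).1.trunc v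
        refine ⟨K + (S.pairing g h).re, fun l hl => ?_⟩
        by_cases hl' : ∃ n : ℤ, l = n + S.pairing g h
        · obtain ⟨n, rfl⟩ := hl'
          rw [vertexOp_apply hψ hu hv n rfl, hK]
          rw [Complex.add_re, Complex.intCast_re, add_le_add_iff_right] at hl
          exact_mod_cast hl
        · exact vertexOp_apply_eq_zero hψ hu hv (by push Not at hl'; exact hl')
      | zero => exact ⟨0, fun l _ => by simp⟩
      | add x y _ _ hx hy =>
        obtain ⟨K, hK⟩ := hx
        obtain ⟨K', hK'⟩ := hy
        exact ⟨max K K', fun l hl => by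
          rw [map_add, hK l (le_trans (le_max_left _ _) hl),
            hK' l (le_trans (le_max_right _ _) hl), add_zero]⟩
    | zero => exact ⟨0, fun l _ => by simp⟩
    | add x y _ _ hx hy =>
      obtain ⟨K, hK⟩ := hx
      obtain ⟨K', hK'⟩ := hy
      exact ⟨max K K', fun l hl => by
        rw [map_add, Pi.add_apply, LinearMap.add_apply, hK l (le_trans (le_max_left _ _) hl),
          hK' l (le_trans (le_max_right _ _) hl), add_zero]⟩
  vacuum l := by
    refine linearMap_ext_of_span S.span fun h w hw => ?_
    have e : fieldOf hψ 0 ⟨S.vac, S.vac_mem⟩ = idField :=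
      fieldOf_eq hψ (idField_mem_fieldSpace hψ) (by simp [idField])
    by_cases hl : ∃ n : ℤ, l = n + S.pairing 0 h
    · obtain ⟨n, hl⟩ := hl
      rw [vertexOp_apply hψ S.vac_mem hw n hl, e]
      rw [map_zero, AddMonoidHom.zero_apply, add_zero] at hl
      subst hl
      have : ((n : ℂ) = -1) ↔ n = -1 := by
        constructor
        · intro h1; exact_mod_cast h1
        · rintro rfl; simp
      simp only [idField, this]
    · push Not at hl
      rw [vertexOp_apply_eq_zero hψ S.vac_mem hw hl, if_neg]
      · rfl
      · rintro rfl
        exact hl (-1) (by simp)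
  creation v l hl := by
    have hv : v ∈ ⨆ g, S.gr g := S.span ▸ Submodule.mem_top
    induction hv using Submodule.iSup_induction' with
    | mem g v hv =>
      by_cases hl' : ∃ n : ℤ, l = n + S.pairing g 0
      · obtain ⟨n, hl'⟩ := hl'
        rw [vertexOp_apply hψ hv S.vac_mem n hl']
        refine (fieldOf_mem hψ _).2.2.1 n ?_
        by_contra h0
        refine hl (-1 - n).toNat ?_
        have : ((-1 - n).toNat : ℤ) = -1 - n := Int.toNat_of_nonneg (by omega)
        rw [← Int.cast_natCast, this, hl']
        simp
      · exact vertexOp_apply_eq_zero hψ hv S.vac_mem (by push Not at hl'; exact hl')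
    | zero => simp
    | add x y _ _ hx hy => simp [hx, hy]
  creation_neg_one v := by
    have hv : v ∈ ⨆ g, S.gr g := S.span ▸ Submodule.mem_top
    induction hv using Submodule.iSup_induction' with
    | mem g v hv =>
      rw [vertexOp_apply hψ hv S.vac_mem (-1) (by simp), fieldOf_vac]
    | zero => simp
    | add x y _ _ hx hy => simp [hx, hy]
  support g h u v r l hu hv hr hl := by
    obtain ⟨p, hp⟩ := hr.exists_int hF
    refine vertexOp_apply_eq_zero hψ hu hv fun n hn => hl (n - 2 * p) ?_
    rw [hn, hp]
    push_cast
    ring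
  jacobi g h g' u v w hu hv hw r s t hr hs ht n m k := by
    -- The representatives differ from the values of the pairing by even integers, which are absorbed
    -- by the integral indices; the sign `(-1)^n` does not change.
    obtain ⟨a, rfl⟩ := hr.exists_int hF
    obtain ⟨b, rfl⟩ := hs.exists_int hF
    obtain ⟨d, rfl⟩ := ht.exists_int hF
    have J := jacobiFor_fieldOf hψ ⟨u, hu⟩ ⟨v, hv⟩ hw (n + 2 * a) (m + 2 * b) (k + 2 * d)
    have mu := (fieldOf_mem hψ ⟨u, hu⟩).1
    have mv := (fieldOf_mem hψ ⟨v, hv⟩).1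
    rw [act_left_apply, act_right_apply] at J
    simp only [opTable, Prod.swap_prod_mk, coeff_oneSubPow] at J
    rw [hc]
    convert J using 2
    · refine finsum_congr fun i => ?_
      rw [vertexOp_apply hψ hv hw (k + 2 * d + i) (by push_cast; ring),
        vertexOp_apply hψ hu (mv.maps _ _ hw _) (m + 2 * b + (n + 2 * a) - i)
          (by rw [map_add]; push_cast; ring)]
      congr 3
      push_cast
      ring
    · have e : (-1 : ℂ) ^ (n + 2 * a) = (-1) ^ n := by
        rw [zpow_add₀ (by norm_num), zpow_mul]; simp
      rw [e, Units.val_one, one_mul]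
      congr 1
      refine finsum_congr fun i => ?_
      rw [vertexOp_apply hψ hu hw (m + 2 * b + i) (by push_cast; ring),
        vertexOp_apply hψ hv (mu.maps _ _ hw _) (k + 2 * d + (n + 2 * a) - i)
          (by rw [map_add, S.pairing_comm h g]; push_cast; ring)]
      congr 3
      push_cast
      ring
    · funext i
      rw [vertexOp_apply hψ hu hv (n + 2 * a + i) (by push_cast; ring),
        vertexOp_apply hψ (mu.maps _ _ hv _) hw (m + 2 * b + (k + 2 * d) - i)
          (by rw [map_add, AddMonoidHom.add_apply]; push_cast; ring)]
      congr 2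
      push_cast
      ring

theorem reconstruct_Y_generator (hψ : Generating S c ψ) (F : GradingForms G)
    (hF : ∀ g h, F.form g h = QuotientAddGroup.mk (S.pairing g h)) (hc : ∀ g h, F.c g h = 1)
    (x : ι) {h : G} {w : W} (hw : w ∈ S.gr h) (n : ℤ) :
    (reconstruct hψ F hF hc).Y (ψ x (-1) S.vac) (n + S.pairing (c x) h) w = ψ x n w := by
  have hu : ψ x (-1) S.vac ∈ S.gr (c x) := by
    have := (hψ.field x).maps 0 S.vac S.vac_mem (-1)
    rwa [add_zero] at this
  change vertexOp hψ _ _ _ = _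
  rw [vertexOp_apply hψ hu hw n rfl, fieldOf_eq hψ (generator_mem_fieldSpace hψ x) rfl]

/-- A generalized vertex algebra is determined by its vacuum and generating fields: the Jacobi
identity expresses the fields of `u_n v` through those of `u` and `v`. -/
theorem genVertexAlgebra_ext (hψ : Generating S c ψ) {F : GradingForms G}
    (hF : ∀ g h, F.form g h = QuotientAddGroup.mk (S.pairing g h))
    {T T' : GenVertexAlgebra F S.gr} (hv : T.vac = S.vac) (hv' : T'.vac = S.vac)
    (hT : ∀ x, ∀ h, ∀ w ∈ S.gr h, ∀ n : ℤ,
      T.Y (ψ x (-1) S.vac) (n + S.pairing (c x) h) w = ψ x n w)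
    (hT' : ∀ x, ∀ h, ∀ w ∈ S.gr h, ∀ n : ℤ,
      T'.Y (ψ x (-1) S.vac) (n + S.pairing (c x) h) w = ψ x n w) : T = T' := by
  have rep : ∀ g h, F.Rep (S.pairing g h) g h := fun g h => (hF g h).symm
  have ext_of : ∀ {g : G} {u : W}, u ∈ S.gr g → (∀ h, ∀ w ∈ S.gr h, ∀ n : ℤ,
      T.Y u (n + S.pairing g h) w = T'.Y u (n + S.pairing g h) w) → T.Y u = T'.Y u := by
    intro g u hu hyp
    funext l
    refine linearMap_ext_of_span S.span fun h w hw => ?_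
    by_cases hl : ∃ n : ℤ, l = n + S.pairing g h
    · obtain ⟨n, rfl⟩ := hl
      exact hyp h w hw n
    · push Not at hl
      have hl' : ∀ k : ℤ, l ≠ S.pairing g h + k := fun k h0 => hl k (by rw [h0, add_comm])
      rw [T.support g h u w _ l hu hw (rep g h) hl', T'.support g h u w _ l hu hw (rep g h) hl']
  have key : ∀ h u, Reach S.vac c ψ h u → T.Y u = T'.Y u := by
    intro h u hu
    induction hu with
    | vac =>
      funext l
      have e1 := T.vacuum l
      have e2 := T'.vacuum l
      rw [hv] at e1
      rw [hv'] at e2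
      rw [e1, e2]
    | @step x n h u hu ih =>
      have hu' := hu.mem hψ.field
      set a := ψ x (-1) S.vac with ha
      have ha' : a ∈ S.gr (c x) := by
        have := (hψ.field x).maps 0 S.vac S.vac_mem (-1)
        rwa [add_zero] at this
      have Ya : T.Y a = T'.Y a := ext_of ha' fun h w hw n => by rw [hT x h w hw, hT' x h w hw]
      refine ext_of ((hψ.field x).maps _ _ hu' n) fun g' w hw q => ?_
      obtain ⟨K, hK⟩ := (hψ.field x).trunc u
      -- Downward induction on `n`: for `m = 0` the right hand side of the Jacobi identity is the mode
      -- of `ψ x n u` plus modes of `ψ x (n + i) u` with `i ≥ 1`.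
      have down : ∀ d : ℕ, ∀ n : ℤ, K - d ≤ n → ∀ q : ℤ,
          T.Y (ψ x n u) (q + S.pairing (c x + h) g') w =
            T'.Y (ψ x n u) (q + S.pairing (c x + h) g') w := by
        intro d
        induction d with
        | zero => intro n hn q; rw [hK n (by omega)]; simp
        | succ d ihd =>
          intro n hn q
          have j := T.jacobi (c x) h g' a u w ha' hu' hw _ _ _ (rep _ _) (rep _ _) (rep _ _) n 0 q
          have j' := T'.jacobi (c x) h g' a u w ha' hu' hw _ _ _ (rep _ _) (rep _ _) (rep _ _)
            n 0 q
          rw [Ya, ih] at j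
          have j2 := j.symm.trans j'
          have e : ∀ i : ℕ, T'.Y a (n + S.pairing (c x) h + i) u = ψ x (n + i) u := by
            intro i
            rw [show ((n : ℂ) + S.pairing (c x) h + i) =
              ((n + i : ℤ) : ℂ) + S.pairing (c x) h by push_cast; ring]
            exact hT' x h u hu' (n + i)
          have e2 : ∀ i : ℕ, (((0 : ℤ) : ℂ) + S.pairing (c x) g' + q + S.pairing h g' - i) =
              ((q - i : ℤ) : ℂ) + S.pairing (c x + h) g' := by
            intro i
            rw [map_add, AddMonoidHom.add_apply]
            push_cast
            ring
          simp only [e, e2] at j2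
          have fin : ∀ T : GenVertexAlgebra F S.gr, (Function.support fun i : ℕ =>
              Ring.choose (((0 : ℤ) : ℂ) + S.pairing (c x) g') i •
                T.Y (ψ x (n + i) u) (((q - i : ℤ) : ℂ) + S.pairing (c x + h) g') w).Finite := by
            intro T
            refine (Set.finite_Iio (K - n).toNat).subset fun i hi => ?_
            rw [Set.mem_Iio]
            by_contra h0
            exact hi (by simp only; rw [hK _ (by omega)]; simp)
          rw [← sub_eq_zero, ← finsum_sub_distrib (fin T) (fin T'), finsum_eq_single _ 0] at j2
          · simpa [sub_eq_zero] using j2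
          · intro i hi
            rw [ihd (n + i) (by omega), sub_self]
      exact down (K - n).toNat n (by omega) q
  refine GenVertexAlgebra.ext ?_ (hv.trans hv'.symm)
  refine LinearMap.ext_on hψ.span ?_
  rintro u ⟨h, hu⟩
  exact key h u hu

/-- A generalized vertex algebra with generating fields is generated by the corresponding
vectors. -/
theorem generatedBy_of_generating (hψ : Generating S c ψ) {F : GradingForms G}
    {T : GenVertexAlgebra F S.gr} (hv : T.vac = S.vac)
    (hT : ∀ x, ∀ h, ∀ w ∈ S.gr h, ∀ n : ℤ,
      T.Y (ψ x (-1) S.vac) (n + S.pairing (c x) h) w = ψ x n w)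
    {U : Set W} (hU : ∀ x, ψ x (-1) S.vac ∈ U) : T.GeneratedBy U := by
  intro P hP hUP hcl
  rw [eq_top_iff, ← hψ.span, Submodule.span_le]
  rintro w ⟨h, hw⟩
  induction hw with
  | vac => rw [← hv]; exact hP
  | step x n hw ih =>
    rw [← hT x _ _ (hw.mem hψ.field)]
    exact hcl _ (hUP (hU x)) _ ih _

end Reconstruction

/-! ### Exponentials of power series with noncommuting coefficients -/

section ExpSeries

open scoped Nat
open Finset.HasAntidiagonal

variable {A : Type*} [Ring A] [Algebra ℂ A]

/-- The formal derivative of a power series over a noncommutative algebra. -/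
def psDeriv (f : PowerSeries A) : PowerSeries A :=
  PowerSeries.mk fun n => ((n : ℂ) + 1) • PowerSeries.coeff (n + 1) f

theorem coeff_psDeriv (f : PowerSeries A) (n : ℕ) :
    PowerSeries.coeff n (psDeriv f) = ((n : ℂ) + 1) • PowerSeries.coeff (n + 1) f := by
  simp [psDeriv]

theorem psDeriv_mul (f g : PowerSeries A) :
    psDeriv (f * g) = psDeriv f * g + f * psDeriv g := by
  ext n
  rw [coeff_psDeriv, map_add, PowerSeries.coeff_mul, PowerSeries.coeff_mul, PowerSeries.coeff_mul,
    Finset.smul_sum]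
  have h1 : ∑ p ∈ antidiagonal (n + 1),
      ((n : ℂ) + 1) • (PowerSeries.coeff p.1 f * PowerSeries.coeff p.2 g) =
      ∑ p ∈ antidiagonal (n + 1), ((p.1 : ℂ) • (PowerSeries.coeff p.1 f * PowerSeries.coeff p.2 g) +
        (p.2 : ℂ) • (PowerSeries.coeff p.1 f * PowerSeries.coeff p.2 g)) := by
    refine Finset.sum_congr rfl fun p hp => ?_
    rw [← add_smul]
    congr 1
    have := mem_antidiagonal.1 hp
    exact_mod_cast this.symm
  rw [h1, Finset.sum_add_distrib]
  congr 1
  · rw [Finset.Nat.sum_antidiagonal_succ]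
    simp [coeff_psDeriv]
  · rw [Finset.Nat.sum_antidiagonal_succ']
    simp [coeff_psDeriv]

theorem psDeriv_C (a : A) : psDeriv (PowerSeries.C a) = 0 := by
  ext n
  simp [coeff_psDeriv]

theorem eq_C_of_psDeriv_eq_zero {f : PowerSeries A} (h : psDeriv f = 0) :
    f = PowerSeries.C (PowerSeries.coeff 0 f) := by
  ext n
  cases n with
  | zero => simp
  | succ n =>
    have h1 := congrArg (PowerSeries.coeff n) h
    rw [coeff_psDeriv, map_zero, smul_eq_zero] at h1
    rcases h1 with h1 | h1
    · exact absurd h1 (by exact_mod_cast Nat.succ_ne_zero n)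
    · rw [h1, PowerSeries.coeff_C, if_neg (Nat.succ_ne_zero n)]

theorem psDeriv_pow {f : PowerSeries A} (h : Commute f (psDeriv f)) (r : ℕ) :
    psDeriv (f ^ (r + 1)) = ((r : ℂ) + 1) • (psDeriv f * f ^ r) := by
  induction r with
  | zero => simp
  | succ r ih =>
    rw [pow_succ, psDeriv_mul, ih, (h.pow_left (r + 1)).eq, smul_mul_assoc, mul_assoc, ← pow_succ]
    push_cast
    module

theorem coeff_pow_eq_zero {f : PowerSeries A} (h0 : PowerSeries.coeff 0 f = 0) {k r : ℕ}
    (h : k < r) : PowerSeries.coeff k (f ^ r) = 0 := by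
  induction r generalizing k with
  | zero => omega
  | succ r ih =>
    rw [pow_succ, PowerSeries.coeff_mul]
    refine Finset.sum_eq_zero fun p hp => ?_
    have hp' := mem_antidiagonal.1 hp
    by_cases h1 : p.2 = 0
    · rw [h1, h0, mul_zero]
    · rw [ih (by omega), zero_mul]

theorem coeff_expSeries {f : PowerSeries A} (h0 : PowerSeries.coeff 0 f = 0) {k N : ℕ}
    (h : k ≤ N) : PowerSeries.coeff k (expSeries f) =
      ∑ r ∈ Finset.range (N + 1), ((r ! : ℂ)⁻¹) • PowerSeries.coeff k (f ^ r) := by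
  rw [expSeries, PowerSeries.coeff_mk]
  refine Finset.sum_subset (Finset.range_mono (by omega)) fun r _ hr => ?_
  rw [coeff_pow_eq_zero h0 (by simpa using hr), smul_zero]

/-- The differential equation of the exponential. -/
theorem psDeriv_expSeries {f : PowerSeries A} (h0 : PowerSeries.coeff 0 f = 0)
    (h : Commute f (psDeriv f)) : psDeriv (expSeries f) = psDeriv f * expSeries f := by
  ext n
  rw [coeff_psDeriv, coeff_expSeries h0 le_rfl, Finset.sum_range_succ', PowerSeries.coeff_mul]
  have h1 : ∀ p ∈ antidiagonal n, PowerSeries.coeff p.1 (psDeriv f) *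
      PowerSeries.coeff p.2 (expSeries f) = ∑ r ∈ Finset.range (n + 1), ((r ! : ℂ)⁻¹) •
        (PowerSeries.coeff p.1 (psDeriv f) * PowerSeries.coeff p.2 (f ^ r)) := by
    intro p hp
    have := mem_antidiagonal.1 hp
    rw [coeff_expSeries h0 (show p.2 ≤ n by omega), Finset.mul_sum]
    simp only [mul_smul_comm]
  rw [Finset.sum_congr rfl h1, Finset.sum_comm]
  simp only [← Finset.smul_sum, ← PowerSeries.coeff_mul]
  rw [pow_zero, PowerSeries.coeff_one, if_neg (Nat.succ_ne_zero n), smul_zero, add_zero,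
    Finset.smul_sum]
  refine Finset.sum_congr rfl fun r _ => ?_
  have h2 := congrArg (PowerSeries.coeff n) (psDeriv_pow h r)
  rw [coeff_psDeriv, show ∀ (c : ℂ) (x : PowerSeries A), PowerSeries.coeff n (c • x) =
    c • PowerSeries.coeff n x from fun _ _ => rfl] at h2
  rw [smul_comm, h2, smul_smul]
  congr 1
  rw [Nat.factorial_succ]
  push_cast
  have : (r : ℂ) + 1 ≠ 0 := by exact_mod_cast Nat.succ_ne_zero r
  field_simp

theorem coeff_zero_expSeries (f : PowerSeries A) : PowerSeries.coeff 0 (expSeries f) = 1 := by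
  simp [expSeries]

theorem commute_of_coeff {f g : PowerSeries A}
    (h : ∀ i j, Commute (PowerSeries.coeff i f) (PowerSeries.coeff j g)) : Commute f g := by
  ext n
  rw [PowerSeries.coeff_mul, PowerSeries.coeff_mul, ← Finset.Nat.sum_antidiagonal_swap]
  exact Finset.sum_congr rfl fun p _ => (h p.2 p.1).eq

/-- An element that commutes with the coefficients of `g` commutes with the coefficients of the
solution of `E' = gE`, `E(0) = 1`. -/
theorem commute_coeff_of_ode {E g : PowerSeries A} (hE : psDeriv E = g * E)
    (h0 : PowerSeries.coeff 0 E = 1) {T : A} (hT : ∀ k, Commute T (PowerSeries.coeff k g)) (n : ℕ) :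
    Commute T (PowerSeries.coeff n E) := by
  induction n using Nat.strong_induction_on with
  | _ n ih =>
    cases n with
    | zero => rw [h0]; exact Commute.one_right T
    | succ n =>
      have h1 := congrArg (PowerSeries.coeff n) hE
      rw [coeff_psDeriv, PowerSeries.coeff_mul] at h1
      have hn : (n : ℂ) + 1 ≠ 0 := by exact_mod_cast Nat.succ_ne_zero n
      have h2 : PowerSeries.coeff (n + 1) E = ((n : ℂ) + 1)⁻¹ •
          ∑ p ∈ antidiagonal n, PowerSeries.coeff p.1 g * PowerSeries.coeff p.2 E := by
        rw [← h1, smul_smul, inv_mul_cancel₀ hn, one_smul]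
      rw [h2]
      refine Commute.smul_right (Commute.sum_right _ _ _ fun p hp => ?_) _
      have := mem_antidiagonal.1 hp
      exact (hT _).mul_right (ih _ (by omega))

theorem coeff_mul_mul (E' E : PowerSeries A) (g : ℕ → A) (j : ℕ) :
    PowerSeries.coeff j (E' * PowerSeries.mk g * E) =
      ∑ p ∈ antidiagonal j, PowerSeries.coeff p.2 (E' * PowerSeries.C (g p.1) * E) := by
  have h1 : ∀ p : ℕ × ℕ, PowerSeries.coeff p.2 (E' * PowerSeries.C (g p.1) * E) =
      ∑ q ∈ antidiagonal p.2,
        PowerSeries.coeff q.1 E' * g p.1 * PowerSeries.coeff q.2 E := by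
    intro p
    rw [PowerSeries.coeff_mul]
    simp only [PowerSeries.coeff_mul_C]
  simp only [h1]
  rw [PowerSeries.coeff_mul]
  simp only [PowerSeries.coeff_mul, PowerSeries.coeff_mk, Finset.sum_mul]
  rw [Finset.sum_sigma', Finset.sum_sigma']
  refine Finset.sum_nbij' (fun x => ⟨(x.2.2, x.2.1 + x.1.2), (x.2.1, x.1.2)⟩)
    (fun x => ⟨(x.2.1 + x.1.1, x.2.2), (x.2.1, x.1.1)⟩) ?_ ?_ ?_ ?_ ?_
  · rintro ⟨⟨a, b⟩, ⟨c, d⟩⟩ h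
    simp only [Finset.mem_sigma, mem_antidiagonal] at h ⊢
    obtain ⟨h, rfl⟩ := h
    exact ⟨by omega, trivial⟩
  · rintro ⟨⟨a, b⟩, ⟨c, d⟩⟩ h
    simp only [Finset.mem_sigma, mem_antidiagonal] at h ⊢
    obtain ⟨h, rfl⟩ := h
    exact ⟨by omega, trivial⟩
  · rintro ⟨⟨a, b⟩, ⟨c, d⟩⟩ h
    simp only [Finset.mem_sigma, mem_antidiagonal] at h
    obtain ⟨h, rfl⟩ := h
    rfl
  · rintro ⟨⟨a, b⟩, ⟨c, d⟩⟩ h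
    simp only [Finset.mem_sigma, mem_antidiagonal] at h
    obtain ⟨h, rfl⟩ := h
    rfl
  · rintro ⟨⟨a, b⟩, ⟨c, d⟩⟩ h
    rfl

/-- Data of a series `g` with commuting coefficients and the exponentials of its integral and of the
negative of its integral. -/
structure ExpPair (g E E' : PowerSeries A) : Prop where
  comm : ∀ i j, Commute (PowerSeries.coeff i g) (PowerSeries.coeff j g)
  deriv : psDeriv E = g * E
  deriv' : psDeriv E' = -g * E'
  zero : PowerSeries.coeff 0 E = 1
  zero' : PowerSeries.coeff 0 E' = 1

variable {g E E' : PowerSeries A}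

theorem ExpPair.symm (h : ExpPair g E E') : ExpPair (-g) E' E where
  comm i j := by simpa using h.comm i j
  deriv := h.deriv'
  deriv' := by rw [neg_neg]; exact h.deriv
  zero := h.zero'
  zero' := h.zero

theorem ExpPair.commute (h : ExpPair g E E') : Commute g E :=
  commute_of_coeff fun i j => commute_coeff_of_ode h.deriv h.zero (fun k => h.comm i k) j

theorem ExpPair.commute' (h : ExpPair g E E') : Commute g E' := by
  have := h.symm.commute
  rwa [Commute.neg_left_iff] at this

theorem ExpPair.mul_eq_one (h : ExpPair g E E') : E' * E = 1 := by
  have h1 : psDeriv (E' * E) = 0 := by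
    rw [psDeriv_mul, h.deriv, h.deriv', ← mul_assoc, ← h.commute'.eq]
    noncomm_ring
  rw [eq_C_of_psDeriv_eq_zero h1, PowerSeries.coeff_mul,
    Finset.Nat.antidiagonal_zero, Finset.sum_singleton, h.zero, h.zero', one_mul, map_one]

theorem ExpPair.mul_eq_one' (h : ExpPair g E E') : E * E' = 1 := h.symm.mul_eq_one

/-- The coefficients of the conjugate of `T` by the exponential satisfy a recursion through the
conjugates of the commutators of `T` with the coefficients of `g`. -/
theorem ExpPair.conj_rec (h : ExpPair g E E') (T : A) (j : ℕ) :
    ((j : ℂ) + 1) • PowerSeries.coeff (j + 1) (E' * PowerSeries.C T * E) =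
      ∑ p ∈ antidiagonal j, PowerSeries.coeff p.2 (E' * PowerSeries.C
        (T * PowerSeries.coeff p.1 g - PowerSeries.coeff p.1 g * T) * E) := by
  rw [← coeff_psDeriv, ← coeff_mul_mul E' E
    (fun k => T * PowerSeries.coeff k g - PowerSeries.coeff k g * T)]
  congr 1
  have h1 : (PowerSeries.mk fun k => T * PowerSeries.coeff k g - PowerSeries.coeff k g * T) =
      PowerSeries.C T * g - g * PowerSeries.C T := by
    ext k; simp
  rw [h1, psDeriv_mul, psDeriv_mul, psDeriv_C, h.deriv, h.deriv', neg_mul, h.commute'.eq]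
  noncomm_ring

theorem ExpPair.mul_coeff (h : ExpPair g E E') (T : A) (j : ℕ) :
    T * PowerSeries.coeff j E = ∑ p ∈ antidiagonal j,
      PowerSeries.coeff p.1 E * PowerSeries.coeff p.2 (E' * PowerSeries.C T * E) := by
  rw [← PowerSeries.coeff_mul, ← mul_assoc, ← mul_assoc, h.mul_eq_one', one_mul,
    PowerSeries.coeff_C_mul]

theorem ExpPair.coeff_zero_conj (h : ExpPair g E E') (T : A) :
    PowerSeries.coeff 0 (E' * PowerSeries.C T * E) = T := by
  have h1 := h.zero
  have h2 := h.zero'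
  rw [PowerSeries.coeff_zero_eq_constantCoeff_apply] at *
  simp [h1, h2]

theorem ExpPair.coeff_conj_of_commute (h : ExpPair g E E') {T : A}
    (hT : ∀ k, Commute T (PowerSeries.coeff k g)) (j : ℕ) :
    PowerSeries.coeff j (E' * PowerSeries.C T * E) = if j = 0 then T else 0 := by
  have h1 : Commute (PowerSeries.C T) E := commute_of_coeff fun i j => by
    rw [PowerSeries.coeff_C]
    split_ifs
    · exact commute_coeff_of_ode h.deriv h.zero hT j
    · exact Commute.zero_left _
  rw [mul_assoc, h1.eq, ← mul_assoc, h.mul_eq_one, one_mul, PowerSeries.coeff_C]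

end ExpSeries

/-! ### The normalized form on the Cartan subalgebra -/

section NormalizedForm

open LieAlgebra LieAlgebra.LoopAlgebra LieModule
open scoped TensorProduct Nat

variable {𝔤 : Type*} [LieRing 𝔤] [LieAlgebra ℂ 𝔤] [FiniteDimensional ℂ 𝔤] [LieAlgebra.IsSimple ℂ 𝔤]
variable (H : LieSubalgebra ℂ 𝔤) [H.IsCartanSubalgebra]

theorem lie_cartan (h h' : H) : ⁅(h : 𝔤), (h' : 𝔤)⁆ = 0 := by
  rw [← LieSubalgebra.coe_bracket, trivial_lie_zero]; rfl

/-- The root space decomposition, as an induction principle. -/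
theorem root_induction {P : Submodule ℂ 𝔤} (h0 : ∀ h : H, (h : 𝔤) ∈ P)
    (h1 : ∀ α ∈ H.root, ∀ a ∈ rootSpace H α, a ∈ P) (x : 𝔤) : x ∈ P := by
  have key : (⨆ χ : Weight ℂ H 𝔤, (rootSpace H χ).toSubmodule) = ⊤ := by
    rw [← LieSubmodule.iSup_toSubmodule, iSup_genWeightSpace_eq_top', LieSubmodule.top_toSubmodule]
  have h2 : (⨆ χ : Weight ℂ H 𝔤, (rootSpace H χ).toSubmodule) ≤ P := by
    refine iSup_le fun χ a ha => ?_
    by_cases hχ : χ.IsZero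
    · rw [hχ.eq, rootSpace_zero_eq] at ha
      exact h0 ⟨a, ha⟩
    · exact h1 χ (by simpa [LieSubalgebra.root] using hχ) a ha
  exact h2 (key ▸ Submodule.mem_top)

theorem exists_root : Nonempty H.root := by
  by_contra hne
  have hmem : ∀ x : 𝔤, x ∈ H.toSubmodule :=
    root_induction H (fun h => h.2) fun α hα => absurd ⟨⟨α, hα⟩⟩ hne
  refine LieAlgebra.IsSimple.non_abelian ℂ (L := 𝔤) ⟨fun x y => ?_⟩
  exact lie_cartan H ⟨x, hmem x⟩ ⟨y, hmem y⟩

/-- `α(t_α)` is a positive real number, since `4 / α(t_α)` is the sum of the squares of the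
integers `β(α^∨)`. -/
theorem root_apply_dual_pos (α : H.root) : ∃ x : ℝ, 0 < x ∧
    (α : Weight ℂ H 𝔤) ((IsKilling.cartanEquivDual H).symm
      (Weight.toLinear ℂ H 𝔤 (α : Weight ℂ H 𝔤))) = x := by
  have hα : (α : Weight ℂ H 𝔤).IsNonZero := LieSubalgebra.isNonZero_coe_root α
  have hne := IsKilling.root_apply_cartanEquivDual_symm_ne_zero hα
  have h2 := IsKilling.root_apply_coroot hα
  have h1 := IsKilling.traceForm_coroot (α : Weight ℂ H 𝔤) (IsKilling.coroot (α : Weight ℂ H 𝔤))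
  rw [h2] at h1
  set z : ℂ := (α : Weight ℂ H 𝔤) ((IsKilling.cartanEquivDual H).symm
      (Weight.toLinear ℂ H 𝔤 (α : Weight ℂ H 𝔤))) with hz
  have h3 := congrArg (fun B => B (IsKilling.coroot (α : Weight ℂ H 𝔤))
    (IsKilling.coroot (α : Weight ℂ H 𝔤))) (IsKilling.restrict_killingForm_eq_sum (K := ℂ) (H := H))
  choose n hn using fun β : Weight ℂ H 𝔤 =>
    (⟨_, IsKilling.apply_coroot_eq_cast' (α : Weight ℂ H 𝔤) β⟩ :
      ∃ m : ℤ, β (IsKilling.coroot (α : Weight ℂ H 𝔤)) = m)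
  have h4 : 4 * z⁻¹ = ((∑ β ∈ H.root, (n β : ℝ) ^ 2 : ℝ) : ℂ) := by
    have h5 : traceForm ℂ H 𝔤 (IsKilling.coroot (α : Weight ℂ H 𝔤))
        (IsKilling.coroot (α : Weight ℂ H 𝔤)) = 4 * z⁻¹ := by
      rw [h1]; simp only [nsmul_eq_mul, smul_eq_mul]; push_cast; ring
    rw [← h5]
    refine h3.trans ?_
    push_cast
    rw [Finset.sum_apply, LinearMap.sum_apply]
    refine Finset.sum_congr rfl fun β _ => ?_
    exact (congrArg₂ (· * ·) (hn β) (hn β)).trans (sq _).symm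
  have h6 : 0 < ∑ β ∈ H.root, (n β : ℝ) ^ 2 := by
    refine Finset.sum_pos' (fun _ _ => sq_nonneg _) ⟨α, α.2, ?_⟩
    have h7 := (hn α).symm.trans h2
    have : n α = 2 := by exact_mod_cast h7
    simp [this]
  refine ⟨4 / ∑ β ∈ H.root, (n β : ℝ) ^ 2, by positivity, ?_⟩
  rw [Complex.ofReal_div, ← h4]
  push_cast
  field_simp

theorem killingLongRootSq_pos : 0 < killingLongRootSq H := by
  obtain ⟨α⟩ := exists_root H
  obtain ⟨x, hx, h⟩ := root_apply_dual_pos H α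
  refine lt_of_lt_of_le ?_ (le_ciSup (Set.finite_range _).bddAbove α)
  simpa [h] using hx

theorem normFactor_ne_zero : normFactor H ≠ 0 := by
  have := killingLongRootSq_pos H
  rw [normFactor, Complex.ofReal_ne_zero]
  positivity

theorem normForm_dualToCartan (lam : Module.Dual ℂ H) (h : H) :
    normForm H (dualToCartan H lam : 𝔤) (h : 𝔤) = lam h := by
  have h1 : killingForm ℂ 𝔤 ((IsKilling.cartanEquivDual H).symm lam : H) (h : 𝔤) = lam h := by
    conv_rhs => rw [← (IsKilling.cartanEquivDual H).apply_symm_apply lam]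
    rfl
  have := normFactor_ne_zero H
  simp only [normForm, dualToCartan, LinearMap.smul_apply, LinearEquiv.coe_coe,
    show ∀ (c : ℂ) (y : H), ((c • y : H) : 𝔤) = c • (y : 𝔤) from fun _ _ => rfl, map_smul,
    smul_eq_mul, h1]
  field_simp

theorem normForm_comm (x y : 𝔤) : normForm H x y = normForm H y x := by
  simp only [normForm, LinearMap.smul_apply]
  rw [traceForm_comm]

theorem normForm_root (α : Weight ℂ H 𝔤) (hα : α.IsNonZero) {a : 𝔤} (ha : a ∈ rootSpace H α) (h : H) :
    normForm H a (h : 𝔤) = 0 := by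
  have h0 : (h : 𝔤) ∈ rootSpace H (0 : H → ℂ) := by
    rw [rootSpace_zero_eq]; exact h.2
  have := killingForm_apply_eq_zero_of_mem_rootSpace_of_add_ne_zero ℂ 𝔤 H ha h0
    (by simpa using hα)
  simp [normForm, this]

theorem lie_root (α : Weight ℂ H 𝔤) {a : 𝔤} (ha : a ∈ rootSpace H α) (h : H) :
    ⁅(h : 𝔤), a⁆ = Weight.toLinear ℂ H 𝔤 α h • a :=
  IsKilling.lie_eq_smul_of_mem_rootSpace ha h

/-- The expansion of an element of the Cartan subalgebra along dual bases. -/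
theorem sum_normForm_dual_basis (h : H) :
    ∑ i, normForm H (dualToCartan H ((Module.finBasis ℂ H).coord i) : 𝔤) (h : 𝔤) •
      Module.finBasis ℂ H i = h := by
  simp only [normForm_dualToCartan, Module.Basis.coord_apply]
  exact (Module.finBasis ℂ H).sum_repr h

end NormalizedForm

/-! ### Modes of the affine Lie algebra on a vacuum module -/

section Modes

open LieAlgebra LieAlgebra.LoopAlgebra LieModule
open scoped TensorProduct Nat
open Finset.HasAntidiagonal

variable {𝔤 : Type*} [LieRing 𝔤] [LieAlgebra ℂ 𝔤] [FiniteDimensional ℂ 𝔤] [LieAlgebra.IsSimple ℂ 𝔤]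
variable (H : LieSubalgebra ℂ 𝔤) [H.IsCartanSubalgebra]

theorem loopElt_add (x y : 𝔤) (n : ℤ) : loopElt H (x + y) n = loopElt H x n + loopElt H y n := by
  simp only [loopElt, ← of_add, TensorProduct.tmul_add, Prod.mk_add_mk, add_zero]

theorem loopElt_smul (c : ℂ) (x : 𝔤) (n : ℤ) : loopElt H (c • x) n = c • loopElt H x n := by
  simp only [loopElt, ← of_smul, TensorProduct.tmul_smul, Prod.smul_mk, smul_zero]

variable (V : Type*) [AddCommGroup V] [Module ℂ V] [Module (UAffine H) V]
  [IsScalarTower ℂ (UAffine H) V]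

theorem modeOp_add (x y : 𝔤) (n : ℤ) : modeOp H V (x + y) n = modeOp H V x n + modeOp H V y n := by
  rw [modeOp, loopU, loopElt_add, map_add, map_add]; rfl

theorem modeOp_smul (c : ℂ) (x : 𝔤) (n : ℤ) : modeOp H V (c • x) n = c • modeOp H V x n := by
  rw [modeOp, loopU, loopElt_smul, map_smul, map_smul]; rfl

theorem modeOp_zero (n : ℤ) : modeOp H V 0 n = 0 := by
  simpa using modeOp_smul H V 0 0 n

theorem modeOp_neg (x : 𝔤) (n : ℤ) : modeOp H V (-x) n = -modeOp H V x n := by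
  simpa using modeOp_smul H V (-1) x n

variable {V}

/-- The properties of the modules `M(ℓ,0)` and `L(ℓ,0)` that the construction uses: the centre acts
by `ℓ`, fields are truncated, the module is generated by a vector `o` killed by all nonnegative
modes, and it carries a derivation `D` lowering the modes and killing `o`. -/
structure IsVacuumModule (ℓ : ℂ) (o : V) (D : Module.End ℂ V) : Prop where
  central : ∀ v : V, UniversalEnvelopingAlgebra.ι ℂ (centralElt H) • v = ℓ • v
  smooth : ∀ v : V, ∃ N : ℤ, ∀ (x : 𝔤) (n : ℤ), N ≤ n → modeOp H V x n v = 0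
  annihilates : ∀ (x : 𝔤) (n : ℤ), 0 ≤ n → modeOp H V x n o = 0
  cyclic : ∀ X : Submodule ℂ V, o ∈ X → (∀ x n, ∀ v ∈ X, modeOp H V x n v ∈ X) → X = ⊤
  der : ∀ (x : 𝔤) (n : ℤ) (v : V),
    D (modeOp H V x n v) = modeOp H V x n (D v) - (n : ℂ) • modeOp H V x (n - 1) v
  der_vac : D o = 0

variable {H} {ℓ : ℂ} {o : V} {D : Module.End ℂ V}

theorem modeOp_mul_of_central
    (hc : ∀ v : V, UniversalEnvelopingAlgebra.ι ℂ (centralElt H) • v = ℓ • v) (x y : 𝔤) (m n : ℤ) :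
    modeOp H V x m * modeOp H V y n = modeOp H V y n * modeOp H V x m +
      modeOp H V ⁅x, y⁆ (m + n) +
      ((m : ℂ) * normForm H x y * (if m + n = 0 then 1 else 0) * ℓ) • 1 := by
  have h := congrArg (UniversalEnvelopingAlgebra.ι ℂ) (lie_loopElt H x y m n)
  let _ := LieRing.ofAssociativeRing (A := UAffine H)
  let _ := LieAlgebra.ofAssociativeAlgebra (R := ℂ) (A := UAffine H)
  rw [LieHom.map_lie, map_add, map_smul] at h
  replace h := sub_eq_iff_eq_add.1 h
  have h' := congrArg (Algebra.lsmul ℂ ℂ V) h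
  rw [map_mul, map_add, map_add, map_mul, map_smul] at h'
  have hc : Algebra.lsmul ℂ ℂ V (UniversalEnvelopingAlgebra.ι ℂ (centralElt H)) = ℓ • 1 := by
    ext v; exact hc v
  rw [hc, smul_smul] at h'
  refine h'.trans ?_
  rw [add_comm, ← add_assoc]
  rfl

namespace IsVacuumModule

theorem modeOp_mul (hV : IsVacuumModule H ℓ o D) (x y : 𝔤) (m n : ℤ) :
    modeOp H V x m * modeOp H V y n = modeOp H V y n * modeOp H V x m +
      modeOp H V ⁅x, y⁆ (m + n) +
      ((m : ℂ) * normForm H x y * (if m + n = 0 then 1 else 0) * ℓ) • 1 :=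
  modeOp_mul_of_central hV.central x y m n

theorem modeOp_modeOp (hV : IsVacuumModule H ℓ o D) (x y : 𝔤) (m n : ℤ) (v : V) :
    modeOp H V x m (modeOp H V y n v) = modeOp H V y n (modeOp H V x m v) +
      modeOp H V ⁅x, y⁆ (m + n) v +
      ((m : ℂ) * normForm H x y * (if m + n = 0 then 1 else 0) * ℓ) • v :=
  congrArg (fun T : Module.End ℂ V => T v) (hV.modeOp_mul x y m n)

theorem cartan_mul (hV : IsVacuumModule H ℓ o D) (h h' : H) (m n : ℤ) :
    modeOp H V (h : 𝔤) m * modeOp H V (h' : 𝔤) n = modeOp H V (h' : 𝔤) n * modeOp H V (h : 𝔤) m +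
      ((m : ℂ) * normForm H (h : 𝔤) h' * (if m + n = 0 then 1 else 0) * ℓ) • 1 := by
  rw [hV.modeOp_mul, lie_cartan, modeOp_zero, add_zero]

theorem cartan_commute (hV : IsVacuumModule H ℓ o D) (h h' : H) {m n : ℤ} (hmn : m + n ≠ 0 ∨ m = 0) :
    Commute (modeOp H V (h : 𝔤) m) (modeOp H V (h' : 𝔤) n) := by
  rw [Commute, SemiconjBy, hV.cartan_mul]
  rcases hmn with hmn | rfl
  · simp [hmn]
  · simp

theorem cartan_mul_root (hV : IsVacuumModule H ℓ o D) (h : H) {α : Weight ℂ H 𝔤}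
    (hα : α.IsNonZero) {a : 𝔤} (ha : a ∈ rootSpace H α) (m n : ℤ) :
    modeOp H V (h : 𝔤) m * modeOp H V a n = modeOp H V a n * modeOp H V (h : 𝔤) m +
      (Weight.toLinear ℂ H 𝔤 α h) • modeOp H V a (m + n) := by
  rw [hV.modeOp_mul, lie_root H α ha, modeOp_smul, normForm_comm, normForm_root H α hα ha]
  simp

theorem cartan_root (hV : IsVacuumModule H ℓ o D) (h : H) {α : Weight ℂ H 𝔤}
    (hα : α.IsNonZero) {a : 𝔤} (ha : a ∈ rootSpace H α) (m n : ℤ) (v : V) :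
    modeOp H V (h : 𝔤) m (modeOp H V a n v) = modeOp H V a n (modeOp H V (h : 𝔤) m v) +
      (Weight.toLinear ℂ H 𝔤 α h) • modeOp H V a (m + n) v := by
  simpa using congrArg (fun T : Module.End ℂ V => T v) (hV.cartan_mul_root h hα ha m n)

variable (H V) in
/-- The series `-∑ h(-k-1) z^k`, the logarithmic derivative of `E⁻(h,z)`. -/
def negModes (h : H) : PowerSeries (Module.End ℂ V) :=
  PowerSeries.mk fun k : ℕ => -modeOp H V (h : 𝔤) (-(k : ℤ) - 1)

variable (H V) in
theorem coeff_negModes (h : H) (k : ℕ) :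
    PowerSeries.coeff k (negModes H V h) = -modeOp H V (h : 𝔤) (-(k : ℤ) - 1) := by
  simp [negModes]

theorem psDeriv_EMinus (hV : IsVacuumModule H ℓ o D) (h : H) :
    psDeriv (EMinus H V h) = negModes H V h * EMinus H V h := by
  set f : PowerSeries (Module.End ℂ V) := PowerSeries.mk fun n : ℕ =>
    if n = 0 then 0 else (-(n : ℂ))⁻¹ • modeOp H V (h : 𝔤) (-n) with hf
  have h1 : psDeriv f = negModes H V h := by
    ext1 n
    rw [coeff_psDeriv, coeff_negModes, hf, PowerSeries.coeff_mk, if_neg (Nat.succ_ne_zero n),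
      smul_smul]
    have : (n : ℂ) + 1 ≠ 0 := by exact_mod_cast Nat.succ_ne_zero n
    push_cast
    rw [inv_neg, mul_neg, mul_inv_cancel₀ this, neg_one_smul, neg_add]
    rfl
  have h2 := psDeriv_expSeries (f := f) (by simp [hf]) (by
    rw [h1]
    refine commute_of_coeff fun i j => ?_
    rw [coeff_negModes, hf, PowerSeries.coeff_mk]
    split_ifs
    · exact Commute.zero_left _
    · exact ((hV.cartan_commute h h (Or.inl (by omega))).smul_left _).neg_right)
  rw [h1] at h2
  exact h2

theorem expPair_EMinus (hV : IsVacuumModule H ℓ o D) (h : H) :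
    ExpPair (negModes H V h) (EMinus H V h) (EMinus H V (-h)) where
  comm i j := by
    rw [coeff_negModes, coeff_negModes]
    exact ((hV.cartan_commute h h (Or.inl (by omega))).neg_left).neg_right
  deriv := hV.psDeriv_EMinus h
  deriv' := by
    have : negModes H V (-h) = -negModes H V h := by
      ext1 n
      rw [map_neg, coeff_negModes, coeff_negModes, ← modeOp_neg]
      simp
    rw [hV.psDeriv_EMinus, this]
  zero := coeff_zero_expSeries _
  zero' := coeff_zero_expSeries _

/-- `E⁺` acts as the identity on the vacuum space. -/
theorem coeff_EPlus_apply (h : H) {w : V}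
    (hw : ∀ n : ℤ, 1 ≤ n → modeOp H V (h : 𝔤) n w = 0) (j : ℕ) :
    PowerSeries.coeff j (EPlus H V h) w = if j = 0 then w else 0 := by
  set f : PowerSeries (Module.End ℂ V) := PowerSeries.mk fun n : ℕ =>
    if n = 0 then 0 else (n : ℂ)⁻¹ • modeOp H V (h : 𝔤) n with hf
  have h1 : ∀ r k, (PowerSeries.coeff k (f ^ (r + 1)) : Module.End ℂ V) w = 0 := by
    intro r k
    rw [pow_succ, PowerSeries.coeff_mul, LinearMap.sum_apply]
    refine Finset.sum_eq_zero fun p _ => ?_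
    rw [Module.End.mul_apply, hf, PowerSeries.coeff_mk]
    split_ifs with h0
    · simp
    · rw [LinearMap.smul_apply, hw _ (by omega), smul_zero, map_zero]
  change PowerSeries.coeff j (expSeries f) w = _
  rw [expSeries, PowerSeries.coeff_mk, Finset.sum_range_succ', LinearMap.add_apply,
    LinearMap.sum_apply, Finset.sum_eq_zero fun r _ => by rw [LinearMap.smul_apply, h1, smul_zero]]
  rw [pow_zero, PowerSeries.coeff_one]
  split_ifs <;> simp

/-- The conjugate `E⁻(-h,z) T E⁻(h,z)`. -/
abbrev conj (h : H) (T : Module.End ℂ V) (j : ℕ) : Module.End ℂ V :=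
  PowerSeries.coeff j (EMinus H V (-h) * PowerSeries.C T * EMinus H V h)

theorem conj_scalar (hV : IsVacuumModule H ℓ o D) (h : H) (c : ℂ) (j : ℕ) :
    conj h (c • (1 : Module.End ℂ V)) j = if j = 0 then c • 1 else 0 :=
  (hV.expPair_EMinus h).coeff_conj_of_commute (fun _ => (Commute.one_left _).smul_left c) j

/-- Conjugation by `E⁻(h,z)` translates `h'(m)`, `m ≥ 1`, by a multiple of `z^m`. -/
theorem conj_cartan (hV : IsVacuumModule H ℓ o D) (h h' : H) {m : ℕ} (hm : 1 ≤ m) (j : ℕ) :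
    conj h (modeOp H V (h' : 𝔤) m) j = if j = 0 then modeOp H V (h' : 𝔤) m else
      if j = m then (-(normForm H (h' : 𝔤) h * ℓ)) • 1 else 0 := by
  cases j with
  | zero => rw [if_pos rfl]; exact (hV.expPair_EMinus h).coeff_zero_conj _
  | succ j =>
    have h1 := (hV.expPair_EMinus h).conj_rec (modeOp H V (h' : 𝔤) m) j
    have h2 : ∀ p ∈ antidiagonal j, PowerSeries.coeff p.2 (EMinus H V (-h) * PowerSeries.C
        (modeOp H V (h' : 𝔤) m * PowerSeries.coeff p.1 (negModes H V h) -
          PowerSeries.coeff p.1 (negModes H V h) * modeOp H V (h' : 𝔤) m) * EMinus H V h) =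
        if p.2 = 0 then
          (-((m : ℂ) * normForm H (h' : 𝔤) h * (if p.1 + 1 = m then 1 else 0) * ℓ)) • 1 else 0 := by
      intro p _
      rw [← hV.conj_scalar h]
      unfold conj
      congr 4
      rw [coeff_negModes, mul_neg, neg_mul, hV.cartan_mul]
      have : ((m : ℤ) + (-(p.1 : ℤ) - 1) = 0) = (p.1 + 1 = m) := by
        rw [eq_iff_iff]; omega
      simp only [this]
      push_cast
      module
    rw [Finset.sum_congr rfl h2, Finset.sum_eq_single (j, 0)] at h1
    · have hj : (j : ℂ) + 1 ≠ 0 := by exact_mod_cast Nat.succ_ne_zero j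
      rw [if_neg (Nat.succ_ne_zero j)]
      refine smul_right_injective _ hj (h1.trans ?_)
      rw [if_pos rfl]
      beta_reduce
      split_ifs with h3
      · subst h3
        push_cast
        module
      · simp
    · rintro ⟨a, b⟩ hp hne
      rw [if_neg]
      rintro h0
      simp only [mem_antidiagonal] at hp h0
      subst h0
      exact hne (by simpa using hp)
    · simp

theorem cartan_coeff_EMinus (hV : IsVacuumModule H ℓ o D) (h h' : H) {m : ℕ} (hm : 1 ≤ m) (n : ℕ) :
    modeOp H V (h' : 𝔤) m * PowerSeries.coeff n (EMinus H V h) =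
      PowerSeries.coeff n (EMinus H V h) * modeOp H V (h' : 𝔤) m -
        if m ≤ n then (normForm H (h' : 𝔤) h * ℓ) • PowerSeries.coeff (n - m) (EMinus H V h)
        else 0 := by
  rw [(hV.expPair_EMinus h).mul_coeff]
  have h1 : ∀ p ∈ antidiagonal n, PowerSeries.coeff p.1 (EMinus H V h) *
      PowerSeries.coeff p.2 (EMinus H V (-h) * PowerSeries.C (modeOp H V (h' : 𝔤) m) * EMinus H V h) =
      (if p.2 = 0 then PowerSeries.coeff n (EMinus H V h) * modeOp H V (h' : 𝔤) m else 0) +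
      (if p.2 = m then (-(normForm H (h' : 𝔤) h * ℓ)) • PowerSeries.coeff (n - m) (EMinus H V h)
        else 0) := by
    rintro ⟨a, b⟩ hp
    have hp' := mem_antidiagonal.1 hp
    simp only at hp' ⊢
    rw [show PowerSeries.coeff b _ = _ from hV.conj_cartan h h' hm b]
    by_cases hb : b = 0
    · subst hb
      obtain rfl : a = n := by omega
      simp [show 0 ≠ m by omega]
    · by_cases hbm : b = m
      · subst hbm
        obtain rfl : a = n - b := by omega
        simp [hb]
      · simp [hb, hbm]
  rw [Finset.sum_congr rfl h1, Finset.sum_add_distrib, sub_eq_add_neg]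
  congr 1
  · rw [Finset.sum_eq_single (n, 0)]
    · simp
    · rintro ⟨a, b⟩ hp hne
      rw [if_neg]
      rintro h0
      simp only [mem_antidiagonal] at hp h0
      subst h0
      exact hne (by simpa using hp)
    · simp
  · split_ifs with hmn
    · rw [Finset.sum_eq_single (n - m, m)]
      · simp
      · rintro ⟨a, b⟩ hp hne
        rw [if_neg]
        rintro h0
        simp only [mem_antidiagonal] at hp h0
        subst h0
        exact hne (by ext <;> simp; omega)
      · intro hp
        exact absurd (mem_antidiagonal.2 (by simp; omega)) hp
    · rw [neg_zero]
      refine Finset.sum_eq_zero fun p hp => if_neg ?_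
      have := mem_antidiagonal.1 hp
      omega

theorem succ_mul_coeff_oneSubPow (r : ℂ) (j : ℕ) :
    ((j : ℂ) + 1) * PowerSeries.coeff (j + 1) (oneSubPow (-r)) =
      ∑ p ∈ antidiagonal j, r * PowerSeries.coeff p.2 (oneSubPow (-r)) := by
  have h1 : ∀ i, PowerSeries.coeff i (oneSubPow (-1)) = 1 := by
    intro i
    have := choose_neg_one_sub 0 i
    rw [Nat.cast_zero, sub_zero] at this
    rw [coeff_oneSubPow, this, ← mul_assoc, ← pow_add, ← two_mul, pow_mul]
    simp
  have h2 : ∑ p ∈ antidiagonal j, PowerSeries.coeff p.2 (oneSubPow (-r)) =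
      PowerSeries.coeff j (oneSubPow (-r - 1)) := by
    rw [sub_eq_neg_add, oneSubPow_add, PowerSeries.coeff_mul]
    simp [h1]
  rw [← Finset.mul_sum, h2, coeff_oneSubPow, coeff_oneSubPow, pow_succ]
  linear_combination (-(-1) ^ j) * succ_mul_choose_succ' (-r) j

/-- Conjugation by `E⁻(h,z)` multiplies the field `b(w)` by the factor `(1 - z/w)^{-β(h)}`. -/
theorem conj_root (hV : IsVacuumModule H ℓ o D) (h : H) {β : Weight ℂ H 𝔤}
    (hβ : β.IsNonZero) {b : 𝔤} (hb : b ∈ rootSpace H β) (n : ℤ) (j : ℕ) :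
    conj h (modeOp H V b n) j =
      PowerSeries.coeff j (oneSubPow (-(Weight.toLinear ℂ H 𝔤 β h))) • modeOp H V b (n - j) := by
  induction j using Nat.strong_induction_on generalizing n with
  | _ j ih =>
  cases j with
  | zero =>
    have := (hV.expPair_EMinus h).coeff_zero_conj (modeOp H V b n)
    refine this.trans ?_
    simp [coeff_oneSubPow]
  | succ j =>
    have h1 := (hV.expPair_EMinus h).conj_rec (modeOp H V b n) j
    have h2 : ∀ p ∈ antidiagonal j, PowerSeries.coeff p.2 (EMinus H V (-h) * PowerSeries.C
        (modeOp H V b n * PowerSeries.coeff p.1 (negModes H V h) -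
          PowerSeries.coeff p.1 (negModes H V h) * modeOp H V b n) * EMinus H V h) =
        (Weight.toLinear ℂ H 𝔤 β h * PowerSeries.coeff p.2
          (oneSubPow (-(Weight.toLinear ℂ H 𝔤 β h)))) • modeOp H V b (n - (j + 1 : ℕ)) := by
      intro p hp
      have hp' := mem_antidiagonal.1 hp
      have h3 : modeOp H V b n * PowerSeries.coeff p.1 (negModes H V h) -
          PowerSeries.coeff p.1 (negModes H V h) * modeOp H V b n =
          Weight.toLinear ℂ H 𝔤 β h • modeOp H V b (n - p.1 - 1) := by
        rw [coeff_negModes, mul_neg, neg_mul, hV.cartan_mul_root h hβ hb,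
          show -(p.1 : ℤ) - 1 + n = n - p.1 - 1 by ring]
        abel
      have h4 : ∀ (c : ℂ) (T : Module.End ℂ V), PowerSeries.coeff p.2 (EMinus H V (-h) *
          PowerSeries.C (c • T) * EMinus H V h) = c • conj h T p.2 := by
        intro c T
        have : PowerSeries.C (c • T) = c • PowerSeries.C T := by
          ext1 i
          change _ = c • PowerSeries.coeff i (PowerSeries.C T)
          rw [PowerSeries.coeff_C, PowerSeries.coeff_C]
          split_ifs <;> simp
        rw [this, mul_smul_comm, smul_mul_assoc]
        rfl
      rw [h3, h4, ih p.2 (by omega), smul_smul]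
      congr 2
      push_cast [← hp']
      ring
    rw [Finset.sum_congr rfl h2, ← Finset.sum_smul, ← succ_mul_coeff_oneSubPow, mul_smul] at h1
    exact smul_right_injective _ (by exact_mod_cast Nat.succ_ne_zero j) h1

/-- The commutation of a root vector field past `E⁻`. -/
theorem root_coeff_EMinus (hV : IsVacuumModule H ℓ o D) (h : H) {β : Weight ℂ H 𝔤}
    (hβ : β.IsNonZero) {b : 𝔤} (hb : b ∈ rootSpace H β) (n : ℤ) (j : ℕ) :
    modeOp H V b n * PowerSeries.coeff j (EMinus H V h) = ∑ p ∈ antidiagonal j,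
      PowerSeries.coeff p.2 (oneSubPow (-(Weight.toLinear ℂ H 𝔤 β h))) •
        (PowerSeries.coeff p.1 (EMinus H V h) * modeOp H V b (n - p.2)) := by
  rw [(hV.expPair_EMinus h).mul_coeff]
  refine Finset.sum_congr rfl fun p _ => ?_
  rw [show PowerSeries.coeff p.2 _ = _ from hV.conj_root h hβ hb n p.2, mul_smul_comm]

theorem conj_der (hV : IsVacuumModule H ℓ o D) (h : H) (j : ℕ) :
    conj h D (j + 1) = -modeOp H V (h : 𝔤) (-(j : ℤ) - 2) := by
  have h1 := (hV.expPair_EMinus h).conj_rec D j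
  have h2 : ∀ p ∈ antidiagonal j, PowerSeries.coeff p.2 (EMinus H V (-h) * PowerSeries.C
      (D * PowerSeries.coeff p.1 (negModes H V h) -
        PowerSeries.coeff p.1 (negModes H V h) * D) * EMinus H V h) =
      if p.2 = 0 then (-((p.1 : ℂ) + 1)) • modeOp H V (h : 𝔤) (-(p.1 : ℤ) - 2) else 0 := by
    intro p _
    rw [← (hV.expPair_EMinus h).coeff_conj_of_commute]
    · congr 4
      ext v
      rw [coeff_negModes]
      simp only [LinearMap.sub_apply, Module.End.mul_apply, LinearMap.neg_apply, map_neg, hV.der,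
        LinearMap.smul_apply]
      rw [show -(p.1 : ℤ) - 1 - 1 = -(p.1 : ℤ) - 2 by ring]
      push_cast
      module
    · intro k
      rw [coeff_negModes]
      exact ((hV.cartan_commute h h (Or.inl (by omega))).neg_right).smul_left _
  rw [Finset.sum_congr rfl h2, Finset.sum_eq_single (j, 0)] at h1
  · have hj : (j : ℂ) + 1 ≠ 0 := by exact_mod_cast Nat.succ_ne_zero j
    refine smul_right_injective _ hj (h1.trans ?_)
    rw [if_pos rfl]
    beta_reduce
    module
  · rintro ⟨a, b⟩ hp hne
    rw [if_neg]
    rintro h0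
    simp only [mem_antidiagonal] at hp h0
    subst h0
    exact hne (by simpa using hp)
  · simp

theorem succ_smul_coeff_EMinus (hV : IsVacuumModule H ℓ o D) (h : H) (n : ℕ) :
    ((n : ℂ) + 1) • PowerSeries.coeff (n + 1) (EMinus H V h) = -∑ p ∈ antidiagonal n,
      PowerSeries.coeff p.1 (EMinus H V h) * modeOp H V (h : 𝔤) (-(p.2 : ℤ) - 1) := by
  rw [← coeff_psDeriv, hV.psDeriv_EMinus, (hV.expPair_EMinus h).commute.eq, PowerSeries.coeff_mul,
    ← Finset.sum_neg_distrib]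
  refine Finset.sum_congr rfl fun p _ => ?_
  rw [coeff_negModes, mul_neg]

theorem cartan_commute_coeff_EMinus (hV : IsVacuumModule H ℓ o D) (h h' : H) {m : ℤ} (hm : m ≤ 0)
    (n : ℕ) : Commute (modeOp H V (h' : 𝔤) m) (PowerSeries.coeff n (EMinus H V h)) := by
  refine commute_coeff_of_ode (hV.expPair_EMinus h).deriv (hV.expPair_EMinus h).zero (fun k => ?_) n
  rw [coeff_negModes]
  exact (hV.cartan_commute h' h (Or.inl (by omega))).neg_right

theorem commute_coeff_EMinus (hV : IsVacuumModule H ℓ o D) (h h' : H) (i j : ℕ) :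
    Commute (PowerSeries.coeff i (EMinus H V h)) (PowerSeries.coeff j (EMinus H V h')) := by
  refine commute_coeff_of_ode (hV.expPair_EMinus h').deriv (hV.expPair_EMinus h').zero
    (fun k => ?_) j
  rw [coeff_negModes]
  exact ((hV.cartan_commute_coeff_EMinus h h' (by omega) i).neg_left).symm

/-- `[D, E⁻(h,z)] = d/dz E⁻(h,z) + h(-1) E⁻(h,z)`. -/
theorem der_coeff_EMinus (hV : IsVacuumModule H ℓ o D) (h : H) (n : ℕ) :
    D * PowerSeries.coeff n (EMinus H V h) = PowerSeries.coeff n (EMinus H V h) * D +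
      ((n : ℂ) + 1) • PowerSeries.coeff (n + 1) (EMinus H V h) +
      modeOp H V (h : 𝔤) (-1) * PowerSeries.coeff n (EMinus H V h) := by
  rw [(hV.expPair_EMinus h).mul_coeff, hV.succ_smul_coeff_EMinus,
    (hV.cartan_commute_coeff_EMinus h h (by omega) n).eq]
  cases n with
  | zero =>
    simp only [Finset.Nat.antidiagonal_zero, Finset.sum_singleton]
    rw [(hV.expPair_EMinus h).coeff_zero_conj]
    simp
  | succ n =>
    rw [Finset.Nat.sum_antidiagonal_succ', Finset.Nat.sum_antidiagonal_succ']
    rw [(hV.expPair_EMinus h).coeff_zero_conj]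
    have h1 : ∀ p ∈ antidiagonal n, PowerSeries.coeff p.1 (EMinus H V h) *
        PowerSeries.coeff (p.2 + 1) (EMinus H V (-h) * PowerSeries.C D * EMinus H V h) =
        -(PowerSeries.coeff p.1 (EMinus H V h) *
          modeOp H V (h : 𝔤) (-((p.2 + 1 : ℕ) : ℤ) - 1)) := by
      intro p _
      rw [show PowerSeries.coeff (p.2 + 1) _ = _ from hV.conj_der h p.2, mul_neg]
      congr 3
      push_cast
      ring
    rw [Finset.sum_congr rfl h1, Finset.sum_neg_distrib]
    simp
    abel

end IsVacuumModule

end Modes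

/-! ### Series of operators acting on formal distributions -/

section OpAct

variable {W : Type*} [AddCommGroup W] [Module ℂ W] {I : Type*} [AddCommGroup I]

theorem map_finsum_of_finite {W' α : Type*} [AddCommGroup W'] [Module ℂ W'] (L : W →ₗ[ℂ] W')
    {f : α → W} (h : {a | f a ≠ 0}.Finite) : L (∑ᶠ a, f a) = ∑ᶠ a, L (f a) :=
  AddMonoidHom.map_finsum L.toAddMonoidHom h

/-- The action of an operator-valued power series `∑ e i X^i` on a family `T : I → W`, where `X`
acts by the translation of the index by `δ`. -/
def opAct (e : ℕ → Module.End ℂ W) (δ : I) (T : I → W) (γ : I) : W :=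
  ∑ᶠ i : ℕ, e i (T (γ + i • δ))

theorem opAct_ne_zero {e : ℕ → Module.End ℂ W} {δ : I} {T : I → W} {γ : I}
    (h : opAct e δ T γ ≠ 0) : ∃ i : ℕ, T (γ + i • δ) ≠ 0 := by
  by_contra! h0
  exact h (by simp [opAct, h0])

theorem act_eq_opAct (p : PowerSeries ℂ) (δ : I) (T : I → W) :
    act p δ T = opAct (fun i => PowerSeries.coeff i p • 1) δ T := by
  funext γ
  simp [act, opAct]

theorem Summable₃.opAct {a b c : I} {T : I → W} (h : Summable₃ a b c T)
    (e : ℕ → Module.End ℂ W) : Summable₂ a b (opAct e c T) := by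
  intro γ
  refine ((h γ).image fun e => (e.1, e.2.1)).subset fun e he => ?_
  obtain ⟨i, hi⟩ := opAct_ne_zero he
  exact ⟨(e.1, e.2, i), hi, rfl⟩

theorem Summable₂.opAct {a b : I} {T : I → W} (h : Summable₂ a b T) (e : ℕ → Module.End ℂ W) :
    Summable₁ a (opAct e b T) := by
  intro γ
  refine ((h γ).image fun e => e.1).subset fun e he => ?_
  obtain ⟨i, hi⟩ := opAct_ne_zero he
  exact ⟨(e, i), hi, rfl⟩

theorem opAct_opAct {a b : I} {T : I → W} (h : Summable₂ a b T) (e f : ℕ → Module.End ℂ W) (γ : I) :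
    opAct e a (opAct f b T) γ = ∑ᶠ i : ℕ, ∑ᶠ j : ℕ, e i (f j (T (γ + i • a + j • b))) := by
  unfold opAct
  refine finsum_congr fun i => map_finsum_of_finite _ ?_
  refine (h.right (γ + i • a)).subset fun j hj h0 => hj ?_
  rw [h0, map_zero]

theorem opAct_comm {a b : I} {T : I → W} (h : Summable₂ a b T) {e f : ℕ → Module.End ℂ W}
    (hef : ∀ i j, Commute (e i) (f j)) :
    opAct e a (opAct f b T) = opAct f b (opAct e a T) := by
  funext γ
  rw [opAct_opAct h, opAct_opAct h.symm, finsum_comm_of_finite]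
  · refine finsum_congr fun i => finsum_congr fun j => ?_
    rw [add_right_comm, ← Module.End.mul_apply, (hef j i).eq, Module.End.mul_apply]
  · refine (h γ).subset fun e he h0 => he ?_
    simp only [h0, map_zero]

theorem opAct_act {a b : I} {T : I → W} (h : Summable₂ a b T) (e : ℕ → Module.End ℂ W)
    (p : PowerSeries ℂ) : opAct e a (act p b T) = act p b (opAct e a T) := by
  rw [act_eq_opAct, act_eq_opAct, opAct_comm h]
  exact fun i j => (Commute.one_right _).smul_right _

theorem opAct_opAct_act {a b c : I} {T : I → W} (h : Summable₃ a b c T)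
    (e f : ℕ → Module.End ℂ W) (p : PowerSeries ℂ) :
    opAct e a (opAct f b (act p c T)) = act p c (opAct e a (opAct f b T)) := by
  rw [opAct_act h.rotate.left, opAct_act (h.rotate.rotate.opAct f).symm]

theorem opAct_translate (e : ℕ → Module.End ℂ W) (a τ : I) (T : I → W) (γ : I) :
    opAct e a T (γ + τ) = opAct e a (fun x => T (x + τ)) γ := by
  unfold opAct
  refine finsum_congr fun i => ?_
  rw [add_right_comm]

theorem opAct_swap (e : ℕ → Module.End ℂ W) (a : ℤ × ℤ) (T : ℤ × ℤ → W) (γ : ℤ × ℤ) :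
    opAct e a T γ.swap = opAct e a.swap (fun p => T p.swap) γ := by
  unfold opAct
  refine finsum_congr fun i => ?_
  rfl

theorem act_swap (p : PowerSeries ℂ) (a : ℤ × ℤ) (T : ℤ × ℤ → W) (γ : ℤ × ℤ) :
    act p a T γ.swap = act p a.swap (fun p => T p.swap) γ := by
  rw [act_eq_opAct, act_eq_opAct, opAct_swap]

theorem Summable₃.swap {a b c : ℤ × ℤ} {T : ℤ × ℤ → W} (h : Summable₃ a b c T) :
    Summable₃ a.swap b.swap c.swap fun p => T p.swap := fun γ => h γ.swap

theorem summable₃_of_bddSnd {T : ℤ × ℤ → W} (h : BddSnd T)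
    (h' : ∀ k, ∃ M : ℤ, ∀ m, M ≤ m → T (m, k) = 0) : Summable₃ (1, 0) (0, 1) (-1, 1) T := by
  obtain ⟨K, hK⟩ := h
  choose M hM using h'
  rintro ⟨m, k⟩
  refine ((Finset.range (K - k).toNat ×ˢ Finset.range (K - k).toNat).biUnion fun q =>
    (Finset.range (M (k + q.1 + q.2) - m + q.2).toNat).image fun i =>
      (i, q)).finite_toSet.subset ?_
  rintro ⟨i, j, t⟩ hne
  have e : ((m, k) : ℤ × ℤ) + i • ((1, 0) : ℤ × ℤ) + j • ((0, 1) : ℤ × ℤ) + t • ((-1, 1) : ℤ × ℤ) =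
      (m + i - t, k + j + t) := by
    ext
    · simp; ring
    · simp
  simp only [Set.mem_ofPred_eq, e] at hne
  have h1 : k + j + t < K := by
    by_contra h0
    exact hne (hK _ _ (by omega))
  have h2 : m + i - t < M (k + j + t) := by
    by_contra h0
    exact hne (hM _ _ (by omega))
  simp only [Finset.coe_biUnion, Set.mem_iUnion, Finset.mem_coe, Finset.mem_image, Finset.mem_range,
    Finset.mem_product]
  exact ⟨(j, t), ⟨by omega, by omega⟩, i, by simp only; omega, rfl⟩

end OpAct

/-! ### The operators `ψ(a,z)` -/

section Psi

open LieAlgebra LieAlgebra.LoopAlgebra LieModule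
open scoped TensorProduct Nat
open Finset.HasAntidiagonal

variable {𝔤 : Type*} [LieRing 𝔤] [LieAlgebra ℂ 𝔤] [FiniteDimensional ℂ 𝔤] [LieAlgebra.IsSimple ℂ 𝔤]
variable {H : LieSubalgebra ℂ 𝔤} [H.IsCartanSubalgebra]
variable {V : Type*} [AddCommGroup V] [Module ℂ V] [Module (UAffine H) V]
  [IsScalarTower ℂ (UAffine H) V]
variable {ℓ : ℂ} {o : V} {D : Module.End ℂ V}

namespace IsVacuumModule

theorem finite_modes (hV : IsVacuumModule H ℓ o D) (a : 𝔤) (n : ℤ) (v : V) :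
    {i : ℕ | modeOp H V a (n + i) v ≠ 0}.Finite := by
  obtain ⟨N, hN⟩ := hV.smooth v
  refine (Set.finite_Iio (N - n).toNat).subset fun i hi => ?_
  by_contra h0
  simp only [Set.mem_Iio, not_lt, Int.toNat_le] at h0
  exact hi (hN a _ (by omega))

theorem finite_EMinus_modes (hV : IsVacuumModule H ℓ o D) (h : H) (a : 𝔤) (n : ℤ) (v : V) :
    {i : ℕ | PowerSeries.coeff i (EMinus H V h) (modeOp H V a (n + i) v) ≠ 0}.Finite :=
  (hV.finite_modes a n v).subset fun i hi h0 => hi (by rw [h0, map_zero])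

/-- The coefficient of `z^{-n-1}` in `E⁻(h,z) a(z)`. On the vacuum space, for `a` in the root space
of `α` and `h = α/ℓ`, these are the coefficients of `ψ(a,z)`. -/
def psiOp (hV : IsVacuumModule H ℓ o D) (h : H) (a : 𝔤) (n : ℤ) : Module.End ℂ V :=
  finsumLM (fun i : ℕ => PowerSeries.coeff i (EMinus H V h) * modeOp H V a (n + i))
    (hV.finite_EMinus_modes h a n)

theorem psiOp_apply (hV : IsVacuumModule H ℓ o D) (h : H) (a : 𝔤) (n : ℤ) (v : V) :
    hV.psiOp h a n v = ∑ᶠ i : ℕ, PowerSeries.coeff i (EMinus H V h) (modeOp H V a (n + i) v) := rfl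

theorem psiOp_eq_zero (hV : IsVacuumModule H ℓ o D) (h : H) {a : 𝔤} {n : ℤ} {v : V}
    (hv : ∀ m, n ≤ m → modeOp H V a m v = 0) : hV.psiOp h a n v = 0 := by
  rw [psiOp_apply]
  exact finsum_eq_zero_of_forall_eq_zero fun i => by rw [hv _ (by omega), map_zero]

theorem psiOp_truncated (hV : IsVacuumModule H ℓ o D) (h : H) (a : 𝔤) :
    Truncated (hV.psiOp h a) := by
  intro v
  obtain ⟨N, hN⟩ := hV.smooth v
  exact ⟨N, fun n hn => hV.psiOp_eq_zero h fun m hm => hN a m (by omega)⟩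

theorem modeOp_truncated (hV : IsVacuumModule H ℓ o D) (a : 𝔤) : Truncated (modeOp H V a) := by
  intro v
  obtain ⟨N, hN⟩ := hV.smooth v
  exact ⟨N, fun n hn => hN a n hn⟩

theorem psiOp_vac (hV : IsVacuumModule H ℓ o D) (h : H) (a : 𝔤) {n : ℤ} (hn : 0 ≤ n) :
    hV.psiOp h a n o = 0 :=
  hV.psiOp_eq_zero h fun m hm => hV.annihilates a m (by omega)

theorem psiOp_neg_one_vac (hV : IsVacuumModule H ℓ o D) (h : H) (a : 𝔤) :
    hV.psiOp h a (-1) o = modeOp H V a (-1) o := by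
  rw [psiOp_apply, finsum_eq_single _ 0]
  · rw [(hV.expPair_EMinus h).zero]; simp
  · intro i hi
    rw [hV.annihilates a _ (by omega), map_zero]

/-- The operators `ψ(a,z)` commute with the annihilation part of the Heisenberg algebra. -/
theorem cartan_pos_psiOp (hV : IsVacuumModule H ℓ o D) (hℓ : ℓ ≠ 0) (h' : H) {α : Weight ℂ H 𝔤}
    (hα : α.IsNonZero) {a : 𝔤} (ha : a ∈ rootSpace H α) {m : ℕ} (hm : 1 ≤ m) (n : ℤ) (v : V) :
    modeOp H V (h' : 𝔤) m (hV.psiOp (ℓ⁻¹ • dualToCartan H (Weight.toLinear ℂ H 𝔤 α)) a n v) =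
      hV.psiOp (ℓ⁻¹ • dualToCartan H (Weight.toLinear ℂ H 𝔤 α)) a n
        (modeOp H V (h' : 𝔤) m v) := by
  set h : H := ℓ⁻¹ • dualToCartan H (Weight.toLinear ℂ H 𝔤 α) with hh
  have hn : normForm H (h' : 𝔤) h * ℓ = Weight.toLinear ℂ H 𝔤 α h' := by
    rw [hh, show ((ℓ⁻¹ • dualToCartan H (Weight.toLinear ℂ H 𝔤 α) : H) : 𝔤) =
      ℓ⁻¹ • (dualToCartan H (Weight.toLinear ℂ H 𝔤 α) : 𝔤) from rfl, map_smul, normForm_comm,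
      normForm_dualToCartan, smul_eq_mul]
    field_simp
  have h1 : ∀ i : ℕ, modeOp H V (h' : 𝔤) m (PowerSeries.coeff i (EMinus H V h)
      (modeOp H V a (n + i) v)) =
      PowerSeries.coeff i (EMinus H V h) (modeOp H V a (n + i) (modeOp H V (h' : 𝔤) m v)) +
      Weight.toLinear ℂ H 𝔤 α h' •
        (PowerSeries.coeff i (EMinus H V h) (modeOp H V a (n + m + i) v) -
        if m ≤ i then PowerSeries.coeff (i - m) (EMinus H V h) (modeOp H V a (n + i) v) else 0) := by
    intro i
    have h2 := congrArg (fun T : Module.End ℂ V => T (modeOp H V a (n + i) v))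
      (hV.cartan_coeff_EMinus h h' hm i)
    rw [hn] at h2
    refine h2.trans ?_
    rw [LinearMap.sub_apply, Module.End.mul_apply, hV.cartan_root h' hα ha, map_add, map_smul,
      show (m : ℤ) + (n + i) = n + m + i by ring]
    split_ifs
    · rw [LinearMap.smul_apply]; module
    · rw [LinearMap.zero_apply]; module
  have hf1 := hV.finite_EMinus_modes h a n v
  have hf2 := hV.finite_EMinus_modes h a n (modeOp H V (h' : 𝔤) m v)
  have hf3 := hV.finite_EMinus_modes h a (n + m) v
  have hf4 : {i : ℕ | (if m ≤ i then PowerSeries.coeff (i - m) (EMinus H V h)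
      (modeOp H V a (n + i) v) else 0) ≠ 0}.Finite := by
    refine (hV.finite_modes a n v).subset fun i hi h0 => hi ?_
    split_ifs
    · rw [h0, map_zero]
    · rfl
  rw [psiOp_apply, map_finsum_of_finite _ hf1, finsum_congr h1, finsum_add_distrib hf2, psiOp_apply,
    ← smul_finsum_of_field, finsum_sub_distrib hf3 hf4, sub_eq_zero.2, smul_zero, add_zero]
  · refine Eq.trans ?_ (finsum_comp_of_injective (add_left_injective m) ?_)
    · refine finsum_congr fun i => ?_
      simp only [le_add_iff_nonneg_left, zero_le, if_true, Nat.add_sub_cancel]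
      rw [show n + m + (i : ℤ) = n + (i + m : ℕ) by push_cast; ring]
    · intro i hi
      by_contra h0
      refine hi (if_neg fun hmi => h0 ⟨i - m, ?_⟩)
      simp only
      omega
  · refine hf3.union hf4 |>.subset fun i hi => ?_
    by_contra h0
    simp only [Set.mem_union, Set.mem_ofPred_eq, not_or, not_not] at h0
    refine hi ?_
    beta_reduce
    rw [h0.2, sub_zero, h0.1, smul_zero]

theorem cartan_nonpos_psiOp (hV : IsVacuumModule H ℓ o D) (h h' : H) {α : Weight ℂ H 𝔤}
    (hα : α.IsNonZero) {a : 𝔤} (ha : a ∈ rootSpace H α) {m : ℤ} (hm : m ≤ 0) (n : ℤ) (v : V) :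
    modeOp H V (h' : 𝔤) m (hV.psiOp h a n v) = hV.psiOp h a n (modeOp H V (h' : 𝔤) m v) +
      Weight.toLinear ℂ H 𝔤 α h' • hV.psiOp h a (n + m) v := by
  simp only [psiOp_apply]
  rw [map_finsum_of_finite _ (hV.finite_EMinus_modes h a n v), smul_finsum_of_field,
    ← finsum_add_distrib (hV.finite_EMinus_modes h a n _) ((hV.finite_EMinus_modes h a (n + m) v).subset
      fun i hi h0 => hi (by rw [h0, smul_zero]))]
  refine finsum_congr fun i => ?_
  rw [← Module.End.mul_apply (modeOp H V (h' : 𝔤) m),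
    (hV.cartan_commute_coeff_EMinus h h' hm i).eq, Module.End.mul_apply,
    hV.cartan_root h' hα ha, map_add, map_smul, show m + (n + i) = n + m + i by ring]

/-- `[D, ψ(z)] = d/dz ψ(z) + h(-1) ψ(z)`: the last term is the reason why the translation operator of
the vacuum space is a modification of `D`. -/
theorem der_psiOp (hV : IsVacuumModule H ℓ o D) (h : H) (a : 𝔤) (n : ℤ) (v : V) :
    D (hV.psiOp h a n v) = hV.psiOp h a n (D v) - (n : ℂ) • hV.psiOp h a (n - 1) v +
      modeOp H V (h : 𝔤) (-1) (hV.psiOp h a n v) := by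
  have hf0 := hV.finite_EMinus_modes h a n v
  have hf1 := hV.finite_EMinus_modes h a n (D v)
  have hf2 := hV.finite_EMinus_modes h a (n - 1) v
  have hf3 : ∀ c : ℕ → ℂ, {i : ℕ | c i • PowerSeries.coeff i (EMinus H V h)
      (modeOp H V a (n - 1 + i) v) ≠ 0}.Finite := fun c =>
    hf2.subset fun i hi h0 => hi (by rw [h0, smul_zero])
  have hf4 : {i : ℕ | ((i : ℂ) + 1) • PowerSeries.coeff (i + 1) (EMinus H V h)
      (modeOp H V a (n + i) v) ≠ 0}.Finite :=
    (hV.finite_modes a n v).subset fun i hi h0 => hi (by rw [h0, map_zero, smul_zero])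
  have hf5 : {i : ℕ | modeOp H V (h : 𝔤) (-1) (PowerSeries.coeff i (EMinus H V h)
      (modeOp H V a (n + i) v)) ≠ 0}.Finite :=
    (hV.finite_modes a n v).subset fun i hi h0 => hi (by rw [h0, map_zero, map_zero])
  have h1 : ∀ i : ℕ, D (PowerSeries.coeff i (EMinus H V h) (modeOp H V a (n + i) v)) =
      (PowerSeries.coeff i (EMinus H V h) (modeOp H V a (n + i) (D v)) -
        ((n : ℂ) + i) • PowerSeries.coeff i (EMinus H V h) (modeOp H V a (n - 1 + i) v)) +
      (((i : ℂ) + 1) • PowerSeries.coeff (i + 1) (EMinus H V h) (modeOp H V a (n + i) v) +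
      modeOp H V (h : 𝔤) (-1) (PowerSeries.coeff i (EMinus H V h) (modeOp H V a (n + i) v))) := by
    intro i
    have h2 := congrArg (fun T : Module.End ℂ V => T (modeOp H V a (n + i) v))
      (hV.der_coeff_EMinus h i)
    refine h2.trans ?_
    simp only [LinearMap.add_apply, Module.End.mul_apply, LinearMap.smul_apply, hV.der, map_sub,
      map_smul]
    rw [show n + (i : ℤ) - 1 = n - 1 + i by ring, add_assoc]
    push_cast
    rfl
  have hshift : ∑ᶠ i : ℕ, ((i : ℂ) + 1) • PowerSeries.coeff (i + 1) (EMinus H V h)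
      (modeOp H V a (n + i) v) = ∑ᶠ i : ℕ, (i : ℂ) • PowerSeries.coeff i (EMinus H V h)
      (modeOp H V a (n - 1 + i) v) := by
    refine Eq.trans ?_ (finsum_comp_of_injective (add_left_injective 1) ?_)
    · refine finsum_congr fun i => ?_
      rw [show n - 1 + ((i + 1 : ℕ) : ℤ) = n + i by push_cast; ring]
      push_cast
      rfl
    · intro i hi
      refine ⟨i - 1, Nat.sub_add_cancel (Nat.one_le_iff_ne_zero.2 ?_)⟩
      rintro rfl
      simp at hi
  have hadd : ∑ᶠ i : ℕ, ((n : ℂ) + i) • PowerSeries.coeff i (EMinus H V h)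
      (modeOp H V a (n - 1 + i) v) = ∑ᶠ i : ℕ, (n : ℂ) • PowerSeries.coeff i (EMinus H V h)
      (modeOp H V a (n - 1 + i) v) + ∑ᶠ i : ℕ, (i : ℂ) • PowerSeries.coeff i (EMinus H V h)
      (modeOp H V a (n - 1 + i) v) := by
    rw [← finsum_add_distrib (hf3 _) (hf3 _)]
    exact finsum_congr fun i => add_smul _ _ _
  simp only [psiOp_apply]
  rw [map_finsum_of_finite _ hf0, finsum_congr h1, finsum_add_distrib, finsum_add_distrib hf4 hf5,
    finsum_sub_distrib hf1 (hf3 _), hshift, map_finsum_of_finite _ hf0, smul_finsum_of_field,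
    hadd]
  · abel
  · refine (hf1.union (hf3 fun i => (n : ℂ) + i)).subset fun i hi => ?_
    by_contra h0
    simp only [Set.mem_union, Set.mem_ofPred_eq, not_or, not_not] at h0
    refine hi ?_
    beta_reduce
    rw [h0.2, sub_zero, h0.1]
  · refine (hf4.union hf5).subset fun i hi => ?_
    by_contra h0
    simp only [Set.mem_union, Set.mem_ofPred_eq, not_or, not_not] at h0
    exact hi (by beta_reduce; rw [h0.1, h0.2, add_zero])

/-- `ψ(a,z₁)ψ(b,z₂) = (1 - z₂/z₁)^{-α(h')} E⁻(h,z₁) E⁻(h',z₂) a(z₁)b(z₂)`. -/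
theorem opTable_psiOp (hV : IsVacuumModule H ℓ o D) (h h' : H) {α : Weight ℂ H 𝔤}
    (hα : α.IsNonZero) {a : 𝔤} (ha : a ∈ rootSpace H α) (b : 𝔤) (v : V) :
    opTable (hV.psiOp h a) (hV.psiOp h' b) v =
      act (oneSubPow (-(Weight.toLinear ℂ H 𝔤 α h'))) ((-1, 1) : ℤ × ℤ)
        (opAct (fun i => PowerSeries.coeff i (EMinus H V h)) (1, 0)
          (opAct (fun i => PowerSeries.coeff i (EMinus H V h')) (0, 1)
            (opTable (modeOp H V a) (modeOp H V b) v))) := by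
  set T := opTable (modeOp H V a) (modeOp H V b) v with hT
  have hS := summable₃_of_bddSnd ((hV.modeOp_truncated b).bddSnd (modeOp H V a) v)
    fun k => hV.modeOp_truncated a (modeOp H V b k v)
  rw [← opAct_opAct_act hS]
  funext γ
  obtain ⟨m, k⟩ := γ
  change hV.psiOp h a m (hV.psiOp h' b k v) = _
  rw [psiOp_apply]
  refine finsum_congr fun i => ?_
  beta_reduce
  congr 1
  have e : ((m, k) : ℤ × ℤ) + i • ((1, 0) : ℤ × ℤ) = (m + i, k) := by
    ext <;> simp
  rw [e, psiOp_apply, map_finsum_of_finite _ (hV.finite_EMinus_modes h' b k v)]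
  set c := oneSubPow (-(Weight.toLinear ℂ H 𝔤 α h')) with hc
  have h1 : ∀ j : ℕ, modeOp H V a (m + i) (PowerSeries.coeff j (EMinus H V h')
      (modeOp H V b (k + j) v)) = ∑ p ∈ antidiagonal j, PowerSeries.coeff p.1 (EMinus H V h')
        (PowerSeries.coeff p.2 c • T (m + i - p.2, k + p.1 + p.2)) := by
    intro j
    rw [← Module.End.mul_apply, hV.root_coeff_EMinus h' hα ha, LinearMap.sum_apply]
    refine Finset.sum_congr rfl fun p hp => ?_
    have hp' := mem_antidiagonal.1 hp
    rw [LinearMap.smul_apply, Module.End.mul_apply, map_smul, hT, opTable]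
    simp only
    rw [show k + (p.1 : ℤ) + p.2 = k + j by push_cast [← hp']; ring]
  have hfin : {p : ℕ × ℕ | PowerSeries.coeff p.1 (EMinus H V h')
      (PowerSeries.coeff p.2 c • T (m + i - p.2, k + p.1 + p.2)) ≠ 0}.Finite := by
    refine (hS.rotate.left (m + i, k)).subset fun p hp h0 => hp ?_
    have e2 : ((m + i, k) : ℤ × ℤ) + p.1 • ((0, 1) : ℤ × ℤ) + p.2 • ((-1, 1) : ℤ × ℤ) =
        (m + i - p.2, k + p.1 + p.2) := by
      ext <;> simp [sub_eq_add_neg]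
    rw [e2, ← hT] at h0
    rw [h0, smul_zero, map_zero]
  rw [finsum_congr h1, ← finsum_prod_eq_finsum_antidiagonal hfin, finsum_curry _ hfin]
  refine finsum_congr fun j => ?_
  beta_reduce
  have e3 : ((m + i, k) : ℤ × ℤ) + j • ((0, 1) : ℤ × ℤ) = (m + i, k + j) := by
    ext <;> simp
  rw [e3, act_left_apply]
  refine (map_finsum_of_finite (PowerSeries.coeff j (EMinus H V h') : Module.End ℂ V) ?_).symm
  refine (hS.rotate.left.right (m + i, k + j)).subset fun t ht h0 => ht ?_
  have e4 : ((m + i, k + j) : ℤ × ℤ) + t • ((-1, 1) : ℤ × ℤ) = (m + i - t, k + j + t) := by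
    ext <;> simp [sub_eq_add_neg]
  rw [e4, ← hT] at h0
  rw [h0, smul_zero]

/-- `(z₁ - z₂)² [a(z₁), b(z₂)] = 0`. -/
theorem modeOp_local (hV : IsVacuumModule H ℓ o D) (a b : 𝔤) (v : V) (m k : ℤ) :
    act (oneSubPow 2) ((-1, 1) : ℤ × ℤ) (opTable (modeOp H V a) (modeOp H V b) v) (m + 2, k) =
      act (oneSubPow 2) ((1, -1) : ℤ × ℤ)
        (fun p => opTable (modeOp H V b) (modeOp H V a) v p.swap) (m, k + 2) := by
  have e : (2 : ℂ) = (2 : ℕ) := by norm_num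
  rw [e, act_left_apply, act_right_apply,
    finsum_oneSubPow_nat 2 fun i => opTable (modeOp H V a) (modeOp H V b) v (m + 2 - i, k + i),
    finsum_oneSubPow_nat 2 fun i => opTable (modeOp H V b) (modeOp H V a) v
      (Prod.swap (m + i, k + 2 - i))]
  simp only [Finset.sum_range_succ, Finset.sum_range_zero, opTable, Prod.swap_prod_mk]
  rw [hV.modeOp_modeOp a b (m + 2 - (0 : ℕ)), hV.modeOp_modeOp a b (m + 2 - (1 : ℕ)),
    hV.modeOp_modeOp a b (m + 2 - (2 : ℕ))]
  have e0 : m + 2 - ((0 : ℕ) : ℤ) = m + 2 := by simp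
  have e1 : m + 2 - ((1 : ℕ) : ℤ) = m + 1 := by push_cast; ring
  have e2 : m + 2 - ((2 : ℕ) : ℤ) = m := by push_cast; ring
  have f0 : k + 2 - ((0 : ℕ) : ℤ) = k + 2 := by simp
  have f1 : k + 2 - ((1 : ℕ) : ℤ) = k + 1 := by push_cast; ring
  have f2 : k + 2 - ((2 : ℕ) : ℤ) = k := by push_cast; ring
  rw [e0, e1, e2, f0, f1, f2]
  push_cast
  simp only [add_zero, Nat.choose_zero_right, Nat.choose_self, Nat.choose_one_right,
    show m + 2 + k = m + k + 2 by ring, show m + 1 + (k + 1) = m + k + 2 by ring,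
    show m + (k + 2) = m + k + 2 by ring]
  push_cast
  module

/-- The fields `ψ(a,z)` and `ψ(b,z)` are local of order `2`, since `a(z)` and `b(z)` are, and moving
`a(z₁)` past `E⁻(h',z₂)` produces the factor `(1 - z₂/z₁)^{-α(h')}`. -/
theorem psiOp_local (hV : IsVacuumModule H ℓ o D) (h h' : H) {α β : Weight ℂ H 𝔤}
    (hα : α.IsNonZero) (hβ : β.IsNonZero) {a b : 𝔤} (ha : a ∈ rootSpace H α)
    (hb : b ∈ rootSpace H β) {r : ℂ} (hr : Weight.toLinear ℂ H 𝔤 α h' = r)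
    (hr' : Weight.toLinear ℂ H 𝔤 β h = r) :
    LocalWith 2 r (hV.psiOp h a) (hV.psiOp h' b) := by
  intro v m k
  have hS := summable₃_of_bddSnd ((hV.modeOp_truncated b).bddSnd (modeOp H V a) v)
    fun k => hV.modeOp_truncated a (modeOp H V b k v)
  have hS' := summable₃_of_bddSnd ((hV.modeOp_truncated a).bddSnd (modeOp H V b) v)
    fun k => hV.modeOp_truncated b (modeOp H V a k v)
  set T := opTable (modeOp H V a) (modeOp H V b) v with hT
  set T' := opTable (modeOp H V b) (modeOp H V a) v with hT'
  set e := fun i => PowerSeries.coeff i (EMinus H V h) with he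
  set e' := fun i => PowerSeries.coeff i (EMinus H V h') with he'
  have key : ∀ c : ℂ, 2 + c + -c = 2 := fun c => by ring
  have h1 : act (oneSubPow ((2 : ℕ) + r)) ((-1, 1) : ℤ × ℤ) (opTable (hV.psiOp h a) (hV.psiOp h' b) v) =
      opAct e (1, 0) (opAct e' (0, 1) (act (oneSubPow 2) (-1, 1) T)) := by
    rw [hV.opTable_psiOp h h' hα ha, hr, act_mul, ← oneSubPow_add, Nat.cast_ofNat, key,
      opAct_opAct_act hS]
    exact ((hS.rotate.rotate.opAct _).opAct _)
  have h2 : act (oneSubPow ((2 : ℕ) + r)) ((1, -1) : ℤ × ℤ)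
      (fun p => opTable (hV.psiOp h' b) (hV.psiOp h a) v p.swap) =
      opAct e' (0, 1) (opAct e (1, 0) (act (oneSubPow 2) (1, -1) fun p => T' p.swap)) := by
    have h3 : (fun p => opTable (hV.psiOp h' b) (hV.psiOp h a) v p.swap) =
        act (oneSubPow (-r)) ((1, -1) : ℤ × ℤ)
          (opAct e' (0, 1) (opAct e (1, 0) fun p => T' p.swap)) := by
      funext p
      rw [hV.opTable_psiOp h' h hβ hb, hr', act_swap]
      congr 1
    rw [h3, act_mul, ← oneSubPow_add, Nat.cast_ofNat, key]
    · exact (opAct_opAct_act hS'.swap _ _ _).symm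
    · exact ((hS'.swap.rotate.rotate.opAct _).opAct _)
  have h4 : ∀ γ : ℤ × ℤ, act (oneSubPow 2) ((-1, 1) : ℤ × ℤ) T (γ + (2, 0)) =
      act (oneSubPow 2) ((1, -1) : ℤ × ℤ) (fun p => T' p.swap) (γ + (0, 2)) := by
    rintro ⟨m, k⟩
    simpa using hV.modeOp_local a b v m k
  have h5 : opAct e' (0, 1) (opAct e (1, 0) (act (oneSubPow 2) (1, -1) fun p => T' p.swap)) =
      opAct e (1, 0) (opAct e' (0, 1) (act (oneSubPow 2) (1, -1) fun p => T' p.swap)) :=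
    opAct_comm (hS'.swap.act (oneSubPow 2)) fun i j => hV.commute_coeff_EMinus h' h i j
  rw [h1, h2, h5,
    show ((m + (2 : ℕ), k) : ℤ × ℤ) = (m, k) + (2, 0) by simp,
    show ((m, k + (2 : ℕ)) : ℤ × ℤ) = (m, k) + (0, 2) by simp, opAct_translate, opAct_translate,
    neg_one_sq, one_smul]
  congr 1
  funext γ
  rw [opAct_translate, opAct_translate]
  simp only [h4]

end IsVacuumModule

end Psi

/-! ### The vacuum space and its generation -/

section VacuumSpace

open LieAlgebra LieAlgebra.LoopAlgebra LieModule
open scoped TensorProduct Nat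
open Finset.HasAntidiagonal

variable {𝔤 : Type*} [LieRing 𝔤] [LieAlgebra ℂ 𝔤] [FiniteDimensional ℂ 𝔤] [LieAlgebra.IsSimple ℂ 𝔤]
variable {H : LieSubalgebra ℂ 𝔤} [H.IsCartanSubalgebra]
variable {V : Type*} [AddCommGroup V] [Module ℂ V] [Module (UAffine H) V]
  [IsScalarTower ℂ (UAffine H) V]
variable {ℓ : ℂ} {o : V} {D : Module.End ℂ V}

theorem mem_vacuumSpace {w : V} : w ∈ vacuumSpace H V ↔
    ∀ (h : H) (n : ℤ), 1 ≤ n → modeOp H V (h : 𝔤) n w = 0 := by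
  simp [vacuumSpace, Submodule.mem_iInf]

theorem mem_vacuumWeightSpace {β : rootLattice H} {w : vacuumSpace H V} :
    w ∈ vacuumWeightSpace H V β ↔
      ∀ h : H, modeOp H V (h : 𝔤) 0 (w : V) = (β : Module.Dual ℂ H) h • (w : V) := by
  simp [vacuumWeightSpace, Submodule.mem_iInf, sub_eq_zero]

variable (H) in
/-- The root vectors, indexing the generating fields. -/
abbrev RootVector : Type _ := (α : H.root) × rootSpace H (α : Weight ℂ H 𝔤)

namespace RootVector

/-- The root of a root vector. -/
def root (x : RootVector H) : Module.Dual ℂ H := Weight.toLinear ℂ H 𝔤 (x.1 : Weight ℂ H 𝔤)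

/-- The root of a root vector, as an element of the root lattice. -/
def charge (x : RootVector H) : rootLattice H :=
  ⟨x.root, AddSubgroup.subset_closure ⟨x.1, x.1.2, rfl⟩⟩

theorem isNonZero (x : RootVector H) : (x.1 : Weight ℂ H 𝔤).IsNonZero :=
  LieSubalgebra.isNonZero_coe_root x.1

end RootVector

namespace IsVacuumModule

/-- The modes of `ψ(a,z)` for a root vector `a`. -/
def psiMode (hV : IsVacuumModule H ℓ o D) (x : RootVector H) (n : ℤ) : Module.End ℂ V :=
  hV.psiOp (ℓ⁻¹ • dualToCartan H x.root) (x.2 : 𝔤) n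

theorem psiMode_mem (hV : IsVacuumModule H ℓ o D) (hℓ : ℓ ≠ 0) (x : RootVector H) (n : ℤ) {w : V}
    (hw : w ∈ vacuumSpace H V) : hV.psiMode x n w ∈ vacuumSpace H V := by
  rw [mem_vacuumSpace] at hw ⊢
  intro h m hm
  lift m to ℕ using by omega
  rw [psiMode, RootVector.root, hV.cartan_pos_psiOp hℓ h x.isNonZero x.2.2 (by omega), hw h m hm,
    map_zero]

/-- The modes of `ψ(a,z)` on the vacuum space. -/
def psi (hV : IsVacuumModule H ℓ o D) (hℓ : ℓ ≠ 0) (x : RootVector H) (n : ℤ) :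
    Module.End ℂ (vacuumSpace H V) :=
  (hV.psiMode x n).restrict fun _ hw => hV.psiMode_mem hℓ x n hw

theorem coe_psi (hV : IsVacuumModule H ℓ o D) (hℓ : ℓ ≠ 0) (x : RootVector H) (n : ℤ)
    (w : vacuumSpace H V) : (hV.psi hℓ x n w : V) = hV.psiMode x n (w : V) := rfl

/-- The vacuum vector. -/
def vacuumVector (hV : IsVacuumModule H ℓ o D) : vacuumSpace H V :=
  ⟨o, mem_vacuumSpace.2 fun h n hn => hV.annihilates _ n (by omega)⟩

theorem vacuumVector_mem (hV : IsVacuumModule H ℓ o D) :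
    hV.vacuumVector ∈ vacuumWeightSpace H V 0 := by
  rw [mem_vacuumWeightSpace]
  intro h
  rw [AddSubgroup.coe_zero, LinearMap.zero_apply, zero_smul]
  exact hV.annihilates _ 0 le_rfl

theorem psi_mem (hV : IsVacuumModule H ℓ o D) (hℓ : ℓ ≠ 0) (x : RootVector H) (n : ℤ)
    {β : rootLattice H} {w : vacuumSpace H V} (hw : w ∈ vacuumWeightSpace H V β) :
    hV.psi hℓ x n w ∈ vacuumWeightSpace H V (x.charge + β) := by
  rw [mem_vacuumWeightSpace] at hw ⊢
  intro h
  rw [coe_psi, psiMode, hV.cartan_nonpos_psiOp _ h x.isNonZero x.2.2 le_rfl, hw h, map_smul,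
    add_zero, ← add_smul, add_comm]
  rfl

theorem reach_mem (hV : IsVacuumModule H ℓ o D) (hℓ : ℓ ≠ 0) {β : rootLattice H}
    {w : vacuumSpace H V} (hw : Reach hV.vacuumVector RootVector.charge (hV.psi hℓ) β w) :
    w ∈ vacuumWeightSpace H V β := by
  induction hw with
  | vac => exact hV.vacuumVector_mem
  | step x n _ ih => exact hV.psi_mem hℓ x n ih

/-- A subspace stable under the modes `h(-n)`, `n ≥ 1`, is stable under `E⁻`. -/
theorem coeff_EMinus_mem (hV : IsVacuumModule H ℓ o D) (h : H) {X : Submodule ℂ V}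
    (hX : ∀ n : ℕ, 1 ≤ n → ∀ v ∈ X, modeOp H V (h : 𝔤) (-n) v ∈ X) (i : ℕ) {v : V} (hv : v ∈ X) :
    PowerSeries.coeff i (EMinus H V h) v ∈ X := by
  induction i using Nat.strong_induction_on with
  | _ i ih =>
    cases i with
    | zero => rw [(hV.expPair_EMinus h).zero]; exact hv
    | succ i =>
      have h1 := congrArg (fun f : PowerSeries (Module.End ℂ V) =>
        (PowerSeries.coeff i f : Module.End ℂ V) v) (hV.psDeriv_EMinus h)
      simp only [coeff_psDeriv, PowerSeries.coeff_mul, LinearMap.smul_apply,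
        LinearMap.sum_apply, Module.End.mul_apply, coeff_negModes, LinearMap.neg_apply] at h1
      have hi : (i : ℂ) + 1 ≠ 0 := by exact_mod_cast Nat.succ_ne_zero i
      rw [← Submodule.smul_mem_iff X hi, h1]
      refine Submodule.sum_mem _ fun p hp => Submodule.neg_mem _ ?_
      have := mem_antidiagonal.1 hp
      have h2 := hX (p.1 + 1) (by omega) _ (ih p.2 (by omega))
      rwa [show -((p.1 + 1 : ℕ) : ℤ) = -(p.1 : ℤ) - 1 by push_cast; ring] at h2

/-- Solving `ψ(a,z) = E⁻ a(z)` for `a(z)`: the modes of `a` are obtained from those of `ψ(a,z)` and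
the modes `h(-n)`. -/
theorem modeOp_mem_of_psiOp_mem (hV : IsVacuumModule H ℓ o D) (h : H) {X : Submodule ℂ V}
    (hX : ∀ n : ℕ, 1 ≤ n → ∀ v ∈ X, modeOp H V (h : 𝔤) (-n) v ∈ X) (a : 𝔤) {v : V}
    (hv : ∀ n, hV.psiOp h a n v ∈ X) (n : ℤ) : modeOp H V a n v ∈ X := by
  obtain ⟨N, hN⟩ := hV.smooth v
  induction hk : (N - n).toNat using Nat.strong_induction_on generalizing n with
  | _ k ih =>
    by_cases hn : N ≤ n
    · rw [hN a n hn]; exact X.zero_mem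
    · have hf := hV.finite_EMinus_modes h a n v
      set f : ℕ → V := fun i => PowerSeries.coeff i (EMinus H V h) (modeOp H V a (n + i) v) with hfdef
      have h1 : ∀ i, f i = (if i = 0 then f 0 else 0) + if i = 0 then 0 else f i := by
        intro i; split_ifs with hi
        · rw [hi, add_zero]
        · rw [zero_add]
      have h2 : hV.psiOp h a n v = f 0 + ∑ᶠ i, if i = 0 then 0 else f i := by
        rw [psiOp_apply]
        change ∑ᶠ i, f i = _
        rw [finsum_congr h1, finsum_add_distrib, finsum_eq_single _ 0]
        · simp
        · intro i hi; rw [if_neg hi]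
        · refine (Set.finite_singleton 0).subset fun i hi => ?_
          by_contra h0
          exact hi (if_neg h0)
        · refine hf.subset fun i hi h0 => hi ?_
          change f i = 0 at h0
          simp [h0]
      have h3 : f 0 = modeOp H V a n v := by
        simp only [hfdef, (hV.expPair_EMinus h).zero, Nat.cast_zero, add_zero]
        rfl
      rw [← h3, ← add_sub_cancel_right (f 0) (∑ᶠ i, if i = 0 then 0 else f i), ← h2]
      refine Submodule.sub_mem _ (hv n) (finsum_mem_submodule _ fun i => ?_)
      split_ifs with hi
      · exact X.zero_mem
      · exact hV.coeff_EMinus_mem h hX i (ih _ (by omega) (n + i) rfl)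

end IsVacuumModule

variable (H) in
/-- The vectors `h₁(-n₁) ⋯ h_k(-n_k) v` with `1 ≤ n_i ≤ M` and `v` in the set `R`. -/
inductive HeisenbergMonomial (R : Set V) (M : ℕ) : ℕ → V → Prop
  | base {v : V} : v ∈ R → HeisenbergMonomial R M 0 v
  | step (h : H) (n : ℕ) {k : ℕ} {v : V} : 1 ≤ n → n ≤ M → HeisenbergMonomial R M k v →
      HeisenbergMonomial R M (k + 1) (modeOp H V (h : 𝔤) (-n) v)

theorem HeisenbergMonomial.mono {R : Set V} {M M' : ℕ} (hM : M ≤ M') {k : ℕ} {v : V}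
    (hv : HeisenbergMonomial H R M k v) : HeisenbergMonomial H R M' k v := by
  induction hv with
  | base h => exact .base h
  | step h n h1 h2 _ ih => exact .step h n h1 (h2.trans hM) ih

namespace IsVacuumModule

/-- The vectors of the vacuum space obtained from the vacuum by the modes of the `ψ(a,z)`. -/
def reachSet (hV : IsVacuumModule H ℓ o D) (hℓ : ℓ ≠ 0) : Set V :=
  {v | ∃ (β : rootLattice H) (w : vacuumSpace H V),
    Reach hV.vacuumVector RootVector.charge (hV.psi hℓ) β w ∧ (w : V) = v}

/-- The span of all Heisenberg monomials applied to `reachSet`. It is stable under all modes of the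
affine Lie algebra, hence the whole module. -/
def monomialSpan (hV : IsVacuumModule H ℓ o D) (hℓ : ℓ ≠ 0) : Submodule ℂ V :=
  Submodule.span ℂ {v | ∃ M k, HeisenbergMonomial H (hV.reachSet hℓ) M k v}

theorem map_mem_span {X : Submodule ℂ V} {s : Set V} {T : Module.End ℂ V} (h : ∀ v ∈ s, T v ∈ X)
    {v : V} (hv : v ∈ Submodule.span ℂ s) : T v ∈ X :=
  (Submodule.span_le (p := X.comap T)).2 h hv

theorem cartan_neg_mem_monomialSpan (hV : IsVacuumModule H ℓ o D) (hℓ : ℓ ≠ 0) (h : H) {n : ℕ}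
    (hn : 1 ≤ n) {v : V} (hv : v ∈ hV.monomialSpan hℓ) :
    modeOp H V (h : 𝔤) (-n) v ∈ hV.monomialSpan hℓ := by
  refine map_mem_span ?_ hv
  rintro v ⟨M, k, hv⟩
  exact Submodule.subset_span ⟨max M n, k + 1, .step h n hn (le_max_right _ _)
    (hv.mono (le_max_left _ _))⟩

theorem cartan_mem_monomialSpan (hV : IsVacuumModule H ℓ o D) (hℓ : ℓ ≠ 0) (h : H) (n : ℤ) {v : V}
    (hv : v ∈ hV.monomialSpan hℓ) : modeOp H V (h : 𝔤) n v ∈ hV.monomialSpan hℓ := by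
  by_cases hn : n < 0
  · obtain ⟨m, rfl⟩ : ∃ m : ℕ, n = -m := ⟨n.natAbs, by omega⟩
    exact hV.cartan_neg_mem_monomialSpan hℓ h (by omega) hv
  refine map_mem_span ?_ hv
  rintro v ⟨M, k, hv⟩
  induction hv with
  | @base v hv =>
    have hv' := hv
    obtain ⟨β, w, hw, rfl⟩ := hv
    rcases (not_lt.1 hn).eq_or_lt with rfl | hn'
    · rw [mem_vacuumWeightSpace.1 (hV.reach_mem hℓ hw) h]
      exact Submodule.smul_mem _ _ (Submodule.subset_span ⟨M, 0, .base hv'⟩)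
    · rw [mem_vacuumSpace.1 w.2 h n (by omega)]
      exact Submodule.zero_mem _
  | @step h' m k v hm1 hm2 hv ih =>
    have h1 := congrArg (fun T : Module.End ℂ V => T v) (hV.cartan_mul h h' n (-m))
    simp only [Module.End.mul_apply, LinearMap.add_apply, LinearMap.smul_apply,
      Module.End.one_apply] at h1
    rw [h1]
    exact Submodule.add_mem _ (hV.cartan_neg_mem_monomialSpan hℓ h' hm1 ih)
      (Submodule.smul_mem _ _ (Submodule.subset_span ⟨M, k, hv⟩))

theorem root_mem_monomialSpan (hV : IsVacuumModule H ℓ o D) (hℓ : ℓ ≠ 0) (x : RootVector H) (n : ℤ)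
    {v : V} (hv : v ∈ hV.monomialSpan hℓ) :
    modeOp H V (x.2 : 𝔤) n v ∈ hV.monomialSpan hℓ := by
  refine map_mem_span ?_ hv
  rintro v ⟨M, k, hv⟩
  induction hv generalizing n with
  | @base v hv =>
    obtain ⟨β, w, hw, rfl⟩ := hv
    refine hV.modeOp_mem_of_psiOp_mem (ℓ⁻¹ • dualToCartan H x.root)
      (fun m hm v hv => hV.cartan_neg_mem_monomialSpan hℓ _ hm hv) _ (fun m => ?_) n
    exact Submodule.subset_span ⟨0, 0, .base ⟨_, _, .step x m hw, rfl⟩⟩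
  | @step h m k v hm1 hm2 hv ih =>
    have h1 := hV.cartan_root h x.isNonZero x.2.2 (-m) n v
    rw [← sub_eq_iff_eq_add.2 h1]
    exact Submodule.sub_mem _ (hV.cartan_neg_mem_monomialSpan hℓ h hm1 (ih n))
      (Submodule.smul_mem _ _ (ih _))

theorem monomialSpan_eq_top (hV : IsVacuumModule H ℓ o D) (hℓ : ℓ ≠ 0) :
    hV.monomialSpan hℓ = ⊤ := by
  refine hV.cyclic _ (Submodule.subset_span ⟨0, 0, .base ⟨0, _, .vac, rfl⟩⟩) fun x n v hv => ?_
  let L : 𝔤 →ₗ[ℂ] V :=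
    { toFun := fun x => modeOp H V x n v
      map_add' := fun x y => by rw [modeOp_add]; rfl
      map_smul' := fun c x => by rw [modeOp_smul]; rfl }
  exact root_induction H (P := (hV.monomialSpan hℓ).comap L)
    (fun h => hV.cartan_mem_monomialSpan hℓ h n hv)
    (fun α hα a ha => hV.root_mem_monomialSpan hℓ ⟨⟨α, hα⟩, ⟨a, ha⟩⟩ n hv) x

variable (H V ℓ) in
/-- The operator `∑_{n=1}^M ∑_i (nℓ)⁻¹ h_i(-n) h^i(n)`, with dual bases `h_i` and `h^i` of the Cartan
subalgebra. It counts the length of Heisenberg monomials. -/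
def eulerOp (M : ℕ) : Module.End ℂ V :=
  ∑ n ∈ Finset.Icc 1 M, ∑ i, ((n : ℂ) * ℓ)⁻¹ • (modeOp H V (Module.finBasis ℂ H i : H) (-(n : ℤ)) *
    modeOp H V (dualToCartan H ((Module.finBasis ℂ H).coord i) : H) n)

theorem eulerOp_of_mem_vacuumSpace (M : ℕ) {w : V} (hw : w ∈ vacuumSpace H V) :
    eulerOp H V ℓ M w = 0 := by
  simp only [eulerOp, LinearMap.sum_apply, LinearMap.smul_apply, Module.End.mul_apply]
  refine Finset.sum_eq_zero fun n hn => Finset.sum_eq_zero fun i _ => ?_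
  rw [mem_vacuumSpace.1 hw _ n (by have := (Finset.mem_Icc.1 hn).1; omega), map_zero, smul_zero]

theorem eulerOp_cartan (hV : IsVacuumModule H ℓ o D) (hℓ : ℓ ≠ 0) (h : H) {m M : ℕ} (hm : 1 ≤ m)
    (hM : m ≤ M) (v : V) : eulerOp H V ℓ M (modeOp H V (h : 𝔤) (-m) v) =
      modeOp H V (h : 𝔤) (-m) (eulerOp H V ℓ M v) + modeOp H V (h : 𝔤) (-m) v := by
  have h1 : ∀ n ∈ Finset.Icc 1 M, ∀ i, ((n : ℂ) * ℓ)⁻¹ •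
      modeOp H V (Module.finBasis ℂ H i : H) (-(n : ℤ)) (modeOp H V
        (dualToCartan H ((Module.finBasis ℂ H).coord i) : H) n (modeOp H V (h : 𝔤) (-m) v)) =
      modeOp H V (h : 𝔤) (-m) (((n : ℂ) * ℓ)⁻¹ • modeOp H V (Module.finBasis ℂ H i : H) (-(n : ℤ))
        (modeOp H V (dualToCartan H ((Module.finBasis ℂ H).coord i) : H) n v)) +
      if n = m then normForm H (dualToCartan H ((Module.finBasis ℂ H).coord i) : 𝔤) (h : 𝔤) •
        modeOp H V (Module.finBasis ℂ H i : H) (-(m : ℤ)) v else 0 := by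
    intro n hn i
    have hn1 := (Finset.mem_Icc.1 hn).1
    have h2 := congrArg (fun T : Module.End ℂ V => T v)
      (hV.cartan_mul (dualToCartan H ((Module.finBasis ℂ H).coord i)) h n (-m))
    have h3 := hV.cartan_commute (Module.finBasis ℂ H i) h (m := -n) (n := -m) (Or.inl (by omega))
    simp only [Module.End.mul_apply, LinearMap.add_apply, LinearMap.smul_apply,
      Module.End.one_apply] at h2
    rw [h2, map_add, ← Module.End.mul_apply _ (modeOp H V (h : 𝔤) (-m)), h3.eq,
      Module.End.mul_apply, map_smul, map_smul, smul_add]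
    congr 1
    by_cases hnm : n = m
    · subst hnm
      have : (n : ℂ) ≠ 0 := by exact_mod_cast (show n ≠ 0 by omega)
      rw [smul_smul, if_pos rfl, if_pos (by omega)]
      congr 1
      push_cast
      field_simp
    · rw [if_neg hnm, if_neg (by omega)]
      simp
  simp only [eulerOp, LinearMap.sum_apply, LinearMap.smul_apply, Module.End.mul_apply]
  rw [Finset.sum_congr rfl fun n hn => Finset.sum_congr rfl fun i _ => h1 n hn i]
  simp only [Finset.sum_add_distrib, map_sum]
  congr 1
  rw [Finset.sum_comm]
  simp only [Finset.sum_ite_eq', Finset.mem_Icc, hm, hM, and_self, if_true]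
  conv_rhs => rw [← sum_normForm_dual_basis H h]
  let L : H →ₗ[ℂ] V :=
    { toFun := fun h => modeOp H V (h : 𝔤) (-m) v
      map_add' := fun x y => by
        rw [show ((x + y : H) : 𝔤) = x + y from rfl, modeOp_add]; rfl
      map_smul' := fun c x => by
        rw [show ((c • x : H) : 𝔤) = c • (x : 𝔤) from rfl, modeOp_smul]; rfl }
  change _ = L _
  rw [map_sum]
  exact Finset.sum_congr rfl fun i _ => (map_smul L _ _).symm

theorem eulerOp_monomial (hV : IsVacuumModule H ℓ o D) (hℓ : ℓ ≠ 0) {M k : ℕ} {v : V}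
    (hv : HeisenbergMonomial H (hV.reachSet hℓ) M k v) :
    eulerOp H V ℓ M v = (k : ℂ) • v := by
  induction hv with
  | base h =>
    obtain ⟨β, w, _, rfl⟩ := h
    rw [eulerOp_of_mem_vacuumSpace M w.2, Nat.cast_zero, zero_smul]
  | step h n h1 h2 _ ih =>
    rw [hV.eulerOp_cartan hℓ h h1 h2, ih, map_smul]
    push_cast
    module

/-- The vacuum space is spanned by the vectors obtained from the vacuum by the modes of the
`ψ(a,z)`: monomials of positive length belong to nonzero eigenvalues of an operator that kills the
vacuum space. -/
theorem vacuumSpace_le_span_reachSet (hV : IsVacuumModule H ℓ o D) (hℓ : ℓ ≠ 0) :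
    vacuumSpace H V ≤ Submodule.span ℂ (hV.reachSet hℓ) := by
  intro w hw
  have hw1 : w ∈ hV.monomialSpan hℓ := by rw [hV.monomialSpan_eq_top]; trivial
  have hR : Submodule.span ℂ (hV.reachSet hℓ) ≤ vacuumSpace H V := by
    rw [Submodule.span_le]
    rintro _ ⟨β, w, _, rfl⟩
    exact w.2
  obtain ⟨M, hM⟩ : ∃ M, w ∈ Submodule.span ℂ
      {v | ∃ k, HeisenbergMonomial H (hV.reachSet hℓ) M k v} := by
    refine Submodule.span_induction ?_ ?_ ?_ ?_ hw1
    · rintro v ⟨M, k, hv⟩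
      exact ⟨M, Submodule.subset_span ⟨k, hv⟩⟩
    · exact ⟨0, Submodule.zero_mem _⟩
    · rintro v v' _ _ ⟨M, hv⟩ ⟨M', hv'⟩
      refine ⟨max M M', Submodule.add_mem _ (Submodule.span_mono ?_ hv)
        (Submodule.span_mono ?_ hv')⟩
      · rintro v ⟨k, hk⟩; exact ⟨k, hk.mono (le_max_left _ _)⟩
      · rintro v ⟨k, hk⟩; exact ⟨k, hk.mono (le_max_right _ _)⟩
    · rintro c v _ ⟨M, hv⟩
      exact ⟨M, Submodule.smul_mem _ _ hv⟩
  have hle : Submodule.span ℂ {v | ∃ k, HeisenbergMonomial H (hV.reachSet hℓ) M k v} ≤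
      Submodule.span ℂ (hV.reachSet hℓ) ⊔
        ⨆ μ, ⨆ (_ : μ ≠ (0 : ℂ)), (eulerOp H V ℓ M).eigenspace μ := by
    rw [Submodule.span_le]
    rintro v ⟨k, hk⟩
    have hv := hV.eulerOp_monomial hℓ hk
    cases hk with
    | base h => exact Submodule.mem_sup_left (Submodule.subset_span h)
    | @step h n k v h1 h2 h3 =>
      refine Submodule.mem_sup_right (Submodule.mem_iSup_of_mem ((k + 1 : ℕ) : ℂ)
        (Submodule.mem_iSup_of_mem (by exact_mod_cast Nat.succ_ne_zero k) ?_))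
      rw [Module.End.mem_eigenspace_iff]
      exact hv
  obtain ⟨y, hy, z, hz, rfl⟩ := Submodule.mem_sup.1 (hle hM)
  have hz0 : z ∈ (eulerOp H V ℓ M).eigenspace 0 := by
    rw [Module.End.mem_eigenspace_iff, zero_smul]
    have : z = (y + z) - y := by abel
    rw [this, map_sub, eulerOp_of_mem_vacuumSpace M hw, eulerOp_of_mem_vacuumSpace M (hR hy),
      sub_zero]
  have := (Module.End.eigenspaces_iSupIndep (eulerOp H V ℓ M) 0).le_bot ⟨hz0, hz⟩
  rw [Submodule.mem_bot] at this
  rw [this, add_zero]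
  exact hy

theorem span_reach (hV : IsVacuumModule H ℓ o D) (hℓ : ℓ ≠ 0) :
    Submodule.span ℂ {w | ∃ β, Reach hV.vacuumVector RootVector.charge (hV.psi hℓ) β w} = ⊤ := by
  rw [eq_top_iff]
  rintro w -
  have h1 := hV.vacuumSpace_le_span_reachSet hℓ w.2
  have h2 : hV.reachSet hℓ = (vacuumSpace H V).subtype ''
      {w | ∃ β, Reach hV.vacuumVector RootVector.charge (hV.psi hℓ) β w} := by
    ext v
    constructor
    · rintro ⟨β, w, hw, rfl⟩; exact ⟨w, ⟨β, hw⟩, rfl⟩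
    · rintro ⟨w, ⟨β, hw⟩, rfl⟩; exact ⟨β, w, hw, rfl⟩
  rw [h2, Submodule.span_image] at h1
  obtain ⟨w', hw', h3⟩ := h1
  rwa [← Subtype.ext h3]

theorem iSup_vacuumWeightSpace (hV : IsVacuumModule H ℓ o D) (hℓ : ℓ ≠ 0) :
    ⨆ β, vacuumWeightSpace H V β = ⊤ := by
  rw [eq_top_iff, ← hV.span_reach hℓ, Submodule.span_le]
  rintro w ⟨β, hw⟩
  exact Submodule.mem_iSup_of_mem β (hV.reach_mem hℓ hw)

theorem iSupIndep_vacuumWeightSpace (hV : IsVacuumModule H ℓ o D) :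
    iSupIndep (vacuumWeightSpace H V) := by
  have hmaps : ∀ (h : H), ∀ w ∈ vacuumSpace H V, modeOp H V (h : 𝔤) 0 w ∈ vacuumSpace H V := by
    intro h w hw
    rw [mem_vacuumSpace] at hw ⊢
    intro h' n hn
    rw [← Module.End.mul_apply, (hV.cartan_commute h' h (Or.inl (by omega))).eq,
      Module.End.mul_apply, hw h' n hn, map_zero]
  let f : H → Module.End ℂ (vacuumSpace H V) := fun h => (modeOp H V (h : 𝔤) 0).restrict (hmaps h)
  have hcomm : ∀ h h', Commute (f h) (f h') := by
    intro h h'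
    ext w
    exact congrArg (fun T : Module.End ℂ V => T (w : V)) (hV.cartan_commute h h' (Or.inr rfl)).eq
  have h1 := Module.End.independent_iInf_maxGenEigenspace_of_forall_mapsTo f
    fun i j c => Module.End.mapsTo_maxGenEigenspace_of_comm (hcomm j i) c
  have h2 : iSupIndep fun β : rootLattice H =>
      ⨅ h, (f h).maxGenEigenspace ((β : Module.Dual ℂ H) h) :=
    h1.comp (f := fun β : rootLattice H => fun h : H => (β : Module.Dual ℂ H) h)
      fun β β' hβ => Subtype.ext (LinearMap.ext fun h => congrFun hβ h)
  refine h2.mono fun β w hw => ?_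
  rw [Submodule.mem_iInf]
  intro h
  have h3 : w ∈ (f h).eigenspace ((β : Module.Dual ℂ H) h) := by
    rw [Module.End.mem_eigenspace_iff]
    exact Subtype.ext (mem_vacuumWeightSpace.1 hw h)
  exact (f h).genEigenspace_le_maximal _ 1 h3

end IsVacuumModule

end VacuumSpace

/-! ### The generating fields of the vacuum space -/

section GeneratingFields

open LieAlgebra LieAlgebra.LoopAlgebra LieModule
open scoped TensorProduct Nat
open Finset.HasAntidiagonal

variable {𝔤 : Type*} [LieRing 𝔤] [LieAlgebra ℂ 𝔤] [FiniteDimensional ℂ 𝔤] [LieAlgebra.IsSimple ℂ 𝔤]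
variable {H : LieSubalgebra ℂ 𝔤} [H.IsCartanSubalgebra]
variable {V : Type*} [AddCommGroup V] [Module ℂ V] [Module (UAffine H) V]
  [IsScalarTower ℂ (UAffine H) V]
variable {ℓ : ℂ} {o : V} {D : Module.End ℂ V}

variable (H) in
/-- The complex-valued form `⟨·,·⟩/ℓ` on the root lattice. -/
def latticePairing (ℓ : ℂ) : rootLattice H →+ rootLattice H →+ ℂ :=
  AddMonoidHom.mk' (fun α => AddMonoidHom.mk' (fun β => dualForm H α β / ℓ)
      (fun β β' => by simp [dualForm, add_div]))
    (fun α α' => by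
      ext β
      simp [dualForm, add_div])

theorem latticePairing_apply (α β : rootLattice H) :
    latticePairing H ℓ α β = (β : Module.Dual ℂ H) (ℓ⁻¹ • dualToCartan H (α : Module.Dual ℂ H)) := by
  rw [map_smul, smul_eq_mul, ← div_eq_inv_mul]
  rfl

theorem latticePairing_comm (α β : rootLattice H) :
    latticePairing H ℓ α β = latticePairing H ℓ β α := by
  change dualForm H α β / ℓ = dualForm H β α / ℓ
  rw [dualForm_comm]

namespace IsVacuumModule

/-- `D - β(-1)/ℓ` preserves the vacuum vectors of weight `β`. -/
theorem der_sub_mem (hV : IsVacuumModule H ℓ o D) (hℓ : ℓ ≠ 0) (β : rootLattice H)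
    {w : vacuumSpace H V} (hw : w ∈ vacuumWeightSpace H V β) :
    D w - modeOp H V (ℓ⁻¹ • dualToCartan H (β : Module.Dual ℂ H) : H) (-1) w ∈ vacuumSpace H V := by
  rw [mem_vacuumSpace]
  intro h n hn
  have h1 : modeOp H V (h : 𝔤) n (D w) = (n : ℂ) • modeOp H V (h : 𝔤) (n - 1) w := by
    have := hV.der h n w
    rw [mem_vacuumSpace.1 w.2 h n hn, map_zero] at this
    exact sub_eq_zero.1 this.symm
  have h2 := congrArg (fun T : Module.End ℂ V => T w)
    (hV.cartan_mul h (ℓ⁻¹ • dualToCartan H (β : Module.Dual ℂ H)) n (-1))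
  simp only [Module.End.mul_apply, LinearMap.add_apply, LinearMap.smul_apply,
    Module.End.one_apply] at h2
  rw [map_sub, h1, h2, mem_vacuumSpace.1 w.2 h n hn, map_zero, zero_add]
  by_cases hn1 : n = 1
  · subst hn1
    rw [sub_self, mem_vacuumWeightSpace.1 hw h, normForm_comm,
      show ((ℓ⁻¹ • dualToCartan H (β : Module.Dual ℂ H) : H) : 𝔤) =
        ℓ⁻¹ • (dualToCartan H (β : Module.Dual ℂ H) : 𝔤) from rfl, map_smul, LinearMap.smul_apply,
      normForm_dualToCartan, if_pos (by norm_num), smul_smul, ← sub_smul, smul_eq_mul]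
    convert zero_smul ℂ _
    field_simp
    simp
  · rw [mem_vacuumSpace.1 w.2 h _ (by omega), if_neg (by omega)]
    simp

theorem der_sub_weight (hV : IsVacuumModule H ℓ o D) (β : rootLattice H)
    {w : vacuumSpace H V} (hw : w ∈ vacuumWeightSpace H V β) (h : H) :
    modeOp H V (h : 𝔤) 0
        (D w - modeOp H V (ℓ⁻¹ • dualToCartan H (β : Module.Dual ℂ H) : H) (-1) w) =
      (β : Module.Dual ℂ H) h •
        (D w - modeOp H V (ℓ⁻¹ • dualToCartan H (β : Module.Dual ℂ H) : H) (-1) w) := by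
  have h1 : modeOp H V (h : 𝔤) 0 (D w) = D (modeOp H V (h : 𝔤) 0 w) := by
    rw [hV.der]; simp
  rw [map_sub, h1, ← Module.End.mul_apply (modeOp H V (h : 𝔤) 0),
    (hV.cartan_commute h _ (Or.inr rfl)).eq, Module.End.mul_apply,
    mem_vacuumWeightSpace.1 hw h, map_smul, map_smul, smul_sub]

/-- The operator `D - β(-1)/ℓ` on the vacuum vectors of weight `β`. -/
def derWeight (hV : IsVacuumModule H ℓ o D) (hℓ : ℓ ≠ 0) (β : rootLattice H) :
    vacuumWeightSpace H V β →ₗ[ℂ] vacuumSpace H V :=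
  ((D - modeOp H V (ℓ⁻¹ • dualToCartan H (β : Module.Dual ℂ H) : H) (-1)) ∘ₗ
    (vacuumSpace H V).subtype ∘ₗ (vacuumWeightSpace H V β).subtype).codRestrict _
      fun w => hV.der_sub_mem hℓ β w.2

/-- The translation operator of the vacuum space, equal to `D - β(-1)/ℓ` in weight `β`. -/
def translation (hV : IsVacuumModule H ℓ o D) (hℓ : ℓ ≠ 0) : Module.End ℂ (vacuumSpace H V) :=
  glue hV.iSupIndep_vacuumWeightSpace (hV.iSup_vacuumWeightSpace hℓ) _ (hV.derWeight hℓ)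

theorem coe_translation (hV : IsVacuumModule H ℓ o D) (hℓ : ℓ ≠ 0) {β : rootLattice H}
    {w : vacuumSpace H V} (hw : w ∈ vacuumWeightSpace H V β) :
    (hV.translation hℓ w : V) =
      D w - modeOp H V (ℓ⁻¹ • dualToCartan H (β : Module.Dual ℂ H) : H) (-1) w := by
  have := glue_apply hV.iSupIndep_vacuumWeightSpace (hV.iSup_vacuumWeightSpace hℓ)
    (hV.derWeight hℓ) hw
  exact congrArg Subtype.val this

/-- The vacuum space as a graded space with a translation operator. -/
def chargedSpace (hV : IsVacuumModule H ℓ o D) (hℓ : ℓ ≠ 0) :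
    ChargedSpace (rootLattice H) (vacuumSpace H V) where
  gr := vacuumWeightSpace H V
  indep := hV.iSupIndep_vacuumWeightSpace
  span := hV.iSup_vacuumWeightSpace hℓ
  pairing := latticePairing H ℓ
  pairing_comm := latticePairing_comm
  vac := hV.vacuumVector
  vac_mem := hV.vacuumVector_mem
  der := hV.translation hℓ
  der_mem β w hw := by
    rw [mem_vacuumWeightSpace]
    intro h
    rw [hV.coe_translation hℓ hw]
    exact hV.der_sub_weight β hw h
  der_vac := by
    refine Subtype.ext ?_
    rw [hV.coe_translation hℓ hV.vacuumVector_mem]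
    change D o - modeOp H V (ℓ⁻¹ • dualToCartan H (0 : Module.Dual ℂ H) : H) (-1) o = 0
    rw [hV.der_vac, map_zero, smul_zero]
    change 0 - modeOp H V (0 : 𝔤) (-1) o = 0
    rw [modeOp_zero]
    simp

theorem isField_psi (hV : IsVacuumModule H ℓ o D) (hℓ : ℓ ≠ 0) (x : RootVector H) :
    IsField (hV.chargedSpace hℓ) x.charge (hV.psi hℓ x) where
  maps _ _ hw n := hV.psi_mem hℓ x n hw
  trunc w := by
    obtain ⟨K, hK⟩ := hV.psiOp_truncated (ℓ⁻¹ • dualToCartan H x.root) (x.2 : 𝔤) w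
    exact ⟨K, fun n hn => Subtype.ext (hK n hn)⟩

/-- The operator `D - (α+β)(-1)/ℓ` on the image of `ψ(a,z)`, `a` of weight `α`, compensates the term
`α(-1)/ℓ` of `der_psiOp`, and `[β(-1)/ℓ, ψ(a,z)]` the shift of the exponents by `⟨α,β⟩/ℓ`. -/
theorem covariant_psi (hV : IsVacuumModule H ℓ o D) (hℓ : ℓ ≠ 0) (x : RootVector H) :
    Covariant (hV.chargedSpace hℓ) x.charge (hV.psi hℓ x) := by
  intro β w hw n
  refine Subtype.ext ?_
  change ((hV.translation hℓ (hV.psi hℓ x n w) : vacuumSpace H V) : V) =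
    hV.psiMode x n (hV.translation hℓ w : vacuumSpace H V) -
      ((n : ℂ) + latticePairing H ℓ x.charge β) • hV.psiMode x (n - 1) w
  rw [hV.coe_translation hℓ (hV.psi_mem hℓ x n hw), hV.coe_translation hℓ hw, coe_psi, map_sub]
  have h1 : ((ℓ⁻¹ • dualToCartan H ((x.charge + β : rootLattice H) : Module.Dual ℂ H) : H) : 𝔤) =
      ((ℓ⁻¹ • dualToCartan H x.root : H) : 𝔤) +
        ((ℓ⁻¹ • dualToCartan H (β : Module.Dual ℂ H) : H) : 𝔤) := by
    rw [AddSubgroup.coe_add, map_add, smul_add]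
    rfl
  have h2 := hV.der_psiOp (ℓ⁻¹ • dualToCartan H x.root) (x.2 : 𝔤) n w
  have h3 := hV.cartan_nonpos_psiOp (ℓ⁻¹ • dualToCartan H x.root)
    (ℓ⁻¹ • dualToCartan H (β : Module.Dual ℂ H)) x.isNonZero x.2.2 (m := -1) (by omega) n w
  have h4 : latticePairing H ℓ x.charge β = Weight.toLinear ℂ H 𝔤 (x.1 : Weight ℂ H 𝔤)
      (ℓ⁻¹ • dualToCartan H (β : Module.Dual ℂ H)) := by
    rw [latticePairing_comm, latticePairing_apply]
    rfl
  rw [h1, modeOp_add, LinearMap.add_apply, h4]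
  unfold psiMode
  rw [h2, h3, show n + -1 = n - 1 by ring]
  module

theorem local_psi (hV : IsVacuumModule H ℓ o D) (hℓ : ℓ ≠ 0) (x y : RootVector H) :
    Local ((hV.chargedSpace hℓ).pairing x.charge y.charge) (hV.psi hℓ x) (hV.psi hℓ y) := by
  refine ⟨2, fun w m k => Subtype.ext ?_⟩
  have h1 := hV.psiOp_local (ℓ⁻¹ • dualToCartan H x.root) (ℓ⁻¹ • dualToCartan H y.root)
    x.isNonZero y.isNonZero x.2.2 y.2.2 (r := latticePairing H ℓ x.charge y.charge)
    (by rw [latticePairing_comm, latticePairing_apply]; rfl)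
    (by rw [latticePairing_apply]; rfl) w m k
  have hs := summable_left ((hV.isField_psi hℓ y).trunc.bddSnd (hV.psi hℓ x) w)
  have hs' := summable_right (T := fun p => opTable (hV.psi hℓ y) (hV.psi hℓ x) w p.swap)
    ((hV.isField_psi hℓ x).trunc.bddFst (hV.psi hℓ y) w)
  rw [← Submodule.subtype_apply, ← Submodule.subtype_apply, map_smul, act_map _ _ _ (hs _), act_map _ _ _ (hs' _)]
  exact h1

theorem generating_psi (hV : IsVacuumModule H ℓ o D) (hℓ : ℓ ≠ 0) :
    Generating (hV.chargedSpace hℓ) RootVector.charge (hV.psi hℓ) where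
  field := hV.isField_psi hℓ
  cov := hV.covariant_psi hℓ
  vac _ _ hn := Subtype.ext (hV.psiOp_vac _ _ hn)
  isLocal := hV.local_psi hℓ
  span := hV.span_reach hℓ

theorem psi_neg_one_vac (hV : IsVacuumModule H ℓ o D) (hℓ : ℓ ≠ 0) (x : RootVector H) :
    (hV.psi hℓ x (-1) hV.vacuumVector : V) = modeOp H V (x.2 : 𝔤) (-1) o :=
  hV.psiOp_neg_one_vac _ _

/-- On the vacuum space the coefficients `ZCoeff` are the modes of `ψ(a,z)`. -/
theorem ZCoeff_eq (hV : IsVacuumModule H ℓ o D) (x : RootVector H) {w : V}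
    (hw : w ∈ vacuumSpace H V) (N : ℤ) :
    ZCoeff H ℓ x.root (x.2 : 𝔤) w N = hV.psiMode x (-1 - N) w := by
  rw [psiMode, psiOp_apply, ZCoeff]
  have hw' := mem_vacuumSpace.1 hw (ℓ⁻¹ • dualToCartan H x.root)
  have h1 : ∀ p : ℕ × ℕ, p ∉ Set.range (fun i : ℕ => (i, 0)) →
      PowerSeries.coeff p.1 (EMinus H V (ℓ⁻¹ • dualToCartan H x.root))
      (modeOp H V (x.2 : 𝔤) ((p.1 : ℤ) - (p.2 : ℤ) - 1 - N)
        (PowerSeries.coeff p.2 (EPlus H V (ℓ⁻¹ • dualToCartan H x.root)) w)) = 0 := by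
    rintro ⟨i, j⟩ hp
    have hj : j ≠ 0 := fun h0 => hp ⟨i, by rw [h0]⟩
    rw [coeff_EPlus_apply _ hw', if_neg hj, map_zero, map_zero]
  rw [← finsum_comp_of_injective (g := fun i : ℕ => (i, 0)) (fun i j hij => (Prod.ext_iff.1 hij).1)]
  · refine finsum_congr fun i => ?_
    simp only
    rw [coeff_EPlus_apply _ hw', if_pos rfl,
      show (i : ℤ) - ((0 : ℕ) : ℤ) - 1 - N = -1 - N + i by push_cast; ring]
  · intro p hp
    by_contra h0
    exact hp (h1 p h0)

theorem psiCoeff_eq (hV : IsVacuumModule H ℓ o D) (hℓ : ℓ ≠ 0) (x : RootVector H)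
    {β : rootLattice H} (w : vacuumSpace H V) (n : ℤ) :
    psiCoeff H ℓ x.root (x.2 : 𝔤) (β : Module.Dual ℂ H) (w : V)
      (-((n : ℂ) + latticePairing H ℓ x.charge β) - 1) = hV.psi hℓ x n w := by
  have h1 : -((n : ℂ) + latticePairing H ℓ x.charge β) - 1 + dualForm H x.root β / ℓ =
      ((-1 - n : ℤ) : ℂ) := by
    change -((n : ℂ) + dualForm H x.root β / ℓ) - 1 + _ = _
    push_cast
    ring
  rw [psiCoeff, h1, Function.Injective.extend_apply Int.cast_injective, hV.ZCoeff_eq x w.2, coe_psi]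
  congr 2
  ring

theorem psiCoeff_eq_zero (x : RootVector H) {β : rootLattice H} (w : V) {y : ℂ}
    (hy : ∀ n : ℤ, -y - 1 ≠ (n : ℂ) + latticePairing H ℓ x.charge β) :
    psiCoeff H ℓ x.root (x.2 : 𝔤) (β : Module.Dual ℂ H) w y = 0 := by
  rw [psiCoeff, Function.extend_apply', Pi.zero_apply]
  rintro ⟨N, hN⟩
  refine hy (-1 - N) ?_
  change _ = _ + dualForm H x.root β / ℓ
  push_cast
  rw [hN]
  ring

/-- The vacuum space of a vacuum module is a generalized vertex algebra in exactly one way such that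
the fields `ψ(a,z)` are vertex operators, and these fields generate it. -/
theorem exists_unique_genVertexAlgebra (hV : IsVacuumModule H ℓ o D) (hℓ : ℓ ≠ 0) :
    ∃ S : GenVertexAlgebra (latticeForms H ℓ) (vacuumWeightSpace H V),
      (S.vac : V) = o ∧ HasPsiFields H o S ∧
      (∀ S' : GenVertexAlgebra (latticeForms H ℓ) (vacuumWeightSpace H V),
        HasPsiFields H o S' → S' = S) ∧
      S.GeneratedBy {u | ∃ α ∈ H.root, ∃ a ∈ rootSpace H α,
        (u : V) = modeOp H V a (-1) o} := by
  have hF : ∀ g h, (latticeForms H ℓ).form g h =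
      QuotientAddGroup.mk ((hV.chargedSpace hℓ).pairing g h) := fun _ _ => rfl
  have hG := hV.generating_psi hℓ
  set S : GenVertexAlgebra (latticeForms H ℓ) (vacuumWeightSpace H V) :=
    reconstruct hG (latticeForms H ℓ) hF fun _ _ => rfl with hS
  have hSY : ∀ (x : RootVector H) (β : rootLattice H), ∀ w ∈ vacuumWeightSpace H V β, ∀ n : ℤ,
      S.Y (hV.psi hℓ x (-1) hV.vacuumVector) (n + latticePairing H ℓ x.charge β) w =
        hV.psi hℓ x n w := fun x β w hw n =>
    reconstruct_Y_generator hG (latticeForms H ℓ) hF (fun _ _ => rfl) x hw n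
  have hmem : ∀ x : RootVector H, hV.psi hℓ x (-1) hV.vacuumVector ∈
      vacuumWeightSpace H V x.charge := by
    intro x
    have := hV.psi_mem hℓ x (-1) hV.vacuumVector_mem
    rwa [add_zero] at this
  refine ⟨S, rfl, ⟨?_, ?_⟩, ?_, ?_⟩
  · intro e he n
    obtain rfl : e = S.vac := Subtype.ext he
    exact S.vacuum n
  · intro α hα a ha u hu β w hw y
    let x : RootVector H := ⟨⟨α, hα⟩, ⟨a, ha⟩⟩
    obtain rfl : u = hV.psi hℓ x (-1) hV.vacuumVector :=
      Subtype.ext (hu.trans (hV.psi_neg_one_vac hℓ x).symm)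
    change _ = psiCoeff H ℓ x.root (x.2 : 𝔤) β (w : V) y
    by_cases hy : ∃ n : ℤ, -y - 1 = (n : ℂ) + latticePairing H ℓ x.charge β
    · obtain ⟨n, hn⟩ := hy
      rw [hn, hSY x β w hw n, ← hV.psiCoeff_eq hℓ x w n, ← hn]
      congr 1
      ring
    · push Not at hy
      rw [psiCoeff_eq_zero x _ hy]
      exact congrArg Subtype.val (S.support x.charge β _ w (latticePairing H ℓ x.charge β) (-y - 1)
        (hmem x) hw rfl fun k hk => hy k (by rw [hk, add_comm]))
  · intro S' hS'
    have hv' : S'.vac = hV.vacuumVector := by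
      have h1 := hS'.1 hV.vacuumVector rfl (-1)
      have h2 := S'.creation_neg_one hV.vacuumVector
      rw [h1, if_pos rfl] at h2
      exact h2
    refine genVertexAlgebra_ext hG (T := S') (T' := S) hF hv' rfl ?_ hSY
    intro x β w hw n
    refine Subtype.ext ?_
    have h1 := hS'.2 x.1 x.1.2 x.2 x.2.2 (hV.psi hℓ x (-1) hV.vacuumVector)
      (hV.psi_neg_one_vac hℓ x) β w hw (-((n : ℂ) + latticePairing H ℓ x.charge β) - 1)
    have h2 : -(-((n : ℂ) + latticePairing H ℓ x.charge β) - 1) - 1 =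
      (n : ℂ) + latticePairing H ℓ x.charge β := by ring
    rw [h2] at h1
    exact h1.trans (hV.psiCoeff_eq hℓ x w n)
  · exact generatedBy_of_generating hG rfl hSY fun x =>
      ⟨x.1, x.1.2, x.2, x.2.2, hV.psi_neg_one_vac hℓ x⟩

end IsVacuumModule

end GeneratingFields

/-! ### Derivations of the universal enveloping algebra -/

section Enveloping

open UniversalEnvelopingAlgebra

attribute [local instance] LieRing.ofAssociativeRing

variable {L : Type*} [LieRing L] [LieAlgebra ℂ L]

/-- The universal enveloping algebra is generated by the Lie algebra. -/
theorem mem_of_ι_mem (S : Subalgebra ℂ (UniversalEnvelopingAlgebra ℂ L)) (h : ∀ x, ι ℂ x ∈ S)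
    (u : UniversalEnvelopingAlgebra ℂ L) : u ∈ S := by
  let f : L →ₗ⁅ℂ⁆ S :=
    { toFun := fun x => ⟨ι ℂ x, h x⟩
      map_add' := fun x y => Subtype.ext (map_add _ _ _)
      map_smul' := fun c x => Subtype.ext (map_smul _ _ _)
      map_lie' := fun {x y} => Subtype.ext (LieHom.map_lie (ι ℂ) x y) }
  have h1 : S.val.comp (lift ℂ f) = AlgHom.id ℂ _ := by
    ext x
    change S.val (lift ℂ f (ι ℂ x)) = ι ℂ x
    rw [lift_ι_apply]
    rfl
  have h2 := congrArg (fun F : _ →ₐ[ℂ] _ => F u) h1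
  change ((lift ℂ f u : S) : UniversalEnvelopingAlgebra ℂ L) = u at h2
  rw [← h2]
  exact (lift ℂ f u).2

/-- A derivation `δ` of the Lie algebra gives the Lie algebra homomorphism `x ↦ x + ε δ(x)` to the
dual numbers over the universal enveloping algebra. -/
def dualHom (δ : L →ₗ[ℂ] L) (hδ : ∀ x y, δ ⁅x, y⁆ = ⁅δ x, y⁆ + ⁅x, δ y⁆) :
    UniversalEnvelopingAlgebra ℂ L →ₐ[ℂ] TrivSqZeroExt (UniversalEnvelopingAlgebra ℂ L)
      (UniversalEnvelopingAlgebra ℂ L) :=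
  lift ℂ
    { toFun := fun x => TrivSqZeroExt.inl (ι ℂ x) + TrivSqZeroExt.inr (ι ℂ (δ x))
      map_add' := fun x y => by ext <;> simp
      map_smul' := fun c x => by ext <;> simp
      map_lie' := fun {x y} => by
        rw [hδ]
        apply TrivSqZeroExt.ext
        · simp only [LieRing.of_associative_ring_bracket, LieHom.map_lie, TrivSqZeroExt.fst_sub,
            TrivSqZeroExt.fst_mul, TrivSqZeroExt.fst_add, TrivSqZeroExt.fst_inl,
            TrivSqZeroExt.fst_inr, add_zero]
        · simp only [LieRing.of_associative_ring_bracket, LieHom.map_lie, map_add,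
            TrivSqZeroExt.snd_sub, TrivSqZeroExt.snd_mul, TrivSqZeroExt.snd_add,
            TrivSqZeroExt.fst_add, TrivSqZeroExt.fst_inl, TrivSqZeroExt.fst_inr,
            TrivSqZeroExt.snd_inl, TrivSqZeroExt.snd_inr, add_zero, zero_add, smul_eq_mul,
            MulOpposite.smul_eq_mul_unop, MulOpposite.unop_op]
          abel }

theorem dualHom_ι {δ : L →ₗ[ℂ] L} (hδ : ∀ x y, δ ⁅x, y⁆ = ⁅δ x, y⁆ + ⁅x, δ y⁆) (x : L) :
    dualHom δ hδ (ι ℂ x) = TrivSqZeroExt.inl (ι ℂ x) + TrivSqZeroExt.inr (ι ℂ (δ x)) :=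
  lift_ι_apply _ _ _

theorem fst_dualHom {δ : L →ₗ[ℂ] L} (hδ : ∀ x y, δ ⁅x, y⁆ = ⁅δ x, y⁆ + ⁅x, δ y⁆)
    (u : UniversalEnvelopingAlgebra ℂ L) : (dualHom δ hδ u).fst = u := by
  have h1 : (TrivSqZeroExt.fstHom ℂ _ _).comp (dualHom δ hδ) = AlgHom.id ℂ _ := by
    ext x
    change (dualHom δ hδ (ι ℂ x)).fst = ι ℂ x
    rw [dualHom_ι]
    simp
  exact congrArg (fun F : _ →ₐ[ℂ] _ => F u) h1

/-- The derivation of the universal enveloping algebra that extends a derivation `δ` of the Lie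
algebra. -/
def envDer (δ : L →ₗ[ℂ] L) (hδ : ∀ x y, δ ⁅x, y⁆ = ⁅δ x, y⁆ + ⁅x, δ y⁆) :
    UniversalEnvelopingAlgebra ℂ L →ₗ[ℂ] UniversalEnvelopingAlgebra ℂ L where
  toFun u := (dualHom δ hδ u).snd
  map_add' u v := by simp
  map_smul' c u := by simp

theorem envDer_mul {δ : L →ₗ[ℂ] L} (hδ : ∀ x y, δ ⁅x, y⁆ = ⁅δ x, y⁆ + ⁅x, δ y⁆)
    (u v : UniversalEnvelopingAlgebra ℂ L) :
    envDer δ hδ (u * v) = u * envDer δ hδ v + envDer δ hδ u * v := by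
  change (dualHom δ hδ (u * v)).snd = _
  rw [map_mul, TrivSqZeroExt.snd_mul, fst_dualHom, fst_dualHom]
  rfl

theorem envDer_ι {δ : L →ₗ[ℂ] L} (hδ : ∀ x y, δ ⁅x, y⁆ = ⁅δ x, y⁆ + ⁅x, δ y⁆) (x : L) :
    envDer δ hδ (ι ℂ x) = ι ℂ (δ x) := by
  change (dualHom δ hδ (ι ℂ x)).snd = _
  rw [dualHom_ι]
  simp

theorem envDer_one {δ : L →ₗ[ℂ] L} (hδ : ∀ x y, δ ⁅x, y⁆ = ⁅δ x, y⁆ + ⁅x, δ y⁆) :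
    envDer δ hδ 1 = 0 := by
  change (dualHom δ hδ 1).snd = _
  rw [map_one, TrivSqZeroExt.snd_one]

end Enveloping

/-! ### The derivations `x(n) ↦ -n x(n+s)` of the affine Lie algebra -/

section Witt

open LieAlgebra LieAlgebra.LoopAlgebra LieModule
open scoped TensorProduct Nat

variable {𝔤 : Type*} [LieRing 𝔤] [LieAlgebra ℂ 𝔤] [FiniteDimensional ℂ 𝔤] [LieAlgebra.IsSimple ℂ 𝔤]
variable (H : LieSubalgebra ℂ 𝔤) [H.IsCartanSubalgebra]

/-- The affine Lie algebra is spanned by the `x(n)` and the central element. -/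
theorem affine_induction (P : Submodule ℂ (Affine H)) (h : ∀ x n, loopElt H x n ∈ P)
    (hc : centralElt H ∈ P) (y : Affine H) : y ∈ P := by
  obtain ⟨⟨f, z⟩, rfl⟩ := (ofProd _).surjective y
  have h1 : ∀ f : loopAlgebra ℂ ℤ 𝔤, (ofProd _ (f, 0) : Affine H) ∈ P := by
    intro f
    induction f using TensorProduct.induction_on with
    | zero => exact P.zero_mem
    | tmul p x =>
      induction p using AddMonoidAlgebra.induction_linear with
      | zero => rw [TensorProduct.zero_tmul]; exact P.zero_mem
      | add p q hp hq =>
        rw [TensorProduct.add_tmul]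
        have := P.add_mem hp hq
        rwa [← of_add, Prod.mk_add_mk, add_zero] at this
      | single n c =>
        have := P.smul_mem c (h x n)
        rwa [loopElt, ← of_smul, Prod.smul_mk, smul_zero, TensorProduct.smul_tmul',
          AddMonoidAlgebra.smul_single, smul_eq_mul, mul_one] at this
    | add f g hf hg =>
      have := P.add_mem hf hg
      rwa [← of_add, Prod.mk_add_mk, add_zero] at this
  have h2 : (ofProd _ (0, z) : Affine H) ∈ P := by
    have := P.smul_mem (TrivialLieModule.equiv ℂ (loopAlgebra ℂ ℤ 𝔤) ℂ z) hc
    rwa [centralElt, ← of_smul, Prod.smul_mk, smul_zero, ← map_smul, smul_eq_mul, mul_one,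
      LinearEquiv.symm_apply_apply] at this
  have := P.add_mem (h1 f) h2
  rwa [← of_add, Prod.mk_add_mk, add_zero, zero_add] at this

/-- The map `tⁿ ↦ -n t^{n+s}` on Laurent polynomials. -/
def laurentDer (s : ℤ) : AddMonoidAlgebra ℂ ℤ →ₗ[ℂ] AddMonoidAlgebra ℂ ℤ :=
  Finsupp.linearCombination ℂ (fun n : ℤ => AddMonoidAlgebra.single (n + s) (-(n : ℂ))) ∘ₗ
    (AddMonoidAlgebra.coeffLinearEquiv ℂ).toLinearMap

/-- The linear map `x(n) ↦ -n x(n+s)`, `c ↦ 0` on the affine Lie algebra. -/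
def wittDer (s : ℤ) : Affine H →ₗ[ℂ] Affine H where
  toFun y := ofProd _ ((laurentDer s).rTensor 𝔤 ((ofProd _).symm y).1, 0)
  map_add' x y := by
    rw [← of_add, of_symm_add, Prod.fst_add, map_add, Prod.mk_add_mk, add_zero]
  map_smul' c x := by
    rw [RingHom.id_apply, ← of_smul, of_symm_smul, Prod.smul_fst, map_smul, Prod.smul_mk, smul_zero]

theorem wittDer_loopElt (s : ℤ) (x : 𝔤) (n : ℤ) :
    wittDer H s (loopElt H x n) = -(n : ℂ) • loopElt H x (n + s) := by
  have h1 : laurentDer s (AddMonoidAlgebra.single n (1 : ℂ)) =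
      -(n : ℂ) • AddMonoidAlgebra.single (n + s) (1 : ℂ) := by
    change Finsupp.linearCombination ℂ _ (Finsupp.single n 1) = _
    rw [Finsupp.linearCombination_single, one_smul, AddMonoidAlgebra.smul_single, smul_eq_mul,
      mul_one]
  change ofProd _ ((laurentDer s).rTensor 𝔤 (AddMonoidAlgebra.single n (1 : ℂ) ⊗ₜ[ℂ] x), 0) = _
  rw [LinearMap.rTensor_tmul, h1, loopElt, ← of_smul, Prod.smul_mk, smul_zero,
    TensorProduct.smul_tmul']

theorem wittDer_centralElt (s : ℤ) : wittDer H s (centralElt H) = 0 := by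
  change ofProd _ ((laurentDer s).rTensor 𝔤 0, 0) = 0
  rw [map_zero]
  rfl

theorem wittDer_lie (s : ℤ) (x y : Affine H) :
    wittDer H s ⁅x, y⁆ = ⁅wittDer H s x, y⁆ + ⁅x, wittDer H s y⁆ := by
  have hc : ∀ z : Affine H, ⁅centralElt H, z⁆ = 0 := fun z => by
    rw [← lie_skew, lie_centralElt, neg_zero]
  let P : Affine H → Submodule ℂ (Affine H) := fun x =>
    LinearMap.ker ((wittDer H s) ∘ₗ (LieModule.toEnd ℂ (Affine H) (Affine H) x) -
      LieModule.toEnd ℂ (Affine H) (Affine H) (wittDer H s x) -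
      (LieModule.toEnd ℂ (Affine H) (Affine H) x) ∘ₗ wittDer H s)
  have hP : ∀ x y, y ∈ P x ↔ wittDer H s ⁅x, y⁆ = ⁅wittDer H s x, y⁆ + ⁅x, wittDer H s y⁆ := by
    intro x y
    rw [LinearMap.mem_ker]
    simp only [LinearMap.sub_apply, LinearMap.comp_apply, LieModule.toEnd_apply_apply]
    rw [sub_sub, sub_eq_zero]
  have hsymm : ∀ x y, y ∈ P x → x ∈ P y := by
    intro x y h
    rw [hP] at h ⊢
    have e1 : ⁅y, x⁆ = -⁅x, y⁆ := (lie_skew y x).symm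
    have e2 : ⁅wittDer H s y, x⁆ = -⁅x, wittDer H s y⁆ := (lie_skew _ _).symm
    have e3 : ⁅y, wittDer H s x⁆ = -⁅wittDer H s x, y⁆ := (lie_skew _ _).symm
    rw [e1, e2, e3, map_neg, h]
    abel
  have hcP : ∀ x, centralElt H ∈ P x := by
    intro x
    rw [hP, lie_centralElt, lie_centralElt, wittDer_centralElt, lie_zero, map_zero, add_zero]
  have h1 : ∀ a m y, y ∈ P (loopElt H a m) := by
    intro a m y
    refine affine_induction H _ (fun b n => ?_) (hcP _) y
    rw [hP, wittDer_loopElt, wittDer_loopElt, lie_smul, smul_lie, lie_loopElt, lie_loopElt,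
      lie_loopElt, map_add, map_smul, wittDer_loopElt, wittDer_centralElt,
      show m + n + s = m + s + n by ring, show m + (n + s) = m + s + n by ring]
    by_cases h0 : m + s + n = 0
    · have h2 : (m : ℂ) + s + n = 0 := by exact_mod_cast h0
      have h3 : (n : ℂ) = -m - s := by linear_combination h2
      simp only [h0, if_true]
      push_cast
      rw [h3]
      module
    · simp only [h0, if_false]
      push_cast
      module
  exact (hP x y).1 (hsymm _ _ (affine_induction H (P y) (fun a m => hsymm _ _ (h1 a m y)) (hcP y) x))

/-- The derivation `x(n) ↦ -n x(n+s)` of the universal enveloping algebra. -/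
def wittU (s : ℤ) : UAffine H →ₗ[ℂ] UAffine H := envDer (wittDer H s) (wittDer_lie H s)

theorem wittU_mul (s : ℤ) (u v : UAffine H) :
    wittU H s (u * v) = u * wittU H s v + wittU H s u * v := envDer_mul _ _ _

theorem wittU_one (s : ℤ) : wittU H s 1 = 0 := envDer_one _

theorem wittU_loopU (s : ℤ) (x : 𝔤) (n : ℤ) :
    wittU H s (loopU H x n) = -(n : ℂ) • loopU H x (n + s) := by
  rw [wittU, loopU, envDer_ι, wittDer_loopElt, map_smul]
  rfl

theorem wittU_central (s : ℤ) :
    wittU H s (UniversalEnvelopingAlgebra.ι ℂ (centralElt H)) = 0 := by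
  rw [wittU, envDer_ι, wittDer_centralElt, map_zero]

theorem wittU_algebraMap (s : ℤ) (c : ℂ) : wittU H s (algebraMap ℂ (UAffine H) c) = 0 := by
  rw [Algebra.algebraMap_eq_smul_one, map_smul, wittU_one, smul_zero]

end Witt

/-! ### The modules `M(ℓ,0)` and `L(ℓ,0)` are vacuum modules -/

section Quotients

open LieAlgebra LieAlgebra.LoopAlgebra LieModule
open scoped TensorProduct Nat

variable {𝔤 : Type*} [LieRing 𝔤] [LieAlgebra ℂ 𝔤] [FiniteDimensional ℂ 𝔤] [LieAlgebra.IsSimple ℂ 𝔤]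
variable (H : LieSubalgebra ℂ 𝔤) [H.IsCartanSubalgebra]

theorem central_mul (u : UAffine H) :
    UniversalEnvelopingAlgebra.ι ℂ (centralElt H) * u =
      u * UniversalEnvelopingAlgebra.ι ℂ (centralElt H) := by
  have h := mem_of_ι_mem
    (Subalgebra.centralizer ℂ {UniversalEnvelopingAlgebra.ι ℂ (centralElt H)}) (fun x => by
      rw [Subalgebra.mem_centralizer_iff]
      rintro g rfl
      have h := congrArg (UniversalEnvelopingAlgebra.ι ℂ) (lie_centralElt H x)
      let _ := LieRing.ofAssociativeRing (A := UAffine H)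
      let _ := LieAlgebra.ofAssociativeAlgebra (R := ℂ) (A := UAffine H)
      rw [LieHom.map_lie, map_zero] at h
      exact (sub_eq_zero.1 h).symm) u
  exact Subalgebra.mem_centralizer_iff ℂ |>.1 h _ rfl

variable {H} in
theorem smul_mem_of_modeOp_mem {V : Type*} [AddCommGroup V] [Module ℂ V] [Module (UAffine H) V]
    [IsScalarTower ℂ (UAffine H) V] {X : Submodule ℂ V}
    (hc : ∀ v ∈ X, UniversalEnvelopingAlgebra.ι ℂ (centralElt H) • v ∈ X)
    (h : ∀ x n, ∀ v ∈ X, modeOp H V x n v ∈ X) (u : UAffine H) {v : V} (hv : v ∈ X) :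
    u • v ∈ X := by
  let S : Subalgebra ℂ (UAffine H) :=
    { carrier := {u | ∀ v ∈ X, u • v ∈ X}
      mul_mem' := fun {a b} ha hb v hv => by rw [mul_smul]; exact ha _ (hb v hv)
      add_mem' := fun {a b} ha hb v hv => by rw [add_smul]; exact X.add_mem (ha v hv) (hb v hv)
      algebraMap_mem' := fun r v hv => by rw [algebraMap_smul]; exact X.smul_mem r hv }
  let i : Affine H →ₗ[ℂ] UAffine H :=
    { toFun := UniversalEnvelopingAlgebra.ι ℂ
      map_add' := map_add _
      map_smul' := map_smul _ }
  have hS : ∀ y : Affine H, UniversalEnvelopingAlgebra.ι ℂ y ∈ S := fun y =>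
    affine_induction H ((Subalgebra.toSubmodule S).comap i) (fun x n => h x n) hc y
  exact mem_of_ι_mem S hS u v hv

variable {H} {ℓ : ℂ}

/-- For `s ≥ -1` the derivation `x(n) ↦ -n x(n+s)` preserves the span of the `x(n)` with `n ≥ 0`, as
the coefficient vanishes for `n = 0`. -/
theorem wittU_mem_vermaIdeal {s : ℤ} (hs : -1 ≤ s) {u : UAffine H} (hu : u ∈ vermaIdeal H ℓ) :
    wittU H s u ∈ vermaIdeal H ℓ := by
  induction hu using Submodule.span_induction with
  | mem u hu =>
    rcases hu with ⟨x, n, hn, rfl⟩ | rfl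
    · rw [wittU_loopU]
      rcases hn.eq_or_lt with rfl | hn
      · simp
      · rw [← algebraMap_smul (UAffine H) (-(n : ℂ))]
        exact Submodule.smul_mem _ _ (Submodule.subset_span (Or.inl ⟨x, n + s, by omega, rfl⟩))
    · rw [map_sub, wittU_central, wittU_algebraMap, sub_zero]
      exact Submodule.zero_mem _
  | zero => rw [map_zero]; exact Submodule.zero_mem _
  | add u v _ _ hu hv => rw [map_add]; exact Submodule.add_mem _ hu hv
  | smul a u hu' hu =>
    rw [smul_eq_mul, wittU_mul]
    exact Submodule.add_mem _ (Submodule.smul_mem _ a hu) (Submodule.smul_mem _ _ hu')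

theorem wittU_neg_one_loopU_smul {V : Type*} [AddCommGroup V] [Module ℂ V] [Module (UAffine H) V]
    [IsScalarTower ℂ (UAffine H) V] (x : 𝔤) (n : ℤ) (v : V) :
    wittU H (-1) (loopU H x n) • v = -((n : ℂ) • modeOp H V x (n - 1) v) := by
  rw [wittU_loopU, smul_assoc, neg_smul, show n + -1 = n - 1 by ring]
  rfl

/-- The endomorphism of `U(ĝ)/K` induced by the derivation `x(n) ↦ -n x(n+s)` of `U(ĝ)`. -/
def quotDer (s : ℤ) (K : Submodule (UAffine H) (UAffine H)) (hK : ∀ u ∈ K, wittU H s u ∈ K) :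
    Module.End ℂ (UAffine H ⧸ K) :=
  (Submodule.Quotient.restrictScalarsEquiv ℂ K).toLinearMap ∘ₗ
    (K.restrictScalars ℂ).mapQ (K.restrictScalars ℂ) (wittU H s) hK ∘ₗ
      (Submodule.Quotient.restrictScalarsEquiv ℂ K).symm.toLinearMap

variable {K : Submodule (UAffine H) (UAffine H)} {s : ℤ}

theorem quotDer_mkQ (hK : ∀ u ∈ K, wittU H s u ∈ K) (u : UAffine H) :
    quotDer s K hK (K.mkQ u) = K.mkQ (wittU H s u) := rfl

theorem smul_mkQ (u v : UAffine H) : u • K.mkQ v = K.mkQ (u * v) := rfl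

theorem quotDer_smul (hK : ∀ u ∈ K, wittU H s u ∈ K) (u : UAffine H) (v : UAffine H ⧸ K) :
    quotDer s K hK (u • v) = u • quotDer s K hK v + wittU H s u • v := by
  obtain ⟨v, rfl⟩ := K.mkQ_surjective v
  rw [smul_mkQ, quotDer_mkQ, quotDer_mkQ, wittU_mul, map_add, smul_mkQ, smul_mkQ]

theorem quotDer_modeOp (hK : ∀ u ∈ K, wittU H (-1) u ∈ K) (x : 𝔤) (n : ℤ) (v : UAffine H ⧸ K) :
    quotDer (-1) K hK (modeOp H (UAffine H ⧸ K) x n v) =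
      modeOp H (UAffine H ⧸ K) x n (quotDer (-1) K hK v) -
        (n : ℂ) • modeOp H (UAffine H ⧸ K) x (n - 1) v := by
  have h := quotDer_smul hK (loopU H x n) v
  have h' := wittU_neg_one_loopU_smul (H := H) x n v
  exact (h.trans (congrArg _ h')).trans (sub_eq_add_neg _ _).symm

theorem eq_top_of_mkQ_one_mem {N : Submodule (UAffine H) (UAffine H ⧸ K)} (h : K.mkQ 1 ∈ N) :
    N = ⊤ := by
  refine eq_top_iff.2 fun v _ => ?_
  obtain ⟨v, rfl⟩ := K.mkQ_surjective v
  rw [← mul_one v, ← smul_mkQ]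
  exact N.smul_mem v h

/-- The central element acts by `ℓ` on all of `U(ĝ)/K`, not only on the generator, since it is central
in `U(ĝ)`. -/
theorem central_smul_quotient (hle : vermaIdeal H ℓ ≤ K) (v : UAffine H ⧸ K) :
    UniversalEnvelopingAlgebra.ι ℂ (centralElt H) • v = ℓ • v := by
  obtain ⟨v, rfl⟩ := K.mkQ_surjective v
  rw [smul_mkQ, central_mul, ← sub_eq_zero, ← algebraMap_smul (UAffine H) ℓ, smul_mkQ,
    Algebra.commutes, ← map_sub, ← mul_sub]
  exact (Submodule.Quotient.mk_eq_zero K).2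
    (K.smul_mem v (hle (Submodule.subset_span (Or.inr rfl))))

theorem modeOp_mkQ_one (hle : vermaIdeal H ℓ ≤ K) (x : 𝔤) {n : ℤ} (hn : 0 ≤ n) :
    modeOp H (UAffine H ⧸ K) x n (K.mkQ 1) = 0 := by
  change loopU H x n • K.mkQ 1 = 0
  rw [smul_mkQ, mul_one]
  exact (Submodule.Quotient.mk_eq_zero K).2
    (hle (Submodule.subset_span (Or.inl ⟨x, n, hn, rfl⟩)))

theorem eq_top_of_modeOp_mem (hle : vermaIdeal H ℓ ≤ K) (X : Submodule ℂ (UAffine H ⧸ K))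
    (hX : K.mkQ 1 ∈ X) (h : ∀ x n, ∀ v ∈ X, modeOp H (UAffine H ⧸ K) x n v ∈ X) : X = ⊤ := by
  refine eq_top_iff.2 fun v _ => ?_
  obtain ⟨v, rfl⟩ := K.mkQ_surjective v
  rw [← mul_one v, ← smul_mkQ]
  exact smul_mem_of_modeOp_mem
    (fun v hv => by rw [central_smul_quotient hle]; exact X.smul_mem ℓ hv) h v hX

variable (H) in
/-- The subspace of the vectors on which the fields `x(z)` are uniformly truncated. -/
def smoothPart (V : Type*) [AddCommGroup V] [Module ℂ V] [Module (UAffine H) V]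
    [IsScalarTower ℂ (UAffine H) V] : Submodule ℂ V where
  carrier := {v | ∃ N : ℤ, ∀ (x : 𝔤) (n : ℤ), N ≤ n → modeOp H V x n v = 0}
  zero_mem' := ⟨0, fun x n _ => map_zero _⟩
  add_mem' := by
    rintro v w ⟨N, hN⟩ ⟨N', hN'⟩
    refine ⟨max N N', fun x n hn => ?_⟩
    rw [map_add, hN x n (by omega), hN' x n (by omega), add_zero]
  smul_mem' := by
    rintro c v ⟨N, hN⟩
    exact ⟨N, fun x n hn => by rw [map_smul, hN x n hn, smul_zero]⟩

theorem modeOp_mem_smoothPart {V : Type*} [AddCommGroup V] [Module ℂ V] [Module (UAffine H) V]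
    [IsScalarTower ℂ (UAffine H) V]
    (hc : ∀ v : V, UniversalEnvelopingAlgebra.ι ℂ (centralElt H) • v = ℓ • v) (y : 𝔤) (m : ℤ)
    {v : V} (hv : v ∈ smoothPart H V) : modeOp H V y m v ∈ smoothPart H V := by
  obtain ⟨N, hN⟩ := hv
  refine ⟨max N (max (N - m) (1 - m)), fun x n hn => ?_⟩
  have h := congrArg (fun T : Module.End ℂ V => T v) (modeOp_mul_of_central hc x y n m)
  simp only [Module.End.mul_apply, LinearMap.add_apply] at h
  rw [h, hN x n (by omega), hN _ (n + m) (by omega), map_zero,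
    if_neg (show n + m ≠ 0 by omega), mul_zero, zero_mul, zero_smul, LinearMap.zero_apply,
    add_zero, add_zero]

/-- Every quotient of `M(ℓ,0)` by a submodule stable under the translation derivation is a vacuum
module. -/
theorem isVacuumModule_quotient (hle : vermaIdeal H ℓ ≤ K) (hK : ∀ u ∈ K, wittU H (-1) u ∈ K) :
    IsVacuumModule H ℓ (K.mkQ 1) (quotDer (-1) K hK) where
  central := central_smul_quotient hle
  smooth v := by
    have hX : smoothPart H (UAffine H ⧸ K) = ⊤ :=
      eq_top_of_modeOp_mem hle _ ⟨0, fun x n hn => modeOp_mkQ_one hle x hn⟩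
        fun y m v hv => modeOp_mem_smoothPart (central_smul_quotient hle) y m hv
    have hv : v ∈ smoothPart H (UAffine H ⧸ K) := hX ▸ Submodule.mem_top
    exact hv
  annihilates x n hn := modeOp_mkQ_one hle x hn
  cyclic := eq_top_of_modeOp_mem hle
  der := quotDer_modeOp hK
  der_vac := by rw [quotDer_mkQ, wittU_one, map_zero]

end Quotients

/-! ### The largest proper graded submodule is stable under translation -/

section Graded

open LieAlgebra LieAlgebra.LoopAlgebra LieModule
open scoped TensorProduct Nat

variable {𝔤 : Type*} [LieRing 𝔤] [LieAlgebra ℂ 𝔤] [FiniteDimensional ℂ 𝔤] [LieAlgebra.IsSimple ℂ 𝔤]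
variable {H : LieSubalgebra ℂ 𝔤} [H.IsCartanSubalgebra]

section Negative

variable {V : Type*} [AddCommGroup V] [Module ℂ V] [Module (UAffine H) V]
  [IsScalarTower ℂ (UAffine H) V] {ℓ : ℂ} {o : V} {D : Module.End ℂ V}

variable (H) in
/-- The span of the vectors `x₁(n₁) ⋯ x_k(n_k) o` with `k ≤ r` and all `n_i` negative. -/
def negSpan (o : V) (r : ℕ) : Submodule ℂ V :=
  Submodule.span ℂ {v | ∃ p : List (𝔤 × ℤ), p.length ≤ r ∧ (∀ q ∈ p, q.2 < 0) ∧
    v = (p.map fun q => loopU H q.1 q.2).prod • o}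

theorem negSpan_mono {r r' : ℕ} (h : r ≤ r') : negSpan H o r ≤ negSpan H o r' :=
  Submodule.span_mono fun _ ⟨p, h1, h2, h3⟩ => ⟨p, h1.trans h, h2, h3⟩

theorem modeOp_mem_negSpan_succ {r : ℕ} (x : 𝔤) {n : ℤ} (hn : n < 0) {v : V}
    (hv : v ∈ negSpan H o r) : modeOp H V x n v ∈ negSpan H o (r + 1) := by
  induction hv using Submodule.span_induction with
  | mem v hv =>
    obtain ⟨p, h1, h2, rfl⟩ := hv
    refine Submodule.subset_span ⟨(x, n) :: p, by simpa using h1, ?_, ?_⟩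
    · simpa using ⟨hn, fun a b hab => h2 (a, b) hab⟩
    · rw [List.map_cons, List.prod_cons, mul_smul]
      rfl
  | zero => rw [map_zero]; exact Submodule.zero_mem _
  | add u v _ _ hu hv => rw [map_add]; exact Submodule.add_mem _ hu hv
  | smul c u _ hu => rw [map_smul]; exact Submodule.smul_mem _ c hu

/-- Nonnegative modes do not increase the length filtration of the span of negative monomials. -/
theorem IsVacuumModule.modeOp_mem_negSpan (hV : IsVacuumModule H ℓ o D) {r : ℕ} :
    ∀ (x : 𝔤) {n : ℤ}, 0 ≤ n → ∀ {v : V}, v ∈ negSpan H o r → modeOp H V x n v ∈ negSpan H o r := by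
  induction r with
  | zero =>
    intro x n hn v hv
    induction hv using Submodule.span_induction with
    | mem v hv =>
      obtain ⟨p, h1, -, rfl⟩ := hv
      obtain rfl : p = [] := List.length_eq_zero_iff.1 (Nat.le_zero.1 h1)
      rw [List.map_nil, List.prod_nil, one_smul, hV.annihilates x n hn]
      exact Submodule.zero_mem _
    | zero => rw [map_zero]; exact Submodule.zero_mem _
    | add u v _ _ hu hv => rw [map_add]; exact Submodule.add_mem _ hu hv
    | smul c u _ hu => rw [map_smul]; exact Submodule.smul_mem _ c hu
  | succ r ih =>
    intro x n hn v hv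
    induction hv using Submodule.span_induction with
    | mem v hv =>
      obtain ⟨p, h1, h2, rfl⟩ := hv
      rcases p with _ | ⟨⟨y, m⟩, p⟩
      · rw [List.map_nil, List.prod_nil, one_smul, hV.annihilates x n hn]
        exact Submodule.zero_mem _
      · have hm : m < 0 := h2 (y, m) List.mem_cons_self
        have hp : (p.map fun q => loopU H q.1 q.2).prod • o ∈ negSpan H o r :=
          Submodule.subset_span
            ⟨p, by simpa using h1, fun q hq => h2 q (List.mem_cons_of_mem _ hq), rfl⟩
        rw [List.map_cons, List.prod_cons, mul_smul]
        change modeOp H V x n (modeOp H V y m _) ∈ _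
        rw [hV.modeOp_modeOp]
        refine Submodule.add_mem _ (Submodule.add_mem _ ?_ ?_) ?_
        · exact modeOp_mem_negSpan_succ y hm (ih x hn hp)
        · rcases lt_or_ge (n + m) 0 with h | h
          · exact modeOp_mem_negSpan_succ _ h hp
          · exact negSpan_mono r.le_succ (ih _ h hp)
        · exact Submodule.smul_mem _ _ (negSpan_mono r.le_succ hp)
    | zero => rw [map_zero]; exact Submodule.zero_mem _
    | add u v _ _ hu hv => rw [map_add]; exact Submodule.add_mem _ hu hv
    | smul c u _ hu => rw [map_smul]; exact Submodule.smul_mem _ c hu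

theorem IsVacuumModule.iSup_negSpan (hV : IsVacuumModule H ℓ o D) : ⨆ r, negSpan H o r = ⊤ := by
  have hdir : Directed (· ≤ ·) (negSpan H o) :=
    (show Monotone (negSpan H o) from fun _ _ h => negSpan_mono h).directed_le
  refine hV.cyclic _ ?_ ?_
  · exact Submodule.mem_iSup_of_mem 0 (Submodule.subset_span ⟨[], le_rfl, by simp, by simp⟩)
  · intro x n v hv
    obtain ⟨r, hr⟩ := (Submodule.mem_iSup_of_directed _ hdir).1 hv
    rcases lt_or_ge n 0 with h | h
    · exact Submodule.mem_iSup_of_mem (r + 1) (modeOp_mem_negSpan_succ x h hr)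
    · exact Submodule.mem_iSup_of_mem r (hV.modeOp_mem_negSpan x h hr)

end Negative

variable (H) (ℓ : ℂ)

/-- The translation operator of `M(ℓ,0)`. -/
def vermaDer : Module.End ℂ (GenVerma H ℓ) :=
  quotDer (-1) (vermaIdeal H ℓ) fun _ => wittU_mem_vermaIdeal le_rfl

/-- The degree operator of `M(ℓ,0)`. -/
def vermaDeg : Module.End ℂ (GenVerma H ℓ) :=
  quotDer 0 (vermaIdeal H ℓ) fun _ => wittU_mem_vermaIdeal (by norm_num)

theorem isVacuumModule_genVerma :
    IsVacuumModule H ℓ ((vermaIdeal H ℓ).mkQ 1) (vermaDer H ℓ) :=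
  isVacuumModule_quotient le_rfl _

/-- The sum of the homogeneous parts of positive degree of `M(ℓ,0)`. -/
def positivePart : Submodule ℂ (GenVerma H ℓ) := ⨆ (d : ℤ) (_ : 1 ≤ d), degreePart H ℓ d

theorem degreePart_le_eigenspace (d : ℤ) :
    degreePart H ℓ d ≤ (vermaDeg H ℓ).eigenspace (d : ℂ) := by
  have key : ∀ p : List (𝔤 × ℤ), wittU H 0 ((p.map fun q => loopU H q.1 q.2).prod) =
      (-((p.map Prod.snd).sum : ℤ) : ℂ) • (p.map fun q => loopU H q.1 q.2).prod := by
    intro p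
    induction p with
    | nil => simp [wittU_one]
    | cons q p ih =>
      simp only [List.map_cons, List.prod_cons, List.sum_cons]
      rw [wittU_mul, ih, wittU_loopU, add_zero, mul_smul_comm, smul_mul_assoc, ← add_smul]
      congr 1
      push_cast
      ring
  refine Submodule.span_le.2 ?_
  rintro v ⟨p, hp, rfl⟩
  refine Module.End.mem_eigenspace_iff.2 ?_
  rw [vermaDeg, quotDer_mkQ, key, hp]
  push_cast
  rw [neg_neg]
  rfl

theorem vac_mem_degreePart : (vermaIdeal H ℓ).mkQ 1 ∈ degreePart H ℓ 0 :=
  Submodule.subset_span ⟨[], by simp, by simp⟩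

/-- The easy half of the Poincaré-Birkhoff-Witt theorem: `M(ℓ,0)` is spanned by monomials in negative
modes. -/
theorem span_vac_sup_positivePart :
    Submodule.span ℂ {(vermaIdeal H ℓ).mkQ 1} ⊔ positivePart H ℓ = ⊤ := by
  rw [eq_top_iff, ← (isVacuumModule_genVerma H ℓ).iSup_negSpan]
  refine iSup_le fun r => Submodule.span_le.2 ?_
  rintro v ⟨p, -, hp, rfl⟩
  rcases p with _ | ⟨q, p⟩
  · rw [List.map_nil, List.prod_nil, one_smul]
    exact Submodule.mem_sup_left (Submodule.mem_span_singleton_self _)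
  · have h1 : ∀ p : List (𝔤 × ℤ), (∀ q ∈ p, q.2 < 0) → (p.map Prod.snd).sum ≤ 0 := by
      intro p hp
      induction p with
      | nil => simp
      | cons q p ih =>
        have := hp q List.mem_cons_self
        have := ih fun q hq => hp q (List.mem_cons_of_mem _ hq)
        simp only [List.map_cons, List.sum_cons]
        omega
    have h2 := h1 p fun q hq => hp q (List.mem_cons_of_mem _ hq)
    have h3 := hp q List.mem_cons_self
    refine Submodule.mem_sup_right ?_
    refine Submodule.mem_iSup_of_mem (-((q :: p).map Prod.snd).sum)
      (Submodule.mem_iSup_of_mem ?_ (Submodule.subset_span ⟨q :: p, by simp, ?_⟩))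
    · simp only [List.map_cons, List.sum_cons]
      omega
    · rw [smul_mkQ, mul_one]

theorem positivePart_le_iSup_eigenspace {μ : ℂ} (hμ : ∀ d : ℤ, 1 ≤ d → (d : ℂ) ≠ μ) :
    positivePart H ℓ ≤ ⨆ (ν : ℂ) (_ : ν ≠ μ), (vermaDeg H ℓ).eigenspace ν :=
  iSup₂_le fun d hd => (degreePart_le_eigenspace H ℓ d).trans
    (le_iSup₂_of_le (d : ℂ) (hμ d hd) le_rfl)

/-- The homogeneous parts of degree `≤ 0` contain only multiples of the vacuum: they lie in eigenspaces
of the degree operator, and these are independent. -/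
theorem degreePart_le_span_vac {d : ℤ} (hd : d ≤ 0) :
    degreePart H ℓ d ≤ Submodule.span ℂ {(vermaIdeal H ℓ).mkQ 1} := by
  intro v hv
  have hE := degreePart_le_eigenspace H ℓ d hv
  have h0 := degreePart_le_eigenspace H ℓ 0 (vac_mem_degreePart H ℓ)
  have hne : ∀ e : ℤ, 1 ≤ e → (e : ℂ) ≠ (d : ℂ) := fun e he h => by
    have : e = d := by exact_mod_cast h
    omega
  have hdisj := Module.End.eigenspaces_iSupIndep (vermaDeg H ℓ) (d : ℂ)
  have htop : v ∈ Submodule.span ℂ {(vermaIdeal H ℓ).mkQ 1} ⊔ positivePart H ℓ := by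
    rw [span_vac_sup_positivePart]; exact Submodule.mem_top
  obtain ⟨y, hy, z, hz, rfl⟩ := Submodule.mem_sup.1 htop
  have hz' := positivePart_le_iSup_eigenspace H ℓ hne hz
  have hy' : y ∈ (vermaDeg H ℓ).eigenspace ((0 : ℤ) : ℂ) :=
    (Submodule.span_singleton_le_iff_mem _ _).2 h0 hy
  by_cases h : d = 0
  · subst h
    have : z ∈ (vermaDeg H ℓ).eigenspace ((0 : ℤ) : ℂ) := by
      simpa using Submodule.sub_mem _ hE hy'
    rw [Submodule.disjoint_def.1 hdisj z this hz', add_zero]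
    exact hy
  · have : y ∈ ⨆ (ν : ℂ) (_ : ν ≠ (d : ℂ)), (vermaDeg H ℓ).eigenspace ν :=
      Submodule.mem_iSup_of_mem _ (Submodule.mem_iSup_of_mem
        (fun h' => h (by exact_mod_cast h'.symm)) hy')
    rw [Submodule.disjoint_def.1 hdisj _ hE (Submodule.add_mem _ this hz')]
    exact Submodule.zero_mem _

theorem vermaDer_mem_degreePart {d : ℤ} {v : GenVerma H ℓ} (hv : v ∈ degreePart H ℓ d) :
    vermaDer H ℓ v ∈ degreePart H ℓ (d + 1) := by
  have key : ∀ p : List (𝔤 × ℤ), wittU H (-1) ((p.map fun q => loopU H q.1 q.2).prod) ∈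
      Submodule.span ℂ {u | ∃ p' : List (𝔤 × ℤ),
        (p'.map Prod.snd).sum = (p.map Prod.snd).sum - 1 ∧
          u = (p'.map fun q => loopU H q.1 q.2).prod} := by
    intro p
    induction p with
    | nil => simp [wittU_one]
    | cons q p ih =>
      simp only [List.map_cons, List.prod_cons, List.sum_cons]
      rw [wittU_mul, wittU_loopU]
      refine Submodule.add_mem _ ?_ ?_
      · generalize wittU H (-1) ((p.map fun q => loopU H q.1 q.2).prod) = u at ih
        induction ih using Submodule.span_induction with
        | mem u hu =>
          obtain ⟨p', hp', rfl⟩ := hu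
          refine Submodule.subset_span ⟨q :: p', ?_, by simp⟩
          simp only [List.map_cons, List.sum_cons, hp']
          ring
        | zero => rw [mul_zero]; exact Submodule.zero_mem _
        | add u v _ _ hu hv => rw [mul_add]; exact Submodule.add_mem _ hu hv
        | smul c u _ hu => rw [mul_smul_comm]; exact Submodule.smul_mem _ c hu
      · rw [smul_mul_assoc]
        refine Submodule.smul_mem _ _ (Submodule.subset_span ⟨(q.1, q.2 + -1) :: p, ?_, by simp⟩)
        simp only [List.map_cons, List.sum_cons]
        ring
  induction hv using Submodule.span_induction with
  | mem v hv =>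
    obtain ⟨p, hp, rfl⟩ := hv
    rw [vermaDer, quotDer_mkQ]
    have h := key p
    rw [hp] at h
    generalize wittU H (-1) ((p.map fun q => loopU H q.1 q.2).prod) = u at h
    induction h using Submodule.span_induction with
    | mem u hu =>
      obtain ⟨p', hp', rfl⟩ := hu
      exact Submodule.subset_span ⟨p', by rw [hp']; ring, rfl⟩
    | zero => rw [map_zero]; exact Submodule.zero_mem _
    | add u v _ _ hu hv => rw [map_add]; exact Submodule.add_mem _ hu hv
    | smul c u _ hu => exact Submodule.smul_mem _ c hu
  | zero => rw [map_zero]; exact Submodule.zero_mem _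
  | add u v _ _ hu hv => rw [map_add]; exact Submodule.add_mem _ hu hv
  | smul c u _ hu => rw [map_smul]; exact Submodule.smul_mem _ c hu

theorem vermaDer_mem_positivePart {v : GenVerma H ℓ} (hv : v ∈ positivePart H ℓ) :
    vermaDer H ℓ v ∈ positivePart H ℓ := by
  have : positivePart H ℓ ≤ (positivePart H ℓ).comap (vermaDer H ℓ) :=
    iSup₂_le fun d hd w hw => Submodule.mem_iSup_of_mem (d + 1)
      (Submodule.mem_iSup_of_mem (by omega) (vermaDer_mem_degreePart H ℓ hw))
  exact this hv

variable {H ℓ}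

/-- A proper graded submodule has no component in degree `≤ 0`, since the vacuum generates `M(ℓ,0)`. -/
theorem IsGradedSub.le_positivePart {N : Submodule (UAffine H) (GenVerma H ℓ)}
    (hN : IsGradedSub H ℓ N) (hne : N ≠ ⊤) : N.restrictScalars ℂ ≤ positivePart H ℓ := by
  rw [hN]
  refine iSup_le fun d => ?_
  rcases lt_or_ge 0 d with hd | hd
  · exact inf_le_right.trans (le_iSup₂_of_le d hd le_rfl)
  · rintro v ⟨hv, hv'⟩
    obtain ⟨c, rfl⟩ := Submodule.mem_span_singleton.1 (degreePart_le_span_vac H ℓ hd hv')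
    by_cases hc : c = 0
    · rw [hc, zero_smul]; exact Submodule.zero_mem _
    · refine absurd (eq_top_of_mkQ_one_mem ?_) hne
      have := (N.restrictScalars ℂ).smul_mem c⁻¹ hv
      rwa [smul_smul, inv_mul_cancel₀ hc, one_smul] at this

/-- The submodule `N + D N`, where `D` is the translation operator. -/
def derHull (N : Submodule (UAffine H) (GenVerma H ℓ)) :
    Submodule (UAffine H) (GenVerma H ℓ) where
  toAddSubmonoid :=
    (N.restrictScalars ℂ ⊔ (N.restrictScalars ℂ).map (vermaDer H ℓ)).toAddSubmonoid
  smul_mem' := by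
    intro u v hv
    obtain ⟨y, hy, _, ⟨z, hz, rfl⟩, rfl⟩ := Submodule.mem_sup.1 hv
    have h : u • vermaDer H ℓ z = vermaDer H ℓ (u • z) - wittU H (-1) u • z := by
      rw [vermaDer, quotDer_smul, add_sub_cancel_right]
    rw [smul_add, h, ← add_sub_assoc, add_sub_right_comm]
    exact Submodule.add_mem_sup (N.sub_mem (N.smul_mem u hy) (N.smul_mem _ hz))
      (Submodule.mem_map_of_mem (N.smul_mem u hz))

theorem derHull_restrictScalars (N : Submodule (UAffine H) (GenVerma H ℓ)) :
    (derHull N).restrictScalars ℂ =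
      N.restrictScalars ℂ ⊔ (N.restrictScalars ℂ).map (vermaDer H ℓ) := rfl

theorem IsGradedSub.derHull {N : Submodule (UAffine H) (GenVerma H ℓ)}
    (hN : IsGradedSub H ℓ N) : IsGradedSub H ℓ (derHull N) := by
  refine le_antisymm ?_ (iSup_le fun d => inf_le_left)
  conv_lhs => rw [derHull_restrictScalars]
  refine sup_le ?_ ?_
  · conv_lhs => rw [hN]
    exact iSup_mono fun d => inf_le_inf_right _ le_sup_left
  · conv_lhs => rw [hN, Submodule.map_iSup]
    refine iSup_le fun d => le_iSup_of_le (d + 1) ?_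
    rintro _ ⟨v, ⟨hv, hv'⟩, rfl⟩
    exact ⟨Submodule.mem_sup_right (Submodule.mem_map_of_mem hv),
      vermaDer_mem_degreePart H ℓ hv'⟩

theorem IsGradedSub.derHull_ne_top {N : Submodule (UAffine H) (GenVerma H ℓ)}
    (hN : IsGradedSub H ℓ N) (hne : N ≠ ⊤) : ZAlgebra.derHull N ≠ ⊤ := by
  intro h
  have h1 : (ZAlgebra.derHull N).restrictScalars ℂ ≤ positivePart H ℓ := by
    rw [derHull_restrictScalars]
    refine sup_le (hN.le_positivePart hne) ?_
    rintro _ ⟨v, hv, rfl⟩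
    exact vermaDer_mem_positivePart H ℓ (hN.le_positivePart hne hv)
  have h2 : (vermaIdeal H ℓ).mkQ 1 ∈ positivePart H ℓ := h1 (h ▸ Submodule.mem_top)
  have h3 := positivePart_le_iSup_eigenspace H ℓ (μ := ((0 : ℤ) : ℂ)) (fun d hd h => by
    have : d = 0 := by exact_mod_cast h
    omega) h2
  have h4 := Submodule.disjoint_def.1 (Module.End.eigenspaces_iSupIndep (vermaDeg H ℓ) _) _
    (degreePart_le_eigenspace H ℓ 0 (vac_mem_degreePart H ℓ)) h3
  exact hne (eq_top_of_mkQ_one_mem (h4 ▸ N.zero_mem))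

/-- The sum of all proper graded submodules `N` is stable under the translation operator, because
`derHull N` is again one. -/
theorem vermaDer_mem_maxGradedSub {v : GenVerma H ℓ} (hv : v ∈ maxGradedSub H ℓ) :
    vermaDer H ℓ v ∈ maxGradedSub H ℓ := by
  let Y : Submodule (UAffine H) (GenVerma H ℓ) :=
    { carrier := {v | v ∈ maxGradedSub H ℓ ∧ vermaDer H ℓ v ∈ maxGradedSub H ℓ}
      zero_mem' := ⟨Submodule.zero_mem _, by rw [map_zero]; exact Submodule.zero_mem _⟩
      add_mem' := fun {a b} ha hb => ⟨Submodule.add_mem _ ha.1 hb.1, by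
        rw [map_add]; exact Submodule.add_mem _ ha.2 hb.2⟩
      smul_mem' := fun u v hv => ⟨Submodule.smul_mem _ u hv.1, by
        rw [vermaDer, quotDer_smul]
        exact Submodule.add_mem _ (Submodule.smul_mem _ u hv.2) (Submodule.smul_mem _ _ hv.1)⟩ }
  have h : maxGradedSub H ℓ ≤ Y := by
    refine sSup_le ?_
    rintro N ⟨hN, hne⟩ v hv
    have h1 : N ≤ maxGradedSub H ℓ :=
      le_sSup (show N ∈ {N | IsGradedSub H ℓ N ∧ N ≠ ⊤} from ⟨hN, hne⟩)
    have h2 : derHull N ≤ maxGradedSub H ℓ :=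
      le_sSup (show derHull N ∈ {N | IsGradedSub H ℓ N ∧ N ≠ ⊤} from
        ⟨hN.derHull, hN.derHull_ne_top hne⟩)
    have h3 : vermaDer H ℓ v ∈
        N.restrictScalars ℂ ⊔ (N.restrictScalars ℂ).map (vermaDer H ℓ) :=
      Submodule.mem_sup_right (Submodule.mem_map_of_mem hv)
    exact ⟨h1 hv, h2 h3⟩
  exact (h hv).2

theorem vermaIdeal_le_simpleIdeal : vermaIdeal H ℓ ≤ simpleIdeal H ℓ := by
  intro u hu
  change (vermaIdeal H ℓ).mkQ u ∈ maxGradedSub H ℓ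
  have h : (vermaIdeal H ℓ).mkQ u = 0 := (Submodule.Quotient.mk_eq_zero _).2 hu
  rw [h]
  exact Submodule.zero_mem _

theorem wittU_mem_simpleIdeal {u : UAffine H} (hu : u ∈ simpleIdeal H ℓ) :
    wittU H (-1) u ∈ simpleIdeal H ℓ :=
  vermaDer_mem_maxGradedSub (v := (vermaIdeal H ℓ).mkQ u) hu

end Graded

end ZAlgebra

theorem theorem4p9 {𝔤 : Type*} [LieRing 𝔤] [LieAlgebra ℂ 𝔤] [FiniteDimensional ℂ 𝔤]
    [LieAlgebra.IsSimple ℂ 𝔤] (H : LieSubalgebra ℂ 𝔤) [H.IsCartanSubalgebra]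
    (ℓ : ℂ) (hℓ : ℓ ≠ 0)
    -- `V = U(ĝ) / K` is `M(ℓ,0)` or `L(ℓ,0)`, with highest weight vector `K.mkQ 1`
    (K : Submodule (ZAlgebra.UAffine H) (ZAlgebra.UAffine H))
    (hK : K = ZAlgebra.vermaIdeal H ℓ ∨ K = ZAlgebra.simpleIdeal H ℓ) :
    K.mkQ 1 ∈ ZAlgebra.vacuumSpace H (ZAlgebra.UAffine H ⧸ K) ∧
    (∀ α ∈ H.root, ∀ a ∈ LieAlgebra.rootSpace H α,
      ZAlgebra.modeOp H (ZAlgebra.UAffine H ⧸ K) a (-1) (K.mkQ 1) ∈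
        ZAlgebra.vacuumSpace H (ZAlgebra.UAffine H ⧸ K)) ∧
    ∃ S : ZAlgebra.GenVertexAlgebra (ZAlgebra.latticeForms H ℓ)
        (ZAlgebra.vacuumWeightSpace H (ZAlgebra.UAffine H ⧸ K)),
      (S.vac : ZAlgebra.UAffine H ⧸ K) = K.mkQ 1 ∧
      ZAlgebra.HasPsiFields H (K.mkQ 1) S ∧
      (∀ S' : ZAlgebra.GenVertexAlgebra (ZAlgebra.latticeForms H ℓ)
          (ZAlgebra.vacuumWeightSpace H (ZAlgebra.UAffine H ⧸ K)),
        ZAlgebra.HasPsiFields H (K.mkQ 1) S' → S' = S) ∧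
      S.GeneratedBy {u | ∃ α ∈ H.root, ∃ a ∈ LieAlgebra.rootSpace H α,
        (u : ZAlgebra.UAffine H ⧸ K) =
          ZAlgebra.modeOp H (ZAlgebra.UAffine H ⧸ K) a (-1) (K.mkQ 1)} := by
  have hle : ZAlgebra.vermaIdeal H ℓ ≤ K := by
    rcases hK with rfl | rfl
    · exact le_rfl
    · exact ZAlgebra.vermaIdeal_le_simpleIdeal
  have hD : ∀ u ∈ K, ZAlgebra.wittU H (-1) u ∈ K := by
    rcases hK with rfl | rfl
    · exact fun _ => ZAlgebra.wittU_mem_vermaIdeal le_rfl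
    · exact fun _ => ZAlgebra.wittU_mem_simpleIdeal
  have hV := ZAlgebra.isVacuumModule_quotient hle hD
  refine ⟨hV.vacuumVector.2, fun α hα a ha => ?_, hV.exists_unique_genVertexAlgebra hℓ⟩
  rw [← hV.psi_neg_one_vac hℓ ⟨⟨α, hα⟩, ⟨a, ha⟩⟩]
  exact Subtype.property _
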